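/- **Setting.** Let $1\le n\le m$ and let $\Lambda_{m,n}$ be the set of $n$-element subsets $S$ of the $m$ modes (the occupied modes). An $n$-fermion state is a unit vector $|\Psi\rangle=\sum_{S\in\Lambda_{m,n}}\alpha_S|S\rangle$; measuring it in the standard basis yields $S$ with probability $|\alpha_S|^2$. An $m\times m$ unitary $V$ acts on such states by $\langle S|\varphi(V)|T\rangle=\det(V_{S,T})$, where $V_{S,T}$ is the submatrix of $V$ with rows $S$ and columns $T$. A state of $n$ non-interacting fermions in $m$ modes is $|\Psi\rangle=\varphi(U)|1_n\rangle$ for some $m\times m$ unitary $U$, where $|1_n\rangle$ has exactly the first $n$ modes occupied. If $A\in\mathbb C^{m\times n}$ consists of the first $n$ columns of $U$ and $K=AA^\dagger$, then the distribution of $|\Psi\rangle$ over the standard basis is $\mathcal D_K$, where $\mathcal D_K(S)=\det(K_S)$ and $K_S$ is the principal submatrix of $K$ on $S$. The matrices $\hat K=\hat A\hat A^\dagger$, where $\hat A\in\mathbb C^{m\times n}$ has orthonormal columns, are exactly the kernels of non-interacting fermion distributions $\mathcal D_{\hat K}$. The total variation distance is $d_{\mathrm{TV}}(p,q)=\frac12\sum_S|p_S-q_S|$.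 **Model.** An algorithm is one fixed finite program, the same for all $m,n,\varepsilon,\delta$, for a random access machine that works with natural-number indices and exact complex numbers. Each assignment, index addition or (truncated) subtraction, arithmetic operation $+,-,\times,/$, complex conjugation, comparison, control step, appending of a beamsplitter or phaseshifter to a measurement network, emptying of that network, request for a measurement, and reading of one mode of the latest measurement outcome costs one unit of classical time. A measurement takes a fresh copy of $|\Psi\rangle$, applies $\varphi(V)$, where $V$ is the product of the gates in the current network, and measures in the standard basis; the unitary $V$ specifies the measurement basis. **Theorem (Main result).** There are an algorithm and an absolute constant $C>0$ such that the following holds for all integers $m$ and $n\ge1$, every state $|\Psi\rangle$ of $n$ non-interacting fermions in $m$ modes (so that $n\le m$), with standard-basis distribution $\mathcal D_K$, and all $\varepsilon\in(0,1]$ and $\delta\in(0,1)$. Put $L=\max\{1,\log(1/\delta)\}$. Given $m,n,\varepsilon,\delta$ and access to copies of $|\Psi\rangle$, the algorithm always halts within classical time $C\,m^3n^2L/\varepsilon^2$, uses at most $C\,m^2n^2L/\varepsilon^2$ copies of $|\Psi\rangle$ and at most $C\,m$ different measurement bases, and outputs an $m\times m$ matrix $\hat K$ such that, with probability at least $1-\delta$,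 $\hat K$ is the kernel of a non-interacting fermion distribution ($\hat K=\hat A\hat A^\dagger$ with $\hat A\in\mathbb C^{m\times n}$, $\hat A^\dagger\hat A=I$) and $d_{\mathrm{TV}}(\mathcal D_{\hat K},\mathcal D_K)\le\varepsilon$. -/

import Mathlib

open scoped Matrix

namespace FermionLearning

noncomputable section

/-! ### Fermionic Fock space with `n` particles in `m` modes -/

/-- The set `Λ_{m,n}` of configurations: which `n` of the `m` modes are occupied. -/
abbrev Occ (m n : ℕ) : Type := Set.powersetCard (Fin m) n

/-- The increasing enumeration of the occupied modes of a configuration. -/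
def Occ.emb {m n : ℕ} (S : Occ m n) : Fin n → Fin m :=
  Set.powersetCard.ofFinEmbEquiv.symm S

/-- The Cauchy–Binet formula. -/
theorem det_mul_eq_sum {m n : ℕ} (A : Matrix (Fin n) (Fin m) ℂ) (B : Matrix (Fin m) (Fin n) ℂ) :
    (A * B).det = ∑ S : Occ m n, (A.submatrix id S.emb).det * (B.submatrix S.emb id).det := by
  classical
  let b := Pi.basisFun ℂ (Fin m)
  let f : Fin n → Module.Dual ℂ (Fin m → ℂ) := fun j => ∑ k, B k j • b.coord k
  let x := exteriorPower.ιMulti ℂ n (fun i => A i)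
  have hf : ∀ (v : Fin n → Fin m → ℂ),
      exteriorPower.pairingDual ℂ (Fin m → ℂ) n (exteriorPower.ιMulti ℂ n f)
        (exteriorPower.ιMulti ℂ n v) = (Matrix.of fun i j => f j (v i)).det := by
    intro v
    simp [exteriorPower.pairingDual_ιMulti_ιMulti]
  have h1 := (b.exteriorPower n).sum_repr x
  have h2 := congrArg (exteriorPower.pairingDual ℂ (Fin m → ℂ) n (exteriorPower.ιMulti ℂ n f)) h1
  rw [map_sum, hf] at h2
  have h3 : (Matrix.of fun i j => f j (A i)) = A * B := by
    ext i j
    simp [f, b, Matrix.mul_apply, mul_comm]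
  rw [h3] at h2
  rw [← h2]
  refine Finset.sum_congr rfl fun S _ => ?_
  rw [map_smul, exteriorPower.basis_repr_apply, exteriorPower.ιMultiDual_apply_ιMulti,
    exteriorPower.basis_apply, exteriorPower.ιMulti_family, hf, smul_eq_mul]
  congr 2
  ext i j
  simp [f, b, Occ.emb, Pi.single_apply]

/-- The `n`-particle lift `φ(V)` of a one-particle operator `V`: `⟨S|φ(V)|T⟩ = det V_{S,T}`. -/
def lift {m : ℕ} (n : ℕ) (V : Matrix (Fin m) (Fin m) ℂ) : Matrix (Occ m n) (Occ m n) ℂ :=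
  Matrix.of fun S T => (V.submatrix S.emb T.emb).det

theorem lift_mul {m n : ℕ} (V W : Matrix (Fin m) (Fin m) ℂ) :
    lift n (V * W) = lift n V * lift n W := by
  ext S T
  simp only [lift, Matrix.of_apply, Matrix.mul_apply]
  rw [Matrix.submatrix_mul V W S.emb id T.emb Function.bijective_id, det_mul_eq_sum]
  rfl

theorem lift_conjTranspose {m n : ℕ} (V : Matrix (Fin m) (Fin m) ℂ) :
    lift n Vᴴ = (lift n V)ᴴ := by
  ext S T
  simp only [lift, Matrix.of_apply, Matrix.conjTranspose_apply]
  rw [← Matrix.det_conjTranspose, Matrix.conjTranspose_submatrix]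

open Classical in
theorem lift_one {m n : ℕ} : lift n (1 : Matrix (Fin m) (Fin m) ℂ) = 1 := by
  ext S T
  simp only [lift, Matrix.of_apply]
  by_cases h : S = T
  · subst h
    have hinj : Function.Injective S.emb := (Set.powersetCard.ofFinEmbEquiv.symm S).injective
    rw [Matrix.submatrix_one _ hinj, Matrix.det_one, Matrix.one_apply_eq]
  · rw [Matrix.one_apply_ne h]
    obtain ⟨i, his, hit⟩ := (Set.powersetCard.exists_mem_notMem_iff_ne S T).mp h
    obtain ⟨k, rfl⟩ := (Set.powersetCard.mem_range_ofFinEmbEquiv_symm_iff_mem S i).mpr his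
    refine Matrix.det_eq_zero_of_row_eq_zero k fun j => ?_
    rw [Matrix.submatrix_apply, Matrix.one_apply_ne]
    intro hkj
    apply hit
    rw [← Set.powersetCard.mem_range_ofFinEmbEquiv_symm_iff_mem]
    exact ⟨j, hkj.symm⟩

/-- A pure `n`-fermion state: a unit vector `∑_S α_S |S⟩`. -/
structure FockState (m n : ℕ) where
  amp : Occ m n → ℂ
  norm_eq_one : ∑ S, ‖amp S‖ ^ 2 = 1

theorem sum_norm_sq_mulVec {ι : Type*} [Fintype ι] [DecidableEq ι] (M : Matrix ι ι ℂ)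
    (hM : Mᴴ * M = 1) (v : ι → ℂ) : ∑ i, ‖(M *ᵥ v) i‖ ^ 2 = ∑ i, ‖v i‖ ^ 2 := by
  have key : ∀ w : ι → ℂ, ((∑ i, ‖w i‖ ^ 2 : ℝ) : ℂ) = star w ⬝ᵥ w := by
    intro w
    simp only [dotProduct, Pi.star_apply, Complex.ofReal_sum, Complex.ofReal_pow]
    exact Finset.sum_congr rfl fun i _ => (Complex.conj_mul' (w i)).symm
  have h : star (M *ᵥ v) ⬝ᵥ (M *ᵥ v) = star v ⬝ᵥ v := by
    rw [Matrix.star_mulVec, Matrix.dotProduct_mulVec, Matrix.vecMul_vecMul, hM, Matrix.vecMul_one]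
  rw [← key, ← key] at h
  exact_mod_cast h

/-- The state `φ(V)|ψ⟩`. -/
def FockState.evolve {m n : ℕ} (V : Matrix.unitaryGroup (Fin m) ℂ) (ψ : FockState m n) :
    FockState m n where
  amp := lift n V.1 *ᵥ ψ.amp
  norm_eq_one := by
    classical
    rw [sum_norm_sq_mulVec, ψ.norm_eq_one]
    rw [← lift_conjTranspose, ← lift_mul, ← Matrix.star_eq_conjTranspose,
      Matrix.UnitaryGroup.star_mul_self, lift_one]

open Classical in
/-- The standard initial state `|1_n⟩`: the first `n` of the `m` modes are occupied. -/
def FockState.initial {m n : ℕ} (h : n ≤ m) : FockState m n where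
  amp S := if S = Set.powersetCard.ofFinEmb n (Fin m) (Fin.castLEEmb h) then 1 else 0
  norm_eq_one := by
    rw [Finset.sum_eq_single (Set.powersetCard.ofFinEmb n (Fin m) (Fin.castLEEmb h))]
    · simp
    · intro S _ hS
      simp [hS]
    · simp

/-- Non-interacting fermion states: `|Ψ⟩ = φ(U)|1_n⟩` for a unitary `U` on the modes. -/
def FockState.IsNonInteracting {m n : ℕ} (ψ : FockState m n) : Prop :=
  ∃ (h : n ≤ m) (U : Matrix.unitaryGroup (Fin m) ℂ), ψ = (FockState.initial h).evolve U

/-- The probability `|α_S|²` of observing `S` upon a measurement in the standard basis. -/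
def FockState.prob {m n : ℕ} (ψ : FockState m n) (S : Occ m n) : ℝ := ‖ψ.amp S‖ ^ 2

/-- The random outcome of a measurement in the standard basis. -/
def FockState.measure {m n : ℕ} (ψ : FockState m n) : PMF (Occ m n) :=
  PMF.ofFintype (fun S => ENNReal.ofReal (ψ.prob S)) (by
    unfold FockState.prob
    rw [← ENNReal.ofReal_sum_of_nonneg fun S _ => sq_nonneg _, ψ.norm_eq_one, ENNReal.ofReal_one])

/-- The kernels of non-interacting fermion distributions: `K = A A†` with the `n` columns of
`A` orthonormal. -/
def IsKernel {m : ℕ} (n : ℕ) (K : Matrix (Fin m) (Fin m) ℂ) : Prop :=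
  ∃ A : Matrix (Fin m) (Fin n) ℂ, Aᴴ * A = 1 ∧ K = A * Aᴴ

/-- The probability `det K_S` that the distribution `D_K` gives to `S` (a real number when `K`
is Hermitian). -/
def kernelProb {m n : ℕ} (K : Matrix (Fin m) (Fin m) ℂ) (S : Occ m n) : ℝ :=
  (K.submatrix S.emb S.emb).det.re

/-- For `|Ψ⟩ = φ(U)|1_n⟩` and `A` the first `n` columns of `U`, the distribution of `|Ψ⟩` over the
standard basis is `D_K` with `K = A A†`. -/
theorem prob_evolve_initial {m n : ℕ} (h : n ≤ m) (U : Matrix.unitaryGroup (Fin m) ℂ)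
    (S : Occ m n) :
    ((FockState.initial h).evolve U).prob S =
      kernelProb (U.1.submatrix id (Fin.castLE h) * (U.1.submatrix id (Fin.castLE h))ᴴ) S := by
  have hT : Occ.emb (Set.powersetCard.ofFinEmb n (Fin m) (Fin.castLEEmb h)) = Fin.castLE h :=
    congrArg DFunLike.coe (Set.powersetCard.ofFinEmbEquiv.symm_apply_apply (Fin.castLEOrderEmb h))
  have hamp : ((FockState.initial h).evolve U).amp S =
      (U.1.submatrix S.emb (Fin.castLE h)).det := by
    simp [FockState.evolve, FockState.initial, Matrix.mulVec, dotProduct, lift, hT]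
  rw [FockState.prob, hamp, kernelProb,
    Matrix.submatrix_mul _ _ S.emb id S.emb Function.bijective_id, Matrix.det_mul,
    ← Matrix.conjTranspose_submatrix, Matrix.det_conjTranspose, Matrix.submatrix_submatrix]
  simp only [Function.id_comp, Function.comp_id]
  exact_mod_cast congrArg Complex.re (Complex.mul_conj' (U.1.submatrix S.emb (Fin.castLE h)).det).symm

/-- Total variation distance. -/
def tvDist {ι : Type*} [Fintype ι] (p q : ι → ℝ) : ℝ := (1 / 2) * ∑ x, |p x - q x|

/-! ### Beamsplitters and phaseshifters -/

theorem phaseMatrix_mem {m : ℕ} (i : Fin m) (θ : ℝ) :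
    Matrix.diagonal (Function.update (fun _ => (1 : ℂ)) i (Complex.exp (θ * Complex.I))) ∈
      Matrix.unitaryGroup (Fin m) ℂ := by
  rw [Matrix.mem_unitaryGroup_iff, Matrix.star_eq_conjTranspose, Matrix.diagonal_conjTranspose,
    Matrix.diagonal_mul_diagonal, ← Matrix.diagonal_one]
  congr 1
  funext k
  by_cases hk : k = i
  · subst hk
    simp [Complex.mul_conj', Complex.norm_exp_ofReal_mul_I]
  · simp [hk]

/-- The phaseshifter `e^{iθ}` on mode `i`. -/
def phaseGate {m : ℕ} (i : Fin m) (θ : ℝ) : Matrix.unitaryGroup (Fin m) ℂ :=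
  ⟨_, phaseMatrix_mem i θ⟩

/-- The rotation through the angle `θ` in the coordinates `i, j`, the identity elsewhere. -/
def rotMatrix {m : ℕ} (i j : Fin m) (θ : ℝ) : Matrix (Fin m) (Fin m) ℂ :=
  Matrix.of fun a =>
    if a = i then Pi.single i (Real.cos θ : ℂ) - Pi.single j (Real.sin θ : ℂ)
    else if a = j then Pi.single i (Real.sin θ : ℂ) + Pi.single j (Real.cos θ : ℂ)
    else Pi.single a 1

theorem rotMatrix_mem {m : ℕ} {i j : Fin m} (hij : i ≠ j) (θ : ℝ) :
    rotMatrix i j θ ∈ Matrix.unitaryGroup (Fin m) ℂ := by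
  have hcs : (Real.cos θ : ℂ) * Real.cos θ + Real.sin θ * Real.sin θ = 1 := by
    have := Real.cos_sq_add_sin_sq θ
    rw [sq, sq] at this
    exact_mod_cast this
  have hji := hij.symm
  have hi : rotMatrix i j θ i =
      Pi.single i (Real.cos θ : ℂ) - Pi.single j (Real.sin θ : ℂ) := if_pos rfl
  have hj : rotMatrix i j θ j =
      Pi.single i (Real.sin θ : ℂ) + Pi.single j (Real.cos θ : ℂ) :=
    (if_neg hji).trans (if_pos rfl)
  have ho : ∀ a, a ≠ i → a ≠ j → rotMatrix i j θ a = Pi.single a 1 :=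
    fun a h1 h2 => (if_neg h1).trans (if_neg h2)
  rw [Matrix.mem_unitaryGroup_iff, Matrix.star_eq_conjTranspose]
  ext a b
  have hmul : (rotMatrix i j θ * (rotMatrix i j θ)ᴴ) a b =
      rotMatrix i j θ a ⬝ᵥ star (rotMatrix i j θ b) := rfl
  rw [hmul, Matrix.one_apply]
  have hstar : ∀ r : ℝ, star (r : ℂ) = r := Complex.conj_ofReal
  by_cases hai : a = i
  · rw [hai, hi]
    by_cases hbi : b = i
    · rw [hbi, hi]
      simp only [sub_dotProduct, single_dotProduct, Pi.star_apply, Pi.sub_apply, Pi.single_eq_same,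
        Pi.single_eq_of_ne hij, Pi.single_eq_of_ne hji, star_sub, star_zero, hstar, if_true]
      linear_combination hcs
    · by_cases hbj : b = j
      · rw [hbj, hj]
        simp only [sub_dotProduct, single_dotProduct, Pi.star_apply, Pi.add_apply,
          Pi.single_eq_same, Pi.single_eq_of_ne hij, Pi.single_eq_of_ne hji, star_add, star_zero,
          hstar, if_neg hij]
        ring
      · rw [ho b hbi hbj]
        simp [Ne.symm hbi, Ne.symm hbj]
  · by_cases haj : a = j
    · rw [haj, hj]
      by_cases hbi : b = i
      · rw [hbi, hi]
        simp only [add_dotProduct, single_dotProduct, Pi.star_apply, Pi.sub_apply,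
          Pi.single_eq_same, Pi.single_eq_of_ne hij, Pi.single_eq_of_ne hji, star_sub, star_zero,
          hstar, if_neg hji]
        ring
      · by_cases hbj : b = j
        · rw [hbj, hj]
          simp only [add_dotProduct, single_dotProduct, Pi.star_apply, Pi.add_apply,
            Pi.single_eq_same, Pi.single_eq_of_ne hij, Pi.single_eq_of_ne hji, star_add, star_zero,
            hstar, if_true]
          linear_combination hcs
        · rw [ho b hbi hbj]
          simp [Ne.symm hbi, Ne.symm hbj]
    · rw [ho a hai haj]
      by_cases hbi : b = i
      · rw [hbi, hi]
        simp [hai, haj]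
      · by_cases hbj : b = j
        · rw [hbj, hj]
          simp [hai, haj]
        · rw [ho b hbi hbj]
          simp [Pi.single_apply, eq_comm]

/-- The beamsplitter with angle `θ` on the modes `i ≠ j` (nothing is done if `i = j`). -/
def beamGate {m : ℕ} (i j : Fin m) (θ : ℝ) : Matrix.unitaryGroup (Fin m) ℂ :=
  if h : i = j then 1 else ⟨rotMatrix i j θ, rotMatrix_mem h θ⟩

/-! ### The machine model

A unit-cost random access machine over the complex numbers (exact arithmetic, no roots, no
rounding), connected to a device that prepares fresh copies of the unknown state, sends each of
them through the current network of beamsplitters and phaseshifters, and measures it in the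
standard basis. A program is one fixed finite text, the same for all inputs. -/

/-- The cell of the two-dimensional array number `arr` whose row and column are the current
values of the index variables `row` and `col`. -/
structure Cell where
  arr : ℕ
  row : ℕ
  col : ℕ

inductive NumOp
  | add
  | sub
  | mul
  | div

def NumOp.eval : NumOp → ℂ → ℂ → ℂ
  | .add, x, y => x + y
  | .sub, x, y => x - y
  | .mul, x, y => x * y
  | .div, x, y => x / y

/-- Elementary instructions. Natural-number arguments are names of index variables, except for
the literal `c` of `idxConst`. -/
inductive Instr
  /-- `i := c` -/
  | idxConst (i c : ℕ)
  /-- `i := j + k` -/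
  | idxAdd (i j k : ℕ)
  /-- `i := j - k`, truncated at `0` -/
  | idxSub (i j k : ℕ)
  /-- `x := q`, a rational literal -/
  | numConst (x : Cell) (q : ℚ)
  /-- `x := √-1` -/
  | numI (x : Cell)
  /-- `x := i`, conversion of an index into a number -/
  | numOfIdx (x : Cell) (i : ℕ)
  /-- `x := conj y` -/
  | numConj (x y : Cell)
  /-- `x := y op z` -/
  | numOp (op : NumOp) (x y z : Cell)
  /-- remove all gates from the network -/
  | resetNet
  /-- append a beamsplitter on the modes `i, j`, its angle being the argument of `x` -/
  | beamsplitter (i j : ℕ) (x : Cell)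
  /-- append a phaseshifter on the mode `i`, its angle being the argument of `x` -/
  | phaseshift (i : ℕ) (x : Cell)
  /-- send a fresh copy through the network and measure it in the standard basis -/
  | measure
  /-- `i := 1` if the mode `j` was occupied in the latest measurement, otherwise `i := 0` -/
  | readMode (i j : ℕ)

/-- Tests: comparison of two index variables, or of the real parts of two cells. -/
inductive Test
  | idxLt (i j : ℕ)
  | numLt (x y : Cell)

inductive Program
  | instr (a : Instr)
  | seq (P Q : Program)
  | ite (t : Test) (P Q : Program)
  | whileDo (t : Test) (P : Program)

/-- The state of the memory and of the device. Modes are numbered from `0`. -/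
structure State (m : ℕ) where
  /-- index variables -/
  idx : ℕ → ℕ
  /-- arrays of numbers -/
  num : ℕ → ℕ → ℕ → ℂ
  /-- the unitary of the current network -/
  net : Matrix.unitaryGroup (Fin m) ℂ
  /-- the modes that were occupied in the latest measurement -/
  outcome : Finset (Fin m)
  /-- one entry per copy measured so far: the unitary applied to it before the standard-basis
  measurement, which determines the measurement basis -/
  log : List (Matrix.unitaryGroup (Fin m) ℂ)

namespace State

variable {m : ℕ}

def get (s : State m) (x : Cell) : ℂ := s.num x.arr (s.idx x.row) (s.idx x.col)

def setIdx (s : State m) (i v : ℕ) : State m := { s with idx := Function.update s.idx i v }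

def set (s : State m) (x : Cell) (v : ℂ) : State m :=
  { s with
    num := fun a i j =>
      if a = x.arr ∧ i = s.idx x.row ∧ j = s.idx x.col then v else s.num a i j }

/-- Gates on modes that do not exist have no effect. -/
def addBeamsplitter (s : State m) (i j : ℕ) (θ : ℝ) : State m :=
  if h : i < m ∧ j < m then { s with net := beamGate ⟨i, h.1⟩ ⟨j, h.2⟩ θ * s.net } else s

def addPhase (s : State m) (i : ℕ) (θ : ℝ) : State m :=
  if h : i < m then { s with net := phaseGate ⟨i, h⟩ θ * s.net } else s

end State

def Test.holds {m : ℕ} (s : State m) : Test → Prop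
  | .idxLt i j => s.idx i < s.idx j
  | .numLt x y => (s.get x).re < (s.get y).re

open Classical in
/-- The effect of one instruction, for copies of the state `ψ`. -/
def Instr.exec {m n : ℕ} (ψ : FockState m n) (s : State m) : Instr → PMF (State m)
  | .idxConst i c => PMF.pure (s.setIdx i c)
  | .idxAdd i j k => PMF.pure (s.setIdx i (s.idx j + s.idx k))
  | .idxSub i j k => PMF.pure (s.setIdx i (s.idx j - s.idx k))
  | .numConst x q => PMF.pure (s.set x (q : ℂ))
  | .numI x => PMF.pure (s.set x Complex.I)
  | .numOfIdx x i => PMF.pure (s.set x (s.idx i : ℂ))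
  | .numConj x y => PMF.pure (s.set x (star (s.get y)))
  | .numOp op x y z => PMF.pure (s.set x (op.eval (s.get y) (s.get z)))
  | .resetNet => PMF.pure { s with net := 1 }
  | .beamsplitter i j x => PMF.pure (s.addBeamsplitter (s.idx i) (s.idx j) (s.get x).arg)
  | .phaseshift i x => PMF.pure (s.addPhase (s.idx i) (s.get x).arg)
  | .measure =>
      (ψ.evolve s.net).measure.map fun S => { s with outcome := S.1, log := s.net :: s.log }
  | .readMode i j =>
      PMF.pure (s.setIdx i (if ∃ h : s.idx j < m, ⟨s.idx j, h⟩ ∈ s.outcome then 1 else 0))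

/-- A configuration: the stack of programs still to be executed, and the state. -/
abbrev Config (m : ℕ) : Type := List Program × State m

open Classical in
/-- One time step. -/
def step {m n : ℕ} (ψ : FockState m n) : Config m → PMF (Config m)
  | ([], s) => PMF.pure ([], s)
  | (.instr a :: k, s) => (a.exec ψ s).map fun s' => (k, s')
  | (.seq P Q :: k, s) => PMF.pure (P :: Q :: k, s)
  | (.ite t P Q :: k, s) => PMF.pure ((if t.holds s then P else Q) :: k, s)
  | (.whileDo t P :: k, s) =>
      PMF.pure (if t.holds s then P :: .whileDo t P :: k else k, s)

/-- The random configuration after `T` time steps. -/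
def run {m n : ℕ} (ψ : FockState m n) : ℕ → Config m → PMF (Config m)
  | 0, c => PMF.pure c
  | T + 1, c => (step ψ c).bind (run ψ T)

/-- The initial state of the machine: index variables `0` and `1` hold `m` and `n`, the first two
cells of array `0` hold `ε` and `δ`, everything else is blank. -/
def State.start (m n : ℕ) (ε δ : ℝ) : State m where
  idx k := if k = 0 then m else if k = 1 then n else 0
  num a i j :=
    if a = 0 ∧ i = 0 ∧ j = 0 then (ε : ℂ) else if a = 0 ∧ i = 0 ∧ j = 1 then (δ : ℂ) else 0
  net := 1
  outcome := ∅
  log := []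

/-- The output matrix `K̂`, stored in array `1`. -/
def State.output {m : ℕ} (s : State m) : Matrix (Fin m) (Fin m) ℂ :=
  Matrix.of fun i j => s.num 1 i j

/-- The number of copies of the unknown state used so far. -/
def State.copies {m : ℕ} (s : State m) : ℕ := s.log.length

/-- The number of different measurement bases used so far. -/
def State.bases {m : ℕ} (s : State m) : ℕ := {V | V ∈ s.log}.ncard

end

end FermionLearning

/-! The state is a Slater determinant, and its distribution depends only on the rank-`n` projection
`K = A A†`. The algorithm estimates `K` entrywise and then rounds the estimate `M` to a projection.

Estimation. Behind a network `V` the mode `i` is occupied with probability `(V K V†) i i`. In round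
`r` the mode `i` is paired with `r - i` modulo `m`. A phase `φ` followed by a balanced beamsplitter
turns the difference of the two occupation probabilities into twice the real part of `φ K i (r -
i)`. The phases `1` and `I` give the real and the imaginary part, and every pair of distinct modes
meets in exactly one round, so `2 m` bases reveal all entries. An outcome vector and its mean have
entries in `[0, 1]` and sum `n`, so one measurement moves the deviation by a squared length of at
most `2 n`, independently of `m` (`sum_occNum_sub_sq_le`). The expectation of `exp (l √(a +
‖deviation‖²))` therefore grows by a bounded factor per measurement (`sum_mul_exp_sqrt_le`). With
`N` measurements per basis this gives `‖M - K‖² = O(n m R / N)` except with probability `2 ^ (-R)`.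

Rounding. A fresh copy measured in the standard basis yields `S` with probability `|det A_S|²`,
which is volume sampling. By Cramer's rule this weight cancels the inverse of `A_S`: in a suitable
basis the columns `S` of `M` are `A` plus an error of mean squared size at most `n ‖M - K‖²`
(`sum_slater_mul_frob_colError_le`). By Markov's inequality the projection to their span is, with
probability at least one half, within `4 n ‖M - K‖²` of `K`. Gram–Schmidt yields the projection
itself without square roots (`IsKernel.extendProj`). Among `R` such candidates the one closest to
`M` is kept, which fails with probability at most `2 ^ (-R)`.

Conclusion. The squared total variation distance is at most half the squared Frobenius distance of
the kernels (`tvDist_sq_le_frob`), and a squared distance below `1` forces rank `n`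
(`le_of_frob_sub_lt_one`). Hence `N` of order `R n² m / ε²` suffices, with `R` of order `L`. The
program is analysed by Hoare triples that bound the running time and carry an upper bound for the
failure probability, conditional on the current memory. -/

namespace FermionLearning
noncomputable section

open scoped ENNReal

/-! ### Expectations and quantitative Hoare triples -/

/-- The expectation of a nonnegative function. -/
def expect {α : Type*} (μ : PMF α) (F : α → ℝ≥0∞) : ℝ≥0∞ := ∑' a, μ a * F a

theorem expect_pure {α : Type*} (a : α) (F : α → ℝ≥0∞) : expect (PMF.pure a) F = F a := by
  classical
  unfold expect
  rw [tsum_eq_single a]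
  · simp
  · intro b hb
    simp [PMF.pure_apply, hb]

theorem expect_bind {α β : Type*} (μ : PMF α) (f : α → PMF β) (F : β → ℝ≥0∞) :
    expect (μ.bind f) F = expect μ fun a => expect (f a) F := by
  simp only [expect, PMF.bind_apply, ← ENNReal.tsum_mul_right, ← ENNReal.tsum_mul_left, mul_assoc]
  exact ENNReal.tsum_comm

theorem expect_map {α β : Type*} (μ : PMF α) (f : α → β) (F : β → ℝ≥0∞) :
    expect (μ.map f) F = expect μ fun a => F (f a) := by
  have : μ.map f = μ.bind fun a => PMF.pure (f a) := rfl
  rw [this, expect_bind]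
  simp only [expect_pure]

theorem expect_mono {α : Type*} (μ : PMF α) {F G : α → ℝ≥0∞} (h : ∀ a, F a ≤ G a) :
    expect μ F ≤ expect μ G :=
  ENNReal.tsum_le_tsum fun a => by gcongr; exact h a

variable {m n : ℕ} (ψ : FockState m n)

/-- From the stack `k` and the state `s`, with at least `T` steps left, the expectation of `F` in
the last configuration is at most `v`. -/
def Safe (F : Config m → ℝ≥0∞) (k : List Program) (s : State m) (T : ℕ) (v : ℝ≥0∞) : Prop :=
  ∀ T', T ≤ T' → expect (run ψ T' (k, s)) F ≤ v

variable {ψ} {F : Config m → ℝ≥0∞} {k : List Program} {s : State m}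

theorem Safe.mono {T T' : ℕ} {v v' : ℝ≥0∞} (h : Safe ψ F k s T v) (hT : T ≤ T') (hv : v ≤ v') :
    Safe ψ F k s T' v' := fun U hU => (h U (hT.trans hU)).trans hv

/-- The empty stack is a fixed point of `step`, so surplus time is harmless and an upper bound for
the running time determines the configuration at the fixed time `T`. -/
theorem Safe.halt : Safe ψ F [] s 0 (F ([], s)) := by
  intro T _
  have : run ψ T ([], s) = PMF.pure ([], s) := by
    induction T with
    | zero => rfl
    | succ T ih => rw [run, step, PMF.pure_bind]; exact ih (Nat.zero_le _)
  rw [this, expect_pure]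

theorem Safe.of_step {P : Program} {T : ℕ} {k' : List Program} {s' : State m} {v : ℝ≥0∞}
    (hs : step ψ (P :: k, s) = PMF.pure (k', s')) (h : Safe ψ F k' s' T v) :
    Safe ψ F (P :: k) s (T + 1) v := by
  rintro (_ | U) hU
  · omega
  · rw [run, hs, PMF.pure_bind]
    exact h U (by omega)

theorem expect_measure (φ : FockState m n) (v : Occ m n → ℝ≥0∞) :
    expect φ.measure v = ∑ S, ENNReal.ofReal (φ.prob S) * v S := by
  rw [expect, tsum_fintype]
  rfl

/-- The memory after a measurement with outcome `S`. -/
def State.observe (s : State m) (S : Occ m n) : State m :=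
  { s with outcome := S.1, log := s.net :: s.log }

theorem Safe.of_measure {T : ℕ} {v : Occ m n → ℝ≥0∞}
    (h : ∀ S, Safe ψ F k (s.observe S) T (v S)) :
    Safe ψ F (.instr .measure :: k) s (T + 1)
      (∑ S, ENNReal.ofReal ((ψ.evolve s.net).prob S) * v S) := by
  rintro (_ | U) hU
  · omega
  · rw [run, step, Instr.exec, PMF.map_comp, expect_bind, expect_map, ← expect_measure]
    exact expect_mono _ fun S => h S U (by omega)

variable (ψ)

/-- A quantitative Hoare triple: `P` started in `s` takes at most `t` steps, ends in a state with
`Q`, and the expectation of `w` at the end is at most `v`. -/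
def Triple (P : Program) (s : State m) (t : ℕ) (v : ℝ≥0∞) (Q : State m → Prop)
    (w : State m → ℝ≥0∞) : Prop :=
  ∀ (F : Config m → ℝ≥0∞) (k : List Program) (T : ℕ),
    (∀ s', Q s' → Safe ψ F k s' T (w s')) → Safe ψ F (P :: k) s (T + t) v

/-- `P` started in `s` takes at most `t` steps and ends in a state with `Q`, whatever the
measurement outcomes. -/
def Hoare (P : Program) (s : State m) (t : ℕ) (Q : State m → Prop) : Prop :=
  ∀ v, Triple ψ P s t v Q fun _ => v

variable {ψ} {P P' body : Program} {t t' : ℕ} {Q Q' : State m → Prop} {v : ℝ≥0∞}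
  {w : State m → ℝ≥0∞}

theorem Triple.mono {v' : ℝ≥0∞} {w' : State m → ℝ≥0∞} (h : Triple ψ P s t v Q w) (ht : t ≤ t')
    (hv : v ≤ v') (hQ : ∀ s', Q s' → Q' s' ∧ w' s' ≤ w s') : Triple ψ P s t' v' Q' w' := by
  intro F k T hk
  refine (h F k T fun s' hs' => ?_).mono (by omega) hv
  exact (hk s' (hQ s' hs').1).mono le_rfl (hQ s' hs').2

theorem Hoare.mono (h : Hoare ψ P s t Q) (ht : t ≤ t') (hQ : ∀ s', Q s' → Q' s') :
    Hoare ψ P s t' Q' :=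
  fun v => (h v).mono ht le_rfl fun s' hs' => ⟨hQ s' hs', le_rfl⟩

/-- `Triple` quantifies over every continuation, so the second program can be pushed on the stack as
the continuation of the first. The extra step unfolds `seq`. -/
theorem Triple.seq (h : Triple ψ P s t v Q w)
    (h' : ∀ s', Q s' → Triple ψ P' s' t' (w s') Q' w') :
    Triple ψ (.seq P P') s (t + t' + 1) v Q' w' := by
  intro F k T hk
  refine (Safe.of_step (k' := P :: P' :: k) (s' := s) (T := T + t' + t) rfl ?_).mono
    (by omega) le_rfl
  exact h F _ _ fun s' hs' => h' s' hs' F k T hk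

theorem Hoare.seq (h : Hoare ψ P s t Q) (h' : ∀ s', Q s' → Hoare ψ P' s' t' Q') :
    Hoare ψ (.seq P P') s (t + t' + 1) Q' :=
  fun v => (h v).seq fun s' hs' => h' s' hs' v

theorem Triple.measure {v : Occ m n → ℝ≥0∞} (hQ : ∀ S, Q (s.observe S) ∧ w (s.observe S) ≤ v S) :
    Triple ψ (.instr .measure) s 1 (∑ S, ENNReal.ofReal ((ψ.evolve s.net).prob S) * v S) Q w := by
  intro F k T hk
  exact Safe.of_measure fun S => (hk _ (hQ S).1).mono le_rfl (hQ S).2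

theorem Triple.ite {c : Test} (h : c.holds s → Triple ψ P s t v Q w)
    (h' : ¬ c.holds s → Triple ψ P' s t v Q w) :
    Triple ψ (.ite c P P') s (t + 1) v Q w := by
  intro F k T hk
  by_cases hc : c.holds s
  · exact Safe.of_step (k' := P :: k) (s' := s) (by simp [step, hc]) (h hc F k T hk)
  · exact Safe.of_step (k' := P' :: k) (s' := s) (by simp [step, hc]) (h' hc F k T hk)

theorem Hoare.ite {c : Test} (h : c.holds s → Hoare ψ P s t Q)
    (h' : ¬ c.holds s → Hoare ψ P' s t Q) : Hoare ψ (.ite c P P') s (t + 1) Q :=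
  fun v => Triple.ite (fun hc => h hc v) fun hc => h' hc v

/-- The rule for loops, with an invariant `Inv j` and a bound `u j` before the `j`-th of `H`
passes. -/
theorem Triple.whileDo {c : Test} (H : ℕ) (Inv : ℕ → State m → Prop) (u : ℕ → State m → ℝ≥0∞)
    (hc : ∀ j s', Inv j s' → j ≤ H ∧ (c.holds s' ↔ j < H))
    (hbody : ∀ j s', j < H → Inv j s' → Triple ψ P s' t (u j s') (Inv (j + 1)) (u (j + 1)))
    (h0 : Inv 0 s) :
    Triple ψ (.whileDo c P) s (H * (t + 1) + 1) (u 0 s) (Inv H) (u H) := by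
  intro F k T hk
  -- Induction on the number `d` of passes left. Each costs the body and one test; the last, failing
  -- test costs the remaining step.
  suffices h : ∀ d j s', j + d = H → Inv j s' →
      Safe ψ F (.whileDo c P :: k) s' (T + (d * (t + 1) + 1)) (u j s') from
    h H 0 s (by omega) h0
  intro d
  induction d with
  | zero =>
    intro j s' hj hI
    obtain rfl : j = H := by omega
    have hn : ¬ c.holds s' := fun h => by have := (hc j s' hI).2.1 h; omega
    refine (Safe.of_step (k' := k) (s' := s') (T := T) (by simp [step, hn]) (hk s' hI)).mono
      (by omega) le_rfl
  | succ d ih =>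
    intro j s' hj hI
    have hn : c.holds s' := (hc j s' hI).2.2 (by omega)
    refine (Safe.of_step (k' := P :: .whileDo c P :: k) (s' := s')
      (T := T + (d * (t + 1) + 1) + t) (by simp [step, hn]) ?_).mono ?_ le_rfl
    · exact hbody j s' (by omega) hI F _ _ fun s'' h'' => ih (j + 1) s'' (by omega) h''
    · rw [Nat.succ_mul]; omega

theorem Hoare.whileDo {c : Test} (H : ℕ) (Inv : ℕ → State m → Prop)
    (hc : ∀ j s', Inv j s' → j ≤ H ∧ (c.holds s' ↔ j < H))
    (hbody : ∀ j s', j < H → Inv j s' → Hoare ψ P s' t (Inv (j + 1)))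
    (h0 : Inv 0 s) : Hoare ψ (.whileDo c P) s (H * (t + 1) + 1) (Inv H) :=
  fun v => Triple.whileDo H Inv (fun _ _ => v) hc (fun j s' hj hI => hbody j s' hj hI v) h0

/-! ### Straight-line code -/

/-- The effect of an instruction other than a measurement. -/
def Instr.effect (s : State m) : Instr → State m
  | .idxConst i c => s.setIdx i c
  | .idxAdd i j k => s.setIdx i (s.idx j + s.idx k)
  | .idxSub i j k => s.setIdx i (s.idx j - s.idx k)
  | .numConst x q => s.set x (q : ℂ)
  | .numI x => s.set x Complex.I
  | .numOfIdx x i => s.set x (s.idx i : ℂ)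
  | .numConj x y => s.set x (star (s.get y))
  | .numOp op x y z => s.set x (op.eval (s.get y) (s.get z))
  | .resetNet => { s with net := 1 }
  | .beamsplitter i j x => s.addBeamsplitter (s.idx i) (s.idx j) (s.get x).arg
  | .phaseshift i x => s.addPhase (s.idx i) (s.get x).arg
  | .measure => s
  | .readMode i j =>
      open Classical in
      s.setIdx i (if ∃ h : s.idx j < m, ⟨s.idx j, h⟩ ∈ s.outcome then 1 else 0)

/-- Instructions other than a measurement. -/
def Instr.IsClassical : Instr → Prop
  | .measure => False
  | _ => True

theorem Hoare.instr {a : Instr} (ha : a.IsClassical) (h : Q (a.effect s)) :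
    Hoare ψ (.instr a) s 1 Q := by
  intro v F k T hk
  refine Safe.of_step (k' := k) (s' := a.effect s) ?_ (hk _ h)
  cases a <;> first | exact ha.elim | (simp only [step, Instr.exec, PMF.pure_map]; rfl)

/-- The instructions of a list one after the other. -/
def block : List Instr → Program
  | [] => .instr (.idxConst 2 0)
  | [a] => .instr a
  | a :: b :: l => .seq (.instr a) (block (b :: l))

/-- Besides the instructions themselves, each `seq` node costs a step, one fewer than there are
instructions; hence the factor `2`. The empty list is excluded because its block still executes one
instruction. -/
theorem hoare_block {l : List Instr} (hl : ∀ a ∈ l, a.IsClassical) (hne : l ≠ [])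
    (h : Q (l.foldl Instr.effect s)) : Hoare ψ (block l) s (2 * l.length) Q := by
  induction l generalizing s with
  | nil => exact (hne rfl).elim
  | cons a l ih =>
    cases l with
    | nil => exact (Hoare.instr (hl a (by simp)) h).mono (by simp) fun _ => id
    | cons b l =>
      refine Hoare.mono (Hoare.seq (t' := 2 * (b :: l).length)
        (Hoare.instr (Q := fun s' => s' = a.effect s) (hl a (by simp)) rfl) ?_) ?_ fun _ => id
      · rintro s' rfl
        exact ih (fun c hc => hl c (List.mem_cons_of_mem _ hc)) (by simp) h
      · simp only [List.length_cons]; omega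

/-- Do nothing (the index variable `2` holds `0` throughout). -/
def skip : Program := .instr (.idxConst 2 0)

theorem hoare_skip (h2 : s.idx 2 = 0) (h : Q s) : Hoare ψ skip s 1 Q := by
  refine Hoare.instr trivial ?_
  have : Instr.effect s (.idxConst 2 0) = s := by
    have : Function.update s.idx 2 0 = s.idx := by rw [← h2, Function.update_eq_self]
    simp only [Instr.effect, State.setIdx, this]
  rwa [this]

/-- For `i` from `0` to the value of `hi`, exclusively (the index variable `3` holds `1`). -/
def forLoop (i hi : ℕ) (P : Program) : Program :=
  .seq (.instr (.idxConst i 0)) (.whileDo (.idxLt i hi) (.seq P (.instr (.idxAdd i i 3))))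

/-- A pass costs the test, the unfolding of `seq`, the body and the increment, hence `t + 3`. The
final `3` pays for the outer `seq`, the initialization and the failing test. Invariant and bound are
evaluated after the increment, so the body has to establish them for the memory with the counter
already raised. -/
theorem triple_forLoop {i hi H : ℕ} (Inv : ℕ → State m → Prop) (u : ℕ → State m → ℝ≥0∞)
    (hInv : ∀ j s', Inv j s' → s'.idx hi = H ∧ s'.idx 3 = 1)
    (hbody : ∀ j s', j < H → s'.idx i = j → Inv j s' →
      Triple ψ P s' t (u j s')
        (fun s'' => s''.idx i = j ∧ s''.idx hi = H ∧ s''.idx 3 = 1 ∧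
          Inv (j + 1) (s''.setIdx i (j + 1)))
        (fun s'' => u (j + 1) (s''.setIdx i (j + 1))))
    (h0 : Inv 0 (s.setIdx i 0)) :
    Triple ψ (forLoop i hi P) s (H * (t + 3) + 3) (u 0 (s.setIdx i 0))
      (fun s' => Inv H s' ∧ s'.idx i = H) (u H) := by
  have hloop : Triple ψ (.whileDo (.idxLt i hi) (.seq P (.instr (.idxAdd i i 3))))
      (s.setIdx i 0) (H * (t + 3) + 1) (u 0 (s.setIdx i 0))
      (fun s' => H ≤ H ∧ Inv H s' ∧ s'.idx i = H) (u H) := by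
    refine Triple.whileDo H (fun j s' => j ≤ H ∧ Inv j s' ∧ s'.idx i = j) u ?_ ?_ ?_
    · rintro j s' ⟨hj, hI, hij⟩
      refine ⟨hj, ?_⟩
      simp only [Test.holds, hij, (hInv j s' hI).1]
    · rintro j s' hj ⟨-, hI, hij⟩
      refine Triple.seq (hbody j s' hj hij hI) ?_
      rintro s'' ⟨e1, e2, e3, e4⟩
      have he : Instr.effect s'' (.idxAdd i i 3) = s''.setIdx i (j + 1) := by
        simp only [Instr.effect, e1, e3]
      refine (Hoare.instr (a := .idxAdd i i 3) (Q := fun s' => s' = s''.setIdx i (j + 1)) trivial he _).mono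
        le_rfl le_rfl ?_
      rintro s' rfl
      exact ⟨⟨hj, e4, by simp [State.setIdx]⟩, le_rfl⟩
    · exact ⟨Nat.zero_le _, h0, by simp [State.setIdx]⟩
  have := Triple.seq (Hoare.instr (ψ := ψ) (a := .idxConst i 0) (s := s)
    (Q := fun s' => s' = s.setIdx i 0) trivial rfl (u 0 (s.setIdx i 0)))
    (P' := .whileDo (.idxLt i hi) (.seq P (.instr (.idxAdd i i 3))))
    (t' := H * (t + 3) + 1) (Q' := fun s' => H ≤ H ∧ Inv H s' ∧ s'.idx i = H)
    (w' := u H) (by rintro s' rfl; exact hloop)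
  exact this.mono (by omega) le_rfl fun s' h => ⟨h.2, le_rfl⟩

/-! ### Frames: the memory that a piece of code leaves unchanged -/

/-- `s'` differs from `s` at most in the index variables `I`, in the arrays `A`, and in the
network. -/
structure NetFrame (I A : List ℕ) (s s' : State m) : Prop where
  idx : ∀ k, k ∉ I → s'.idx k = s.idx k
  num : ∀ a, a ∉ A → s'.num a = s.num a
  outcome : s'.outcome = s.outcome
  log : s'.log = s.log

/-- `s'` differs from `s` at most in the index variables `I` and in the arrays `A`. -/
structure Frame (I A : List ℕ) (s s' : State m) : Prop extends NetFrame I A s s' where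
  net : s'.net = s.net

theorem NetFrame.refl (I A : List ℕ) (s : State m) : NetFrame I A s s :=
  ⟨fun _ _ => rfl, fun _ _ => rfl, rfl, rfl⟩

theorem NetFrame.trans {I A I' A' : List ℕ} {s s' s'' : State m} (h : NetFrame I A s s')
    (h' : NetFrame I' A' s' s'') (hI : I' ⊆ I) (hA : A' ⊆ A) : NetFrame I A s s'' :=
  ⟨fun k hk => (h'.idx k fun hh => hk (hI hh)).trans (h.idx k hk),
    fun a ha => (h'.num a fun hh => ha (hA hh)).trans (h.num a ha),
    h'.outcome.trans h.outcome, h'.log.trans h.log⟩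

theorem NetFrame.mono {I A I' A' : List ℕ} {s s' : State m} (h' : NetFrame I' A' s s')
    (hI : I' ⊆ I) (hA : A' ⊆ A) : NetFrame I A s s' :=
  (NetFrame.refl I A s).trans h' hI hA

theorem NetFrame.setIdx {I A : List ℕ} {s s' : State m} (h : NetFrame I A s s') {i : ℕ}
    (hi : i ∈ I) (v : ℕ) : NetFrame I A s (s'.setIdx i v) :=
  ⟨fun k hk => by
    rw [State.setIdx, ← h.idx k hk]
    exact Function.update_of_ne (fun hh => hk (by rwa [hh])) _ _, h.num, h.outcome, h.log⟩

theorem Frame.refl (I A : List ℕ) (s : State m) : Frame I A s s := ⟨NetFrame.refl I A s, rfl⟩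

theorem Frame.trans {I A I' A' : List ℕ} {s s' s'' : State m} (h : Frame I A s s')
    (h' : Frame I' A' s' s'') (hI : I' ⊆ I) (hA : A' ⊆ A) : Frame I A s s'' :=
  ⟨h.1.trans h'.1 hI hA, h'.net.trans h.net⟩

theorem Frame.mono {I A I' A' : List ℕ} {s s' : State m} (h' : Frame I' A' s s')
    (hI : I' ⊆ I) (hA : A' ⊆ A) : Frame I A s s' :=
  (Frame.refl I A s).trans h' hI hA

theorem Frame.setIdx {I A : List ℕ} {s s' : State m} (h : Frame I A s s') {i : ℕ}
    (hi : i ∈ I) (v : ℕ) : Frame I A s (s'.setIdx i v) := ⟨h.1.setIdx hi v, h.net⟩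

/-- The rule for loops whose body changes only the index variables `I` and the arrays `A`. -/
theorem hoare_forLoop {i hi H : ℕ} (I A : List ℕ) (Inv : ℕ → State m → Prop)
    (hH : s.idx hi = H) (h3 : s.idx 3 = 1) (hi3 : 3 ∉ I) (hihi : hi ∉ I) (hiI : i ∈ I)
    (h0 : Inv 0 (s.setIdx i 0))
    (hbody : ∀ j s', j < H → s'.idx i = j → Frame I A s s' → Inv j s' →
      Hoare ψ P s' t (fun s'' => s''.idx i = j ∧ Frame I A s' s'' ∧
          Inv (j + 1) (s''.setIdx i (j + 1)))) :
    Hoare ψ (forLoop i hi P) s (H * (t + 3) + 3)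
      (fun s' => Frame I A s s' ∧ Inv H s') := by
  intro v
  refine (triple_forLoop (fun j s' => Frame I A s s' ∧ Inv j s') (fun _ _ => v)
    ?_ ?_ ?_).mono le_rfl le_rfl ?_
  · rintro j s' ⟨hF, -⟩
    exact ⟨(hF.idx hi hihi).trans hH, (hF.idx 3 hi3).trans h3⟩
  · rintro j s' hj hij ⟨hF, hI⟩
    refine (hbody j s' hj hij hF hI v).mono le_rfl le_rfl ?_
    rintro s'' ⟨e1, e2, e3⟩
    have e := hF.trans e2 (fun _ => id) (fun _ => id)
    exact ⟨⟨e1, (e.idx hi hihi).trans hH, (e.idx 3 hi3).trans h3, e.setIdx hiI _, e3⟩, le_rfl⟩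
  · exact ⟨(Frame.refl I A s).setIdx hiI 0, h0⟩
  · rintro s' ⟨⟨hF, hI⟩, -⟩
    exact ⟨⟨hF, hI⟩, le_rfl⟩

end
end FermionLearning

namespace FermionLearning
noncomputable section

/-! ### Slater determinants -/

variable {m n : ℕ}

/-- The amplitudes of the state with the one-particle wave functions the columns of `A`. -/
def slater (A : Matrix (Fin m) (Fin n) ℂ) (S : Occ m n) : ℂ := (A.submatrix S.emb id).det

theorem Occ.exists_emb_iff (S : Occ m n) (i : Fin m) : (∃ k, S.emb k = i) ↔ i ∈ S.1 :=
  Set.powersetCard.mem_range_ofFinEmbEquiv_symm_iff_mem S i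

/-- Cauchy–Binet: overlaps of Slater determinants are determinants of overlaps. -/
theorem sum_star_slater_mul (A B : Matrix (Fin m) (Fin n) ℂ) :
    ∑ S, star (slater A S) * slater B S = (Aᴴ * B).det := by
  rw [det_mul_eq_sum]
  refine Finset.sum_congr rfl fun S _ => ?_
  rw [slater, slater, ← Matrix.det_conjTranspose, Matrix.conjTranspose_submatrix]

theorem sum_norm_sq_slater (A : Matrix (Fin m) (Fin n) ℂ) :
    ((∑ S, ‖slater A S‖ ^ 2 : ℝ) : ℂ) = (Aᴴ * A).det := by
  rw [← sum_star_slater_mul, Complex.ofReal_sum]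
  refine Finset.sum_congr rfl fun S _ => ?_
  rw [Complex.ofReal_pow]
  exact (Complex.conj_mul' _).symm

theorem FockState.IsNonInteracting.exists_slater {ψ : FockState m n} (h : ψ.IsNonInteracting) :
    n ≤ m ∧ ∃ A : Matrix (Fin m) (Fin n) ℂ, Aᴴ * A = 1 ∧ ∀ S, ψ.amp S = slater A S := by
  obtain ⟨h, U, rfl⟩ := h
  refine ⟨h, U.1.submatrix id (Fin.castLE h), ?_, fun S => ?_⟩
  · rw [Matrix.conjTranspose_submatrix, ← Matrix.submatrix_mul _ _ _ id _ Function.bijective_id,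
      ← Matrix.star_eq_conjTranspose, Matrix.UnitaryGroup.star_mul_self,
      Matrix.submatrix_one _ (Fin.castLE_injective h)]
  · have hT : Occ.emb (Set.powersetCard.ofFinEmb n (Fin m) (Fin.castLEEmb h)) = Fin.castLE h :=
      congrArg DFunLike.coe
        (Set.powersetCard.ofFinEmbEquiv.symm_apply_apply (Fin.castLEOrderEmb h))
    simp [FockState.evolve, FockState.initial, Matrix.mulVec, dotProduct, lift, hT, slater]

/-- Cauchy–Binet again: networks act on Slater determinants by left multiplication, so every
measured state is again a Slater determinant and the marginals below apply to it. -/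
theorem evolve_amp_eq_slater {ψ : FockState m n} {A : Matrix (Fin m) (Fin n) ℂ}
    (hA : ∀ S, ψ.amp S = slater A S) (V : Matrix.unitaryGroup (Fin m) ℂ) (S : Occ m n) :
    (ψ.evolve V).amp S = slater (V.1 * A) S := by
  rw [slater, Matrix.submatrix_mul V.1 A S.emb id id Function.bijective_id, det_mul_eq_sum]
  simp only [FockState.evolve, Matrix.mulVec, dotProduct, lift, hA, slater, Matrix.of_apply]
  rfl

open Classical in
/-- The one-body marginals of a Slater determinant. -/
theorem sum_norm_sq_slater_of_mem {A : Matrix (Fin m) (Fin n) ℂ} (hA : Aᴴ * A = 1) (i : Fin m) :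
    ∑ S : Occ m n, ‖slater A S‖ ^ 2 * (if i ∈ S.1 then 1 else 0) = ((A * Aᴴ) i i).re := by
  have h1 : ∑ S, ‖slater A S‖ ^ 2 = 1 := by
    have := sum_norm_sq_slater A
    rw [hA, Matrix.det_one] at this
    exact_mod_cast this
  -- Zeroing row `i` kills the amplitudes of the `S` that contain `i` and keeps the others. The
  -- probability that `i` is empty is thus the Gram determinant of the modified matrix.
  have h0 : ∀ S : Occ m n, ‖slater (A.updateRow i 0) S‖ ^ 2 =
      ‖slater A S‖ ^ 2 - ‖slater A S‖ ^ 2 * (if i ∈ S.1 then 1 else 0) := by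
    intro S
    by_cases hi : i ∈ S.1
    · obtain ⟨k, hk⟩ := (S.exists_emb_iff i).2 hi
      have : slater (A.updateRow i 0) S = 0 := by
        refine Matrix.det_eq_zero_of_row_eq_zero k fun j => ?_
        simp [hk]
      simp [this, hi]
    · have : slater (A.updateRow i 0) S = slater A S := by
        unfold slater
        congr 1
        ext k j
        have : S.emb k ≠ i := fun h => hi ((S.exists_emb_iff i).1 ⟨k, h⟩)
        simp [Matrix.updateRow_apply, this]
      simp [this, hi]
  -- The Gram matrix becomes the identity minus a matrix of rank one, whose determinant
  -- `Matrix.det_one_add_mul_comm` reduces to that of a `1 × 1` matrix.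
  have h2 : (A.updateRow i 0)ᴴ * A.updateRow i 0 =
      1 - Matrix.replicateCol Unit (star (A i)) * Matrix.replicateRow Unit (A i) := by
    rw [← hA]
    ext a b
    have : ∀ x, star (A.updateRow i 0 x a) * A.updateRow i 0 x b =
        star (A x a) * A x b - if x = i then star (A i a) * A i b else 0 := by
      intro x
      by_cases hx : x = i
      · subst hx; simp
      · simp [hx]
    simp only [Matrix.mul_apply, Matrix.conjTranspose_apply, this, Finset.sum_sub_distrib,
      Matrix.sub_apply, Finset.sum_ite_eq', Finset.mem_univ, if_true]
    simp
  have h3 := sum_norm_sq_slater (A.updateRow i 0)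
  rw [h2, sub_eq_add_neg, ← Matrix.neg_mul, Matrix.det_one_add_mul_comm] at h3
  simp only [h0, Finset.sum_sub_distrib, h1] at h3
  have h4 := congrArg Complex.re h3
  simp only [Matrix.det_unique, Complex.ofReal_re] at h4
  simp [Matrix.mul_apply] at h4 ⊢
  linarith

/-! ### The Frobenius norm -/

/-- The squared Frobenius norm. -/
def frob {ι κ : Type*} [Fintype ι] [Fintype κ] (X : Matrix ι κ ℂ) : ℝ := ∑ i, ∑ j, ‖X i j‖ ^ 2

section Frob

variable {ι κ : Type*} [Fintype ι] [Fintype κ]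

theorem frob_nonneg (X : Matrix ι κ ℂ) : 0 ≤ frob X :=
  Finset.sum_nonneg fun _ _ => Finset.sum_nonneg fun _ _ => sq_nonneg _

theorem frob_add_le (X Y : Matrix ι κ ℂ) : frob (X + Y) ≤ 2 * frob X + 2 * frob Y := by
  simp only [frob, Finset.mul_sum, ← Finset.sum_add_distrib]
  refine Finset.sum_le_sum fun i _ => Finset.sum_le_sum fun j _ => ?_
  have := norm_add_le (X i j) (Y i j)
  have h := norm_nonneg (X i j + Y i j)
  rw [Matrix.add_apply]
  nlinarith [sq_nonneg (‖X i j‖ - ‖Y i j‖)]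

theorem frob_neg (X : Matrix ι κ ℂ) : frob (-X) = frob X := by simp [frob]

theorem frob_eq_trace (X : Matrix ι κ ℂ) : frob X = ((Xᴴ * X).trace).re := by
  have : ((frob X : ℝ) : ℂ) = (Xᴴ * X).trace := by
    simp only [frob, Matrix.trace, Matrix.mul_apply, Matrix.diag, Matrix.conjTranspose_apply,
      Complex.ofReal_sum, Complex.ofReal_pow]
    rw [Finset.sum_comm]
    exact Finset.sum_congr rfl fun i _ => Finset.sum_congr rfl fun j _ =>
      (Complex.conj_mul' _).symm
  rw [← this, Complex.ofReal_re]

end Frob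

/-! ### Projections -/

theorem frob_sub_eq {Q K : Matrix (Fin m) (Fin m) ℂ} (hQ : Qᴴ = Q) (hQ2 : Q * Q = Q)
    (hK : Kᴴ = K) (hK2 : K * K = K) :
    frob (Q - K) = Q.trace.re + K.trace.re - 2 * (Q * K).trace.re := by
  rw [frob_eq_trace, Matrix.conjTranspose_sub, hQ, hK, Matrix.sub_mul, Matrix.mul_sub,
    Matrix.mul_sub, hQ2, hK2, Matrix.trace_sub, Matrix.trace_sub, Matrix.trace_sub,
    Matrix.trace_mul_comm K Q]
  simp only [Complex.sub_re]
  ring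

section Projection

variable {t : ℕ} {A : Matrix (Fin m) (Fin n) ℂ} {B : Matrix (Fin m) (Fin t) ℂ}

theorem conjTranspose_mul_self_conjTranspose (B : Matrix (Fin m) (Fin t) ℂ) :
    (B * Bᴴ)ᴴ = B * Bᴴ := by
  rw [Matrix.conjTranspose_mul, Matrix.conjTranspose_conjTranspose]

theorem mul_conjTranspose_idem (hB : Bᴴ * B = 1) : B * Bᴴ * (B * Bᴴ) = B * Bᴴ := by
  rw [Matrix.mul_assoc, ← Matrix.mul_assoc Bᴴ, hB, Matrix.one_mul]

theorem trace_mul_conjTranspose (hB : Bᴴ * B = 1) : (B * Bᴴ).trace = t := by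
  rw [Matrix.trace_mul_comm, hB]
  simp

theorem frob_sub_eq_of_orthonormal (hA : Aᴴ * A = 1) (hB : Bᴴ * B = 1) :
    frob (B * Bᴴ - A * Aᴴ) = t + n - 2 * frob (Aᴴ * B) := by
  rw [frob_sub_eq (conjTranspose_mul_self_conjTranspose B) (mul_conjTranspose_idem hB)
    (conjTranspose_mul_self_conjTranspose A) (mul_conjTranspose_idem hA),
    trace_mul_conjTranspose hA, trace_mul_conjTranspose hB, frob_eq_trace,
    Matrix.conjTranspose_mul, Matrix.conjTranspose_conjTranspose, Matrix.mul_assoc B,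
    Matrix.trace_mul_comm B, Matrix.mul_assoc, Matrix.mul_assoc, Matrix.mul_assoc]
  simp

theorem frob_conjTranspose {ι κ : Type*} [Fintype ι] [Fintype κ] (X : Matrix ι κ ℂ) :
    frob Xᴴ = frob X := by
  unfold frob
  rw [Finset.sum_comm]
  simp

theorem frob_one_sub_mul {κ : Type*} [Fintype κ] (hB : Bᴴ * B = 1) (X : Matrix (Fin m) κ ℂ) :
    frob ((1 - B * Bᴴ) * X) = frob X - frob (Bᴴ * X) := by
  have e : (1 - B * Bᴴ) * (1 - B * Bᴴ) = 1 - B * Bᴴ := by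
    rw [Matrix.mul_sub, Matrix.sub_mul, Matrix.sub_mul, mul_conjTranspose_idem hB]; simp
  rw [frob_eq_trace, frob_eq_trace X, frob_eq_trace (Bᴴ * X), Matrix.conjTranspose_mul,
    Matrix.conjTranspose_mul, Matrix.conjTranspose_sub, Matrix.conjTranspose_one,
    conjTranspose_mul_self_conjTranspose, Matrix.mul_assoc, ← Matrix.mul_assoc (1 - B * Bᴴ), e,
    Matrix.sub_mul, Matrix.one_mul, Matrix.mul_sub, Matrix.trace_sub, Complex.sub_re,
    Matrix.conjTranspose_conjTranspose]
  simp only [Matrix.mul_assoc]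

theorem frob_of_orthonormal (hA : Aᴴ * A = 1) : frob A = n := by
  rw [frob_eq_trace, hA]
  simp

/-- A projection of rank at most `n` that fixes the columns of `A + F` is close to `A A†`. -/
theorem frob_sub_le_of_fixes (hA : Aᴴ * A = 1) (hB : Bᴴ * B = 1) (ht : t ≤ n)
    {X : Matrix (Fin m) (Fin n) ℂ} (hX : B * Bᴴ * (A + X) = A + X) :
    frob (B * Bᴴ - A * Aᴴ) ≤ 2 * frob X := by
  -- The part of `A` outside the range of the projection equals, up to sign, that of `X`, so `n -
  -- ‖Bᴴ A‖² ≤ ‖X‖²`. Since `t ≤ n`, the squared distance `t + n - 2 ‖Bᴴ A‖²` is at most twice the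
  -- left side.
  have h2 : (1 - B * Bᴴ) * A = -((1 - B * Bᴴ) * X) := by
    have : (1 - B * Bᴴ) * (A + X) = 0 := by rw [Matrix.sub_mul, hX, Matrix.one_mul, sub_self]
    rw [Matrix.mul_add] at this
    exact eq_neg_of_add_eq_zero_left this
  have h3 := congrArg frob h2
  rw [frob_neg, frob_one_sub_mul hB, frob_one_sub_mul hB, frob_of_orthonormal hA,
    ← frob_conjTranspose (Bᴴ * A), Matrix.conjTranspose_mul,
    Matrix.conjTranspose_conjTranspose] at h3
  rw [frob_sub_eq_of_orthonormal hA hB]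
  have := frob_nonneg (Bᴴ * X)
  have : (t : ℝ) ≤ n := by exact_mod_cast ht
  linarith

/-- The rank of a projection close to `A A†` is not smaller than that of `A A†`. -/
theorem le_of_frob_sub_lt_one (hA : Aᴴ * A = 1) (hB : Bᴴ * B = 1)
    (h : frob (B * Bᴴ - A * Aᴴ) < 1) : n ≤ t := by
  have h1 := frob_one_sub_mul hA B
  have h2 := frob_nonneg ((1 - A * Aᴴ) * B)
  rw [frob_of_orthonormal hB] at h1
  rw [frob_sub_eq_of_orthonormal hA hB] at h
  -- `‖Aᴴ B‖² ≤ t` because `(1 - A Aᴴ) B` has nonnegative squared norm; inserted in `t + n - 2 ‖Aᴴ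
  -- B‖² < 1` this gives the claim.
  have : (n : ℝ) < t + 1 := by linarith
  have : n < t + 1 := by exact_mod_cast this
  omega

end Projection

end
end FermionLearning

namespace FermionLearning
noncomputable section

variable {m n : ℕ}

/-! ### Determinants of Gram matrices -/

section Gram

open scoped ComplexOrder

theorem one_sub_sum_le_prod {ι : Type*} (s : Finset ι) (x : ι → ℝ) (h0 : ∀ i, 0 ≤ x i)
    (h1 : ∀ i, x i ≤ 1) : 1 - ∑ i ∈ s, (1 - x i) ≤ ∏ i ∈ s, x i := by
  classical
  have hle : ∀ s : Finset ι, ∏ i ∈ s, x i ≤ 1 := fun s =>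
    Finset.prod_le_one (fun i _ => h0 i) fun i _ => h1 i
  induction s using Finset.induction_on with
  | empty => simp
  | insert a s ha ih =>
    rw [Finset.sum_insert ha, Finset.prod_insert ha]
    nlinarith [h0 a, h1 a, hle s, mul_nonneg (sub_nonneg.2 (h1 a)) (sub_nonneg.2 (hle s))]

/-- The arithmetic–geometric mean inequality for the eigenvalues, whose sum is `n`, in the form `x ≤
exp (x - 1)`. -/
theorem det_gram_le_one {C : Matrix (Fin m) (Fin n) ℂ} (hC : frob C = n) :
    (Cᴴ * C).det.re ≤ 1 := by
  have hps := Matrix.posSemidef_conjTranspose_mul_self C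
  have htr : ∑ i, (hps.1.eigenvalues i - 1) = 0 := by
    rw [frob_eq_trace, hps.1.trace_eq_sum_eigenvalues] at hC
    simp only [Complex.coe_algebraMap, ← Complex.ofReal_sum, Complex.ofReal_re] at hC
    rw [Finset.sum_sub_distrib, hC]
    simp
  rw [hps.1.det_eq_prod_eigenvalues]
  simp only [Complex.coe_algebraMap, ← Complex.ofReal_prod, Complex.ofReal_re]
  calc ∏ i, hps.1.eigenvalues i ≤ ∏ i, Real.exp (hps.1.eigenvalues i - 1) := by
        refine Finset.prod_le_prod (fun i _ => hps.eigenvalues_nonneg i) fun i _ => ?_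
        have := Real.add_one_le_exp (hps.1.eigenvalues i - 1)
        linarith
    _ = 1 := by rw [← Real.exp_sum, htr, Real.exp_zero]

/-- For a contraction all eigenvalues of the Gram matrix lie in `[0, 1]`, and the Weierstrass
product inequality bounds their product from below by their sum. -/
theorem one_sub_le_det_gram {C : Matrix (Fin m) (Fin n) ℂ} (hC : (1 - Cᴴ * C).PosSemidef) :
    1 - (n - frob C) ≤ (Cᴴ * C).det.re := by
  have hps := Matrix.posSemidef_conjTranspose_mul_self C
  rw [hps.1.det_eq_prod_eigenvalues, frob_eq_trace, hps.1.trace_eq_sum_eigenvalues]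
  simp only [Complex.coe_algebraMap, ← Complex.ofReal_prod, ← Complex.ofReal_sum,
    Complex.ofReal_re]
  refine le_trans (le_of_eq ?_) (one_sub_sum_le_prod _ _ hps.eigenvalues_nonneg fun i => ?_)
  · simp
  · have h1 := hC.re_dotProduct_nonneg (hps.1.eigenvectorBasis i)
    rw [Matrix.sub_mulVec, Matrix.one_mulVec, dotProduct_sub, map_sub] at h1
    have h2 := hps.1.eigenvalues_eq i
    have h3 : RCLike.re (star (hps.1.eigenvectorBasis i).ofLp ⬝ᵥ
        (hps.1.eigenvectorBasis i).ofLp) = 1 := by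
      have := hps.1.eigenvectorBasis.orthonormal.1 i
      rw [EuclideanSpace.norm_eq, Real.sqrt_eq_one] at this
      rw [← this]
      simp only [dotProduct, Pi.star_apply, map_sum]
      refine Finset.sum_congr rfl fun j _ => ?_
      have := Complex.conj_mul' ((hps.1.eigenvectorBasis i).ofLp j)
      simp only [RCLike.star_def, this]
      norm_cast
    rw [h3, ← h2] at h1
    linarith

/-! ### Total variation distance -/

theorem kernelProb_eq_slater (B : Matrix (Fin m) (Fin n) ℂ) (S : Occ m n) :
    kernelProb (B * Bᴴ) S = ‖slater B S‖ ^ 2 := by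
  rw [kernelProb, Matrix.submatrix_mul _ _ S.emb id S.emb Function.bijective_id, Matrix.det_mul,
    ← Matrix.conjTranspose_submatrix, Matrix.det_conjTranspose]
  have := Complex.mul_conj' (slater B S)
  have h := congrArg Complex.re this
  rw [← Complex.ofReal_pow, Complex.ofReal_re] at h
  exact h

/-- Factor `|a|² - |b|² = (|a| - |b|)(|a| + |b|)` and apply Cauchy–Schwarz. The two square sums are
`2 - 2c` and `2 + 2c` with `c = ∑ |a| |b|`, which dominates the modulus of the overlap. -/
theorem tvDist_sq_le {ι : Type*} [Fintype ι] (a b : ι → ℂ) (ha : ∑ i, ‖a i‖ ^ 2 = 1)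
    (hb : ∑ i, ‖b i‖ ^ 2 = 1) :
    tvDist (fun i => ‖a i‖ ^ 2) (fun i => ‖b i‖ ^ 2) ^ 2 ≤ 1 - ‖∑ i, star (a i) * b i‖ ^ 2 := by
  set c := ∑ i, ‖a i‖ * ‖b i‖ with hc
  have h1 : ‖∑ i, star (a i) * b i‖ ≤ c := by
    refine (norm_sum_le _ _).trans (le_of_eq ?_)
    simp [hc]
  have h2 : tvDist (fun i => ‖a i‖ ^ 2) (fun i => ‖b i‖ ^ 2) =
      1 / 2 * ∑ i, |‖a i‖ - ‖b i‖| * (‖a i‖ + ‖b i‖) := by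
    rw [tvDist]
    congr 1
    refine Finset.sum_congr rfl fun i _ => ?_
    have : ‖a i‖ ^ 2 - ‖b i‖ ^ 2 = (‖a i‖ - ‖b i‖) * (‖a i‖ + ‖b i‖) := by ring
    rw [this, abs_mul, abs_of_nonneg (by positivity : 0 ≤ ‖a i‖ + ‖b i‖)]
  have h3 := Finset.sum_mul_sq_le_sq_mul_sq Finset.univ (fun i => |‖a i‖ - ‖b i‖|)
    (fun i => ‖a i‖ + ‖b i‖)
  have h4 : ∑ i, |‖a i‖ - ‖b i‖| ^ 2 = 2 - 2 * c := by
    simp only [sq_abs, sub_sq, Finset.sum_add_distrib, Finset.sum_sub_distrib, ha, hb, hc,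
      mul_assoc, ← Finset.mul_sum]
    ring
  have h5 : ∑ i, (‖a i‖ + ‖b i‖) ^ 2 = 2 + 2 * c := by
    simp only [add_sq, Finset.sum_add_distrib, ha, hb, hc,
      mul_assoc, ← Finset.mul_sum]
    ring
  rw [h4, h5] at h3
  rw [h2, mul_pow]
  have h6 := norm_nonneg (∑ i, star (a i) * b i)
  have h7 : ‖∑ i, star (a i) * b i‖ ^ 2 ≤ c ^ 2 := by gcongr
  nlinarith

/-- The total variation distance is at most the distance of the kernels. -/
theorem tvDist_sq_le_frob {A B : Matrix (Fin m) (Fin n) ℂ} (hA : Aᴴ * A = 1) (hB : Bᴴ * B = 1) :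
    tvDist (fun S : Occ m n => ‖slater B S‖ ^ 2) (fun S => ‖slater A S‖ ^ 2) ^ 2 ≤
      frob (B * Bᴴ - A * Aᴴ) / 2 := by
  have h1 : ∀ {A : Matrix (Fin m) (Fin n) ℂ}, Aᴴ * A = 1 →
      ∑ S : Occ m n, ‖slater A S‖ ^ 2 = 1 := by
    intro A hA
    have := sum_norm_sq_slater A
    rw [hA, Matrix.det_one] at this
    exact_mod_cast this
  have h2 := tvDist_sq_le _ _ (h1 hB) (h1 hA)
  rw [sum_star_slater_mul] at h2
  refine h2.trans ?_
  rw [frob_sub_eq_of_orthonormal hA hB]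
  have h3 : ‖(Bᴴ * A).det‖ ^ 2 = ((Aᴴ * B)ᴴ * (Aᴴ * B)).det.re := by
    rw [Matrix.det_mul, Matrix.conjTranspose_mul, Matrix.conjTranspose_conjTranspose]
    have : (Aᴴ * B).det = star (Bᴴ * A).det := by
      rw [← Matrix.det_conjTranspose, Matrix.conjTranspose_mul,
        Matrix.conjTranspose_conjTranspose]
    rw [this]
    have h := congrArg Complex.re (Complex.mul_conj' (Bᴴ * A).det)
    rw [← Complex.ofReal_pow, Complex.ofReal_re] at h
    exact h.symm
  -- `Aᴴ B` is a contraction: its defect is the Gram matrix of `(1 - A Aᴴ) B`. Hence `1 - |det|² ≤ n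
  -- - ‖Aᴴ B‖²`, which is half the squared distance of the kernels.
  have h4 : (1 - (Aᴴ * B)ᴴ * (Aᴴ * B)).PosSemidef := by
    have : 1 - (Aᴴ * B)ᴴ * (Aᴴ * B) = ((1 - A * Aᴴ) * B)ᴴ * ((1 - A * Aᴴ) * B) := by
      have e : (1 - A * Aᴴ) * (1 - A * Aᴴ) = 1 - A * Aᴴ := by
        rw [Matrix.mul_sub, Matrix.sub_mul, Matrix.sub_mul, mul_conjTranspose_idem hA]; simp
      have e1 : ((1 - A * Aᴴ) * B)ᴴ = Bᴴ * (1 - A * Aᴴ) := by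
        rw [Matrix.conjTranspose_mul, Matrix.conjTranspose_sub, Matrix.conjTranspose_one,
          conjTranspose_mul_self_conjTranspose]
      have e2 : (Aᴴ * B)ᴴ = Bᴴ * A := by
        rw [Matrix.conjTranspose_mul, Matrix.conjTranspose_conjTranspose]
      rw [e1, e2, Matrix.mul_assoc Bᴴ (1 - A * Aᴴ), ← Matrix.mul_assoc (1 - A * Aᴴ), e, Matrix.sub_mul,
        Matrix.one_mul, Matrix.mul_sub, hB]
      simp only [Matrix.mul_assoc]
    rw [this]
    exact Matrix.posSemidef_conjTranspose_mul_self _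
  have h5 := one_sub_le_det_gram h4
  rw [h3]
  linarith

end Gram

/-! ### Volume sampling -/

theorem slater_updateCol_smul (A : Matrix (Fin m) (Fin n) ℂ) (k : Fin n) (c : ℂ) (x : Fin m → ℂ)
    (S : Occ m n) :
    slater (A.updateCol k (c • x)) S = c * slater (A.updateCol k x) S := by
  have h : ∀ y : Fin m → ℂ, (A.updateCol k y).submatrix S.emb id =
      (A.submatrix S.emb id).updateCol k (y ∘ S.emb) := by
    intro y
    ext i j
    simp [Matrix.updateCol_apply]
  rw [slater, slater, h, h, ← Matrix.det_updateCol_smul]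
  rfl

/-- The left side is a Gram determinant. After normalization of `x` all columns are unit vectors and
`det_gram_le_one` applies; homogeneity in the column restores the length of `x`. -/
theorem sum_norm_sq_slater_updateCol_le {A : Matrix (Fin m) (Fin n) ℂ} (hA : Aᴴ * A = 1)
    (k : Fin n) (x : Fin m → ℂ) :
    ∑ S, ‖slater (A.updateCol k x) S‖ ^ 2 ≤ ∑ i, ‖x i‖ ^ 2 := by
  set r := √(∑ i, ‖x i‖ ^ 2) with hr
  have hr2 : r ^ 2 = ∑ i, ‖x i‖ ^ 2 :=
    Real.sq_sqrt (Finset.sum_nonneg fun _ _ => sq_nonneg _)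
  by_cases hr0 : r = 0
  · have hx : x = (0 : ℂ) • x := by
      funext i
      rw [hr0, zero_pow two_ne_zero, eq_comm,
        Finset.sum_eq_zero_iff_of_nonneg fun _ _ => sq_nonneg _] at hr2
      simpa using hr2 i (Finset.mem_univ i)
    rw [hx]
    simp only [slater_updateCol_smul, zero_mul, norm_zero, zero_pow two_ne_zero,
      Finset.sum_const_zero]
    exact Finset.sum_nonneg fun _ _ => sq_nonneg _
  · set y := ((r : ℂ)⁻¹) • x with hy
    have hx : x = (r : ℂ) • y := by
      rw [hy, smul_smul, mul_inv_cancel₀ (by exact_mod_cast hr0), one_smul]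
    have hfrob : frob (A.updateCol k y) = n := by
      have hcol : ∀ j, ∑ i, ‖A.updateCol k y i j‖ ^ 2 = 1 := by
        intro j
        by_cases hj : j = k
        · subst hj
          simp only [Matrix.updateCol_self, hy, Pi.smul_apply, norm_smul, mul_pow,
            ← Finset.mul_sum, ← hr2, norm_inv, Complex.norm_real, Real.norm_eq_abs, inv_pow,
            sq_abs]
          exact inv_mul_cancel₀ (pow_ne_zero 2 hr0)
        · have h := congrFun (congrFun hA j) j
          rw [Matrix.mul_apply, Matrix.one_apply_eq] at h
          have h' : ((∑ i, ‖A i j‖ ^ 2 : ℝ) : ℂ) = 1 := by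
            rw [← h, Complex.ofReal_sum]
            refine Finset.sum_congr rfl fun i _ => ?_
            rw [Complex.ofReal_pow]
            exact (Complex.conj_mul' _).symm
          simp only [Matrix.updateCol_ne hj]
          exact_mod_cast h'
      rw [frob, Finset.sum_comm]
      simp [hcol]
    have h1 := det_gram_le_one hfrob
    rw [← sum_norm_sq_slater, Complex.ofReal_re] at h1
    have h2 : ∀ S, ‖slater (A.updateCol k x) S‖ ^ 2 =
        r ^ 2 * ‖slater (A.updateCol k y) S‖ ^ 2 := by
      intro S
      conv_lhs => rw [hx]
      rw [slater_updateCol_smul, norm_mul, mul_pow, Complex.norm_real, Real.norm_eq_abs, sq_abs]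
    simp only [h2, ← Finset.mul_sum, ← hr2]
    exact mul_le_of_le_one_right (sq_nonneg r) h1

/-- The deviation of the columns `S` of `A A† + E` from a basis of the range of `A`. -/
def colError (A : Matrix (Fin m) (Fin n) ℂ) (E : Matrix (Fin m) (Fin m) ℂ) (S : Occ m n) :
    Matrix (Fin m) (Fin n) ℂ :=
  E.submatrix id S.emb * ((A.submatrix S.emb id)ᴴ)⁻¹

/-- The columns `S` of `A Aᴴ` are `A (A_S)ᴴ`, so a change of basis turns them back into `A`. -/
theorem submatrix_mul_inv {A : Matrix (Fin m) (Fin n) ℂ} (E : Matrix (Fin m) (Fin m) ℂ)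
    {S : Occ m n} (hS : slater A S ≠ 0) :
    (A * Aᴴ + E).submatrix id S.emb * ((A.submatrix S.emb id)ᴴ)⁻¹ = A + colError A E S := by
  have hu : IsUnit ((A.submatrix S.emb id)ᴴ).det := by
    rw [Matrix.det_conjTranspose]
    exact (isUnit_iff_ne_zero.2 hS).star
  have h : (A * Aᴴ + E).submatrix id S.emb =
      A * (A.submatrix S.emb id)ᴴ + E.submatrix id S.emb := by
    ext i j
    simp [Matrix.mul_apply]
  rw [h, Matrix.add_mul, Matrix.mul_assoc, Matrix.mul_nonsing_inv _ hu, Matrix.mul_one, colError]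

/-- Cramer's rule: `det A_S` times an entry of `E_S (A_Sᴴ)⁻¹` is, up to conjugation, the determinant
with a column of `A_S` replaced by a conjugated row of `E`. The possibly huge inverse is thereby
cancelled by the sampling weight. -/
theorem norm_sq_slater_mul_colError (A : Matrix (Fin m) (Fin n) ℂ) (E : Matrix (Fin m) (Fin m) ℂ)
    (S : Occ m n) (i : Fin m) (k : Fin n) :
    ‖slater A S‖ ^ 2 * ‖colError A E S i k‖ ^ 2 ≤ ‖slater (A.updateCol k (star (E i))) S‖ ^ 2 := by
  by_cases hS : slater A S = 0
  · simp [hS]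
  have hu : IsUnit (A.submatrix S.emb id).det := isUnit_iff_ne_zero.2 hS
  have h1 := Matrix.det_smul_inv_mulVec_eq_cramer (A.submatrix S.emb id) (star (E i) ∘ S.emb) hu
  have h2 := congrFun h1 k
  rw [Matrix.cramer_apply, Pi.smul_apply] at h2
  have h3 : (A.submatrix S.emb id).updateCol k (star (E i) ∘ S.emb) =
      (A.updateCol k (star (E i))).submatrix S.emb id := by
    ext a b
    simp [Matrix.updateCol_apply]
  have h4 : colError A E S i k =
      star (((A.submatrix S.emb id)⁻¹ *ᵥ (star (E i) ∘ S.emb)) k) := by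
    rw [colError, ← Matrix.conjTranspose_nonsing_inv, Matrix.mul_apply, Matrix.mulVec, dotProduct,
      star_sum]
    refine Finset.sum_congr rfl fun a _ => ?_
    simp [mul_comm]
  rw [h4, norm_star, ← mul_pow, ← norm_mul]
  rw [h3] at h2
  exact le_of_eq (congrArg (fun z : ℂ => ‖z‖ ^ 2) h2)

/-- For each row of `E` and each replaced column the weighted sum is at most the squared length of
the row; the factor `n` counts the columns. -/
theorem sum_slater_mul_frob_colError_le {A : Matrix (Fin m) (Fin n) ℂ} (hA : Aᴴ * A = 1)
    (E : Matrix (Fin m) (Fin m) ℂ) :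
    ∑ S, ‖slater A S‖ ^ 2 * frob (colError A E S) ≤ n * frob E := by
  calc ∑ S, ‖slater A S‖ ^ 2 * frob (colError A E S)
      ≤ ∑ S, ∑ i, ∑ k, ‖slater (A.updateCol k (star (E i))) S‖ ^ 2 := by
        simp only [frob, Finset.mul_sum]
        gcongr
        exact norm_sq_slater_mul_colError _ _ _ _ _
    _ = ∑ i, ∑ k, ∑ S, ‖slater (A.updateCol k (star (E i))) S‖ ^ 2 := by
        rw [Finset.sum_comm]
        exact Finset.sum_congr rfl fun i _ => Finset.sum_comm
    _ ≤ ∑ i, ∑ _k : Fin n, ∑ j, ‖E i j‖ ^ 2 := by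
        refine Finset.sum_le_sum fun i _ => Finset.sum_le_sum fun k _ => ?_
        refine (sum_norm_sq_slater_updateCol_le hA k _).trans (le_of_eq ?_)
        simp
    _ = n * frob E := by simp [frob, Finset.mul_sum]

/-! ### Gram–Schmidt orthogonalization without square roots -/

/-- The projection to the span of the range of the projection `Q` and of `v`. -/
def extendProj (Q : Matrix (Fin m) (Fin m) ℂ) (v : Fin m → ℂ) : Matrix (Fin m) (Fin m) ℂ :=
  Matrix.of fun i j => Q i j + (v - Q *ᵥ v) i * star ((v - Q *ᵥ v) j) /
    ∑ k, (v - Q *ᵥ v) k * star ((v - Q *ᵥ v) k)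

/-- The residual `w` is orthogonal to the range, so `w / ‖w‖` is one more orthonormal column. The
projection involves only `w wᴴ / ‖w‖²`, so the machine, which has no roots, can compute it. -/
theorem IsKernel.extendProj {t : ℕ} {Q : Matrix (Fin m) (Fin m) ℂ} (hQ : IsKernel t Q)
    (v : Fin m → ℂ) :
    ∃ t' ≤ t + 1, IsKernel t' (extendProj Q v) ∧ extendProj Q v *ᵥ v = v ∧
      ∀ x, Q *ᵥ x = x → extendProj Q v *ᵥ x = x := by
  obtain ⟨B, hB, rfl⟩ := hQ
  set w := v - (B * Bᴴ) *ᵥ v with hw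
  have hBw : Bᴴ *ᵥ w = 0 := by
    rw [hw, Matrix.mulVec_sub, Matrix.mulVec_mulVec, ← Matrix.mul_assoc, hB, Matrix.one_mul,
      sub_self]
  set r := √(∑ k, ‖w k‖ ^ 2) with hr
  have hr2 : r ^ 2 = ∑ k, ‖w k‖ ^ 2 :=
    Real.sq_sqrt (Finset.sum_nonneg fun _ _ => sq_nonneg _)
  have hww : ∑ k, w k * star (w k) = (r : ℂ) ^ 2 := by
    rw [← Complex.ofReal_pow, hr2, Complex.ofReal_sum]
    refine Finset.sum_congr rfl fun k _ => ?_
    rw [Complex.ofReal_pow]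
    exact Complex.mul_conj' _
  -- A vector already in the range has zero residual; the correction is then `0 / 0 = 0` and the
  -- projection stays as it is. The same convention governs the machine's division.
  by_cases hr0 : r = 0
  · have hw0 : w = 0 := by
      funext i
      rw [hr0, zero_pow two_ne_zero, eq_comm,
        Finset.sum_eq_zero_iff_of_nonneg fun _ _ => sq_nonneg _] at hr2
      simpa using hr2 i (Finset.mem_univ i)
    have he : FermionLearning.extendProj (B * Bᴴ) v = B * Bᴴ := by
      ext i j
      simp only [FermionLearning.extendProj, ← hw, hw0, Matrix.of_apply, Pi.zero_apply, zero_mul,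
        zero_div, add_zero]
    rw [he]
    exact ⟨t, Nat.le_succ t, ⟨B, hB, rfl⟩, (sub_eq_zero.1 hw0).symm, fun x hx => hx⟩
  have hrc : (r : ℂ) ≠ 0 := by exact_mod_cast hr0
  have hstar : star (r : ℂ) = r := Complex.conj_ofReal r
  set B' : Matrix (Fin m) (Fin (t + 1)) ℂ := Matrix.of fun i => Fin.snoc (B i) (w i / r) with hB'
  have hcs : ∀ i j, B' i (Fin.castSucc j) = B i j := fun i j => by simp [hB']
  have hls : ∀ i, B' i (Fin.last t) = w i / r := fun i => by simp [hB']
  have hBw' : ∀ j, ∑ i, star (B i j) * w i = 0 := fun j => congrFun hBw j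
  have horth : B'ᴴ * B' = 1 := by
    ext a b
    rw [Matrix.mul_apply]
    simp only [Matrix.conjTranspose_apply]
    induction a using Fin.lastCases with
    | last =>
      induction b using Fin.lastCases with
      | last =>
        simp only [hls, Matrix.one_apply_eq, star_div₀, hstar]
        have : ∀ i, star (w i) / r * (w i / r) = w i * star (w i) / (r : ℂ) ^ 2 := fun i => by
          field_simp
        simp only [this, ← Finset.sum_div, hww]
        exact div_self (pow_ne_zero 2 hrc)
      | cast b =>
        rw [Matrix.one_apply_ne (Fin.castSucc_lt_last b).ne']
        simp only [hls, hcs]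
        have h := congrArg star (hBw' b)
        rw [star_sum, star_zero] at h
        have e : ∀ i, star (w i / (r : ℂ)) * B i b = star (star (B i b) * w i) / r := by
          intro i
          rw [star_div₀, hstar, star_mul, star_star]
          ring
        simp only [e, ← Finset.sum_div, h, zero_div]
    | cast a =>
      induction b using Fin.lastCases with
      | last =>
        rw [Matrix.one_apply_ne (Fin.castSucc_lt_last a).ne]
        simp only [hls, hcs, ← mul_div_assoc, ← Finset.sum_div, hBw' a, zero_div]
      | cast b =>
        simp only [hcs]
        have := congrFun (congrFun hB a) b
        rw [Matrix.mul_apply] at this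
        simp only [Matrix.conjTranspose_apply] at this
        rw [this]
        simp [Matrix.one_apply]
  have hprod : FermionLearning.extendProj (B * Bᴴ) v = B' * B'ᴴ := by
    ext i j
    rw [Matrix.mul_apply, Fin.sum_univ_castSucc]
    simp only [Matrix.conjTranspose_apply, hcs, hls, FermionLearning.extendProj, ← hw, hww,
      Matrix.of_apply, star_div₀, hstar]
    rw [Matrix.mul_apply]
    simp only [Matrix.conjTranspose_apply]
    congr 1
    field_simp
  have happly : ∀ x, FermionLearning.extendProj (B * Bᴴ) v *ᵥ x =
      (B * Bᴴ) *ᵥ x + ((star w ⬝ᵥ x) / (r : ℂ) ^ 2) • w := by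
    intro x
    funext i
    simp only [Matrix.mulVec, dotProduct, FermionLearning.extendProj, ← hw, hww, Matrix.of_apply,
      add_mul, Finset.sum_add_distrib, Pi.add_apply, Pi.smul_apply, smul_eq_mul, Pi.star_apply]
    congr 1
    rw [Finset.sum_div, Finset.sum_mul]
    exact Finset.sum_congr rfl fun j _ => by ring
  have hperp : ∀ x, star w ⬝ᵥ ((B * Bᴴ) *ᵥ x) = 0 := by
    intro x
    rw [← Matrix.mulVec_mulVec, Matrix.dotProduct_mulVec]
    have : star w ᵥ* B = 0 := by
      have := congrArg star hBw
      rwa [Matrix.star_mulVec, Matrix.conjTranspose_conjTranspose, star_zero] at this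
    rw [this, zero_dotProduct]
  refine ⟨t + 1, le_rfl, ⟨B', horth, hprod⟩, ?_, ?_⟩
  · rw [happly]
    have : star w ⬝ᵥ v = (r : ℂ) ^ 2 := by
      have hv : v = w + (B * Bᴴ) *ᵥ v := by rw [hw]; abel
      rw [hv, dotProduct_add, hperp, add_zero, ← hww, dotProduct]
      exact Finset.sum_congr rfl fun k _ => mul_comm _ _
    rw [this, div_self (pow_ne_zero 2 hrc), one_smul, hw]
    abel
  · intro x hx
    rw [happly, hx]
    have : star w ⬝ᵥ x = 0 := by rw [← hx]; exact hperp x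
    rw [this, zero_div, zero_smul, add_zero]

end
end FermionLearning

namespace FermionLearning
noncomputable section

variable {m n : ℕ}

/-! ### Concentration of sums of bounded vectors -/

/-- By convexity the exponential lies below its chord over `[-b, b]`. -/
theorem exp_le_cosh_add {b y : ℝ} (hb : 0 < b) (hy : |y| ≤ b) :
    Real.exp y ≤ Real.cosh b + y / b * Real.sinh b := by
  obtain ⟨h1, h2⟩ := abs_le.1 hy
  have h0 : 0 ≤ (b + y) / (2 * b) := div_nonneg (by linarith) (by linarith)
  have h0' : 0 ≤ (b - y) / (2 * b) := div_nonneg (by linarith) (by linarith)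
  have h := convexOn_exp.2 (Set.mem_univ b) (Set.mem_univ (-b)) h0 h0' (by field_simp; ring)
  have e : ((b + y) / (2 * b)) • b + ((b - y) / (2 * b)) • (-b) = y := by
    simp only [smul_eq_mul]; field_simp; ring
  rw [e] at h
  refine h.trans (le_of_eq ?_)
  rw [Real.cosh_eq, Real.sinh_eq]
  simp only [smul_eq_mul]
  field_simp
  ring

/-- Hoeffding's lemma for a symmetric interval. -/
theorem sum_mul_exp_le {ι : Type*} [Fintype ι] {p y : ι → ℝ} {b : ℝ} (hp : ∀ i, 0 ≤ p i)
    (hp1 : ∑ i, p i = 1) (hy : ∑ i, p i * y i = 0) (hb : 0 ≤ b) (hyb : ∀ i, |y i| ≤ b) :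
    ∑ i, p i * Real.exp (y i) ≤ Real.exp (b ^ 2 / 2) := by
  rcases hb.eq_or_lt with rfl | hb
  · have : ∀ i, y i = 0 := fun i => abs_nonpos_iff.1 (hyb i)
    simp [this, hp1]
  · calc ∑ i, p i * Real.exp (y i)
        ≤ ∑ i, p i * (Real.cosh b + y i / b * Real.sinh b) := by
          gcongr with i
          · exact hp i
          · exact exp_le_cosh_add hb (hyb i)
      _ = Real.cosh b * ∑ i, p i + Real.sinh b / b * ∑ i, p i * y i := by
          rw [Finset.mul_sum, Finset.mul_sum, ← Finset.sum_add_distrib]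
          exact Finset.sum_congr rfl fun i _ => by ring
      _ ≤ Real.exp (b ^ 2 / 2) := by
          rw [hp1, hy, mul_one, mul_zero, add_zero]
          exact Real.cosh_le_exp_half_sq b

theorem sqrt_add_le {f h : ℝ} (hf : 0 < f) (hh : 0 ≤ f ^ 2 + h) :
    √(f ^ 2 + h) ≤ f + h / (2 * f) := by
  have h1 : f + h / (2 * f) = (f ^ 2 + (f ^ 2 + h)) / (2 * f) := by field_simp; ring
  rw [Real.sqrt_le_left]
  · have : f ^ 2 + h ≤ (f + h / (2 * f)) ^ 2 := by
      have : (f + h / (2 * f)) ^ 2 = f ^ 2 + h + (h / (2 * f)) ^ 2 := by field_simp; ring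
      rw [this]; nlinarith [sq_nonneg (h / (2 * f))]
    exact this
  · rw [h1]; positivity

/-- Adding a random vector of mean zero and bounded length to `x` increases the expectation of
`exp (l * √(a + ‖x‖²))` by a bounded factor. -/
theorem sum_mul_exp_sqrt_le {ι κ : Type*} [Fintype ι] [Fintype κ] {p : ι → ℝ} {y : ι → κ → ℝ}
    {a c β l : ℝ} (x : κ → ℝ) (hp : ∀ i, 0 ≤ p i) (hp1 : ∑ i, p i = 1)
    (hy : ∀ k, ∑ i, p i * y i k = 0) (hβ : ∀ i, ∑ k, y i k ^ 2 ≤ β) (hβ0 : 0 ≤ β) (hc : 0 < c)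
    (hca : c ≤ a) (hl : 0 ≤ l) :
    ∑ i, p i * Real.exp (l * √(a + ∑ k, (x k + y i k) ^ 2)) ≤
      Real.exp (l ^ 2 * β / 2 + l * (β / (2 * √c))) * Real.exp (l * √(a + ∑ k, x k ^ 2)) := by
  set f := √(a + ∑ k, x k ^ 2) with hf
  have hx0 : 0 ≤ ∑ k, x k ^ 2 := Finset.sum_nonneg fun _ _ => sq_nonneg _
  have hsc : 0 < √c := Real.sqrt_pos.2 hc
  have hcf : √c ≤ f := Real.sqrt_le_sqrt (by linarith)
  have hf0 : 0 < f := hsc.trans_le hcf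
  have hf2 : f ^ 2 = a + ∑ k, x k ^ 2 := Real.sq_sqrt (by linarith)
  -- The tangent to the square root splits the increment into a term linear in `y`, of mean zero,
  -- and a quadratic one. The offset `a ≥ c > 0` keeps the slope of the tangent bounded.
  have hstep : ∀ i, √(a + ∑ k, (x k + y i k) ^ 2) ≤
      f + (∑ k, x k * y i k) / f + β / (2 * √c) := by
    intro i
    have e : a + ∑ k, (x k + y i k) ^ 2 =
        f ^ 2 + (2 * ∑ k, x k * y i k + ∑ k, y i k ^ 2) := by
      rw [hf2, Finset.mul_sum, add_assoc, ← Finset.sum_add_distrib, ← Finset.sum_add_distrib]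
      congr 1
      exact Finset.sum_congr rfl fun k _ => by ring
    have h0 : 0 ≤ a + ∑ k, (x k + y i k) ^ 2 :=
      add_nonneg (hc.le.trans hca) (Finset.sum_nonneg fun _ _ => sq_nonneg _)
    rw [e] at h0 ⊢
    refine (sqrt_add_le hf0 h0).trans ?_
    have h1 : (∑ k, y i k ^ 2) / (2 * f) ≤ β / (2 * √c) := by
      gcongr
      exact hβ i
    have h2 : (2 * ∑ k, x k * y i k + ∑ k, y i k ^ 2) / (2 * f) =
        (∑ k, x k * y i k) / f + (∑ k, y i k ^ 2) / (2 * f) := by field_simp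
    rw [h2]
    linarith
  -- By Cauchy–Schwarz and `‖x‖ ≤ f` the linear term is at most `l √β` in absolute value, whatever
  -- the dimension of the vectors.
  have hhoef := sum_mul_exp_le (p := p) (y := fun i => l * ((∑ k, x k * y i k) / f))
    (b := l * √β) hp hp1 ?_ (by positivity) ?_
  · calc ∑ i, p i * Real.exp (l * √(a + ∑ k, (x k + y i k) ^ 2))
        ≤ ∑ i, p i * (Real.exp (l * ((∑ k, x k * y i k) / f)) *
            (Real.exp (l * f) * Real.exp (l * (β / (2 * √c))))) := by
          gcongr with i
          · exact hp i
          · rw [← Real.exp_add, ← Real.exp_add, Real.exp_le_exp]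
            have := mul_le_mul_of_nonneg_left (hstep i) hl
            linarith
      _ = (∑ i, p i * Real.exp (l * ((∑ k, x k * y i k) / f))) *
            (Real.exp (l * f) * Real.exp (l * (β / (2 * √c)))) := by
          rw [Finset.sum_mul]
          exact Finset.sum_congr rfl fun i _ => by ring
      _ ≤ Real.exp ((l * √β) ^ 2 / 2) * (Real.exp (l * f) * Real.exp (l * (β / (2 * √c)))) := by
          gcongr
      _ = _ := by
          rw [mul_pow, Real.sq_sqrt hβ0, Real.exp_add]
          ring
  · have : ∀ i, p i * (l * ((∑ k, x k * y i k) / f)) = ∑ k, l / f * x k * (p i * y i k) := by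
      intro i
      rw [Finset.sum_div, Finset.mul_sum, Finset.mul_sum]
      exact Finset.sum_congr rfl fun k _ => by ring
    simp only [this]
    rw [Finset.sum_comm]
    simp [← Finset.mul_sum, hy]
  · intro i
    rw [abs_mul, abs_of_nonneg hl, abs_div, abs_of_pos hf0]
    refine mul_le_mul_of_nonneg_left ?_ hl
    rw [div_le_iff₀ hf0]
    refine abs_le_of_sq_le_sq ?_ (by positivity)
    rw [mul_pow, Real.sq_sqrt hβ0, hf2]
    have h1 := Finset.sum_mul_sq_le_sq_mul_sq Finset.univ x (y i)
    have h2 : (∑ k, x k ^ 2) * (∑ k, y i k ^ 2) ≤ (∑ k, x k ^ 2) * β := by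
      gcongr
      exact hβ i
    nlinarith [mul_nonneg hβ0 (hc.le.trans hca)]

/-! ### The measurement networks -/

section Pairing

/-- The row of the network for the round `r` that belongs to the mode `i`, whose partner is
`r - i`. -/
def pairRow (φ : ℂ) (r i : Fin m) : Fin m → ℂ :=
  if i < r - i then (√2 / 2 : ℂ) • (φ • Pi.single i 1 - Pi.single (r - i) 1)
  else if r - i < i then (√2 / 2 : ℂ) • (φ • Pi.single (r - i) 1 + Pi.single i 1)
  else Pi.single i 1

/-- The probability to observe the mode `i` behind the network for the round `r`. -/
def pairProb (K : Matrix (Fin m) (Fin m) ℂ) (φ : ℂ) (r i : Fin m) : ℝ :=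
  if i < r - i then ((K i i + K (r - i) (r - i)) / 2 - φ * K i (r - i)).re
  else if r - i < i then ((K (r - i) (r - i) + K i i) / 2 + φ * K (r - i) i).re
  else (K i i).re

/-- Expand the quadratic form of a balanced superposition. By hermiticity the two cross terms are
conjugate, so together they leave the real part of `φ K`, with opposite signs for the two partners.
-/
theorem re_pairRow_dotProduct {K : Matrix (Fin m) (Fin m) ℂ} (hK : Kᴴ = K) {φ : ℂ}
    (hφ : φ * star φ = 1) (r i : Fin m) :
    (pairRow φ r i ⬝ᵥ K *ᵥ star (pairRow φ r i)).re = pairProb K φ r i := by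
  have hs : ∀ a b, K a b = star (K b a) := fun a b => (congrFun (congrFun hK a) b).symm
  have h2 : (√2 / 2 : ℂ) * (√2 / 2) = 1 / 2 := by
    have : (√2 : ℂ) * √2 = 2 := by exact_mod_cast Real.mul_self_sqrt (by norm_num : (0:ℝ) ≤ 2)
    linear_combination this / 4
  have hst : star (√2 / 2 : ℂ) = √2 / 2 := by
    have : star ((√2 : ℝ) : ℂ) = (√2 : ℝ) := Complex.conj_ofReal _
    rw [star_div₀, this]
    simp
  unfold pairRow pairProb
  have hre : ∀ z : ℂ, (star z).re = z.re := fun z => Complex.conj_re z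
  split_ifs with h h'
  · have e : ((√2 / 2 : ℂ) • (φ • Pi.single i 1 - Pi.single (r - i) 1) ⬝ᵥ
        K *ᵥ star ((√2 / 2 : ℂ) • (φ • Pi.single i 1 - Pi.single (r - i) 1))) =
        (K i i + K (r - i) (r - i)) / 2 - (φ * K i (r - i) + star (φ * K i (r - i))) / 2 := by
      simp only [star_smul, star_sub, Matrix.mulVec_smul, Matrix.mulVec_sub, smul_dotProduct,
        dotProduct_smul, sub_dotProduct, dotProduct_sub, single_dotProduct, smul_eq_mul, star_mul,
        ← Pi.single_star, star_one, Matrix.mulVec_single, Matrix.col_apply, hst,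
        MulOpposite.op_one, one_smul, one_mul]
      rw [hs (r - i) i]
      linear_combination (φ * star φ * K i i - φ * K i (r - i) - star φ * star (K i (r - i))
        + K (r - i) (r - i)) * h2 + K i i / 2 * hφ
    rw [e, Complex.sub_re, Complex.sub_re]
    congr 1
    have : ∀ z : ℂ, ((z + star z) / 2).re = z.re := fun z => by
      rw [Complex.div_ofNat_re, Complex.add_re, hre]; ring
    exact this _
  · have e : ((√2 / 2 : ℂ) • (φ • Pi.single (r - i) 1 + Pi.single i 1) ⬝ᵥ
        K *ᵥ star ((√2 / 2 : ℂ) • (φ • Pi.single (r - i) 1 + Pi.single i 1))) =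
        (K (r - i) (r - i) + K i i) / 2 + (φ * K (r - i) i + star (φ * K (r - i) i)) / 2 := by
      simp only [star_smul, star_add, Matrix.mulVec_smul, Matrix.mulVec_add, smul_dotProduct,
        dotProduct_smul, add_dotProduct, dotProduct_add, single_dotProduct, smul_eq_mul, star_mul,
        ← Pi.single_star, star_one, Matrix.mulVec_single, Matrix.col_apply, hst,
        MulOpposite.op_one, one_smul, one_mul]
      rw [hs i (r - i)]
      linear_combination (φ * star φ * K (r - i) (r - i) + φ * K (r - i) i
        + star φ * star (K (r - i) i) + K i i) * h2 + K (r - i) (r - i) / 2 * hφ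
    rw [e, Complex.add_re, Complex.add_re]
    congr 1
    have : ∀ z : ℂ, ((z + star z) / 2).re = z.re := fun z => by
      rw [Complex.div_ofNat_re, Complex.add_re, hre]; ring
    exact this _
  · simp

/-! ### The empirical estimate of the kernel -/

variable [NeZero m]

/-- The estimate of the kernel from the numbers `x r i` and `y r i` of observations of the mode
`i` in the round `r`, without and with phaseshifters, in `N` measurements for each round. -/
def estimate (N : ℕ) (x y : Fin m → Fin m → ℝ) : Matrix (Fin m) (Fin m) ℂ :=
  Matrix.of fun i j =>
    (((if i < j then x (i + j) j - x (i + j) i else if j < i then x (i + j) i - x (i + j) j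
      else x (i + j) i + x (i + j) i) / 2 : ℝ) -
      ((y (i + j) j - y (i + j) i) / 2 : ℝ) * Complex.I) / N

/-- In the difference of the two tallies of a pair the diagonal average cancels, and half of it
estimates `N` times the real part of `φ K`. For `φ = I` this is minus the imaginary part, whence the
sign in `estimate`. -/
theorem norm_sq_estimate_sub_le {K : Matrix (Fin m) (Fin m) ℂ} (hK : Kᴴ = K) {N : ℕ}
    (hN : 0 < N) (x y : Fin m → Fin m → ℝ) (i j : Fin m) :
    ‖(estimate N x y - K) i j‖ ^ 2 ≤
      ((x (i + j) i - N * pairProb K 1 (i + j) i) ^ 2 +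
        (x (i + j) j - N * pairProb K 1 (i + j) j) ^ 2 +
        (y (i + j) i - N * pairProb K Complex.I (i + j) i) ^ 2 +
        (y (i + j) j - N * pairProb K Complex.I (i + j) j) ^ 2) / (2 * N ^ 2) := by
  have hN' : (0 : ℝ) < N := by exact_mod_cast hN
  have hNc : (N : ℂ) ≠ 0 := by exact_mod_cast hN.ne'
  have hs : ∀ a b, K a b = star (K b a) := fun a b => (congrFun (congrFun hK a) b).symm
  have key : ∀ X Y : ℝ, (estimate N x y - K) i j = (X - Y * Complex.I) / N →
      X ^ 2 + Y ^ 2 ≤ ((x (i + j) i - N * pairProb K 1 (i + j) i) ^ 2 +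
        (x (i + j) j - N * pairProb K 1 (i + j) j) ^ 2 +
        (y (i + j) i - N * pairProb K Complex.I (i + j) i) ^ 2 +
        (y (i + j) j - N * pairProb K Complex.I (i + j) j) ^ 2) / 2 →
      ‖(estimate N x y - K) i j‖ ^ 2 ≤
      ((x (i + j) i - N * pairProb K 1 (i + j) i) ^ 2 +
        (x (i + j) j - N * pairProb K 1 (i + j) j) ^ 2 +
        (y (i + j) i - N * pairProb K Complex.I (i + j) i) ^ 2 +
        (y (i + j) j - N * pairProb K Complex.I (i + j) j) ^ 2) / (2 * N ^ 2) := by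
    intro X Y h h'
    have e : ‖((X : ℂ) - Y * Complex.I) / N‖ ^ 2 = (X ^ 2 + Y ^ 2) / N ^ 2 := by
      rw [norm_div, div_pow, Complex.norm_natCast, Complex.sq_norm, Complex.normSq_apply]
      simp
      ring
    rw [h, e, ← div_div]
    gcongr
  have hi : i + j - i = j := add_sub_cancel_left i j
  have hj : i + j - j = i := add_sub_cancel_right i j
  set r := i + j with hr
  set dx := fun a => x r a - N * pairProb K 1 r a with hdx
  set dy := fun a => y r a - N * pairProb K Complex.I r a with hdy
  have hsq : ∀ a b : ℝ, ((a - b) / 2) ^ 2 ≤ (a ^ 2 + b ^ 2) / 2 := fun a b => by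
    nlinarith [sq_nonneg (a + b)]
  rcases lt_trichotomy i j with h | h | h
  · refine key ((dx j - dx i) / 2) ((dy j - dy i) / 2) ?_ ?_
    · simp only [hdx, hdy, Matrix.sub_apply, estimate, Matrix.of_apply, ← hr, if_pos h, pairProb,
        hi, hj, if_neg h.not_gt]
      rw [eq_div_iff hNc, sub_mul, div_mul_cancel₀ _ hNc]
      refine Complex.ext ?_ ?_ <;> simp <;> ring
    · have h1 := hsq (dx j) (dx i)
      have h2 := hsq (dy j) (dy i)
      linarith
  · subst h
    refine key (dx i) 0 ?_ ?_
    · simp only [hdx, Matrix.sub_apply, estimate, Matrix.of_apply, ← hr, lt_irrefl, pairProb,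
        hi, if_false]
      rw [eq_div_iff hNc, sub_mul, div_mul_cancel₀ _ hNc]
      have : (K i i).im = 0 := by
        have h1 := congrArg Complex.im (hs i i)
        have h2 : (star (K i i)).im = -(K i i).im := Complex.conj_im _
        linarith
      refine Complex.ext ?_ ?_ <;> simp [this]; ring
    · nlinarith [sq_nonneg (dy i)]
  · refine key ((dx i - dx j) / 2) ((dy j - dy i) / 2) ?_ ?_
    · simp only [hdx, hdy, Matrix.sub_apply, estimate, Matrix.of_apply, ← hr, if_pos h, pairProb,
        hi, hj, if_neg h.not_gt]
      rw [eq_div_iff hNc, sub_mul, div_mul_cancel₀ _ hNc, hs i j]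
      refine Complex.ext ?_ ?_ <;> simp <;> ring
    · have h1 := hsq (dx i) (dx j)
      have h2 := hsq (dy j) (dy i)
      linarith

/-- Since `(i, j) ↦ (i + j, i)` and `(i, j) ↦ (i + j, j)` are bijections, every tally is used
exactly twice, which cancels the `2` in the denominator. -/
theorem frob_estimate_sub_le {K : Matrix (Fin m) (Fin m) ℂ} (hK : Kᴴ = K) {N : ℕ}
    (hN : 0 < N) (x y : Fin m → Fin m → ℝ) :
    frob (estimate N x y - K) ≤
      (∑ r, ∑ i, (x r i - N * pairProb K 1 r i) ^ 2 +
        ∑ r, ∑ i, (y r i - N * pairProb K Complex.I r i) ^ 2) / N ^ 2 := by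
  have h1 : ∀ g : Fin m → Fin m → ℝ, ∑ i, ∑ j, g (i + j) i = ∑ r, ∑ i, g r i := by
    intro g
    rw [Finset.sum_comm (f := fun r i => g r i)]
    exact Finset.sum_congr rfl fun i _ => Equiv.sum_comp (Equiv.addLeft i) fun r => g r i
  have h2 : ∀ g : Fin m → Fin m → ℝ, ∑ i, ∑ j, g (i + j) j = ∑ r, ∑ i, g r i := by
    intro g
    rw [Finset.sum_comm, ← h1 g]
    exact Finset.sum_congr rfl fun i _ => Finset.sum_congr rfl fun j _ => by rw [add_comm]
  refine (Finset.sum_le_sum fun i _ => Finset.sum_le_sum fun j _ =>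
    norm_sq_estimate_sub_le hK hN x y i j).trans (le_of_eq ?_)
  simp only [← Finset.sum_div, Finset.sum_add_distrib]
  rw [h1 fun r i => (x r i - N * pairProb K 1 r i) ^ 2,
    h2 fun r i => (x r i - N * pairProb K 1 r i) ^ 2,
    h1 fun r i => (y r i - N * pairProb K Complex.I r i) ^ 2,
    h2 fun r i => (y r i - N * pairProb K Complex.I r i) ^ 2]
  have hN' : (0 : ℝ) < N := by exact_mod_cast hN
  field_simp
  ring

end Pairing

/-! ### One measurement -/

theorem sum_norm_sq_slater_eq_one {A : Matrix (Fin m) (Fin n) ℂ} (hA : Aᴴ * A = 1) :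
    ∑ S, ‖slater A S‖ ^ 2 = 1 := by
  have := sum_norm_sq_slater A
  rw [hA, Matrix.det_one] at this
  exact_mod_cast this

open Classical in
/-- The occupation number of the mode `i`. -/
def occNum (S : Finset (Fin m)) (i : Fin m) : ℝ := if i ∈ S then 1 else 0

/-- For `o` and `p` in `[0, 1]` one has `(o - p)² ≤ o + p`, and both vectors sum to `n`. The bound
`2 n` instead of `m` is what gives the claimed number of copies. -/
theorem sum_occNum_sub_sq_le {A : Matrix (Fin m) (Fin n) ℂ} (hA : Aᴴ * A = 1) (S : Occ m n) :
    ∑ i, (occNum S.1 i - ((A * Aᴴ) i i).re) ^ 2 ≤ 2 * n := by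
  classical
  have hp0 : ∀ i, 0 ≤ ((A * Aᴴ) i i).re := by
    intro i
    rw [← sum_norm_sq_slater_of_mem hA]
    exact Finset.sum_nonneg fun S _ => by split_ifs <;> positivity
  have hp1 : ∀ i, ((A * Aᴴ) i i).re ≤ 1 := by
    intro i
    rw [← sum_norm_sq_slater_of_mem hA]
    exact (Finset.sum_le_sum fun S _ => mul_le_of_le_one_right (sq_nonneg _) (by
      split_ifs <;> norm_num)).trans_eq (sum_norm_sq_slater_eq_one hA)
  have hps : ∑ i, ((A * Aᴴ) i i).re = n := by
    have := congrArg Complex.re (trace_mul_conjTranspose hA)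
    rw [Matrix.trace, Complex.re_sum] at this
    simpa using this
  have hos : ∑ i, occNum S.1 i = n := by
    simp only [occNum, Finset.sum_boole]
    rw [Finset.filter_mem_eq_inter, Finset.univ_inter]
    exact_mod_cast Set.powersetCard.card_eq S
  calc ∑ i, (occNum S.1 i - ((A * Aᴴ) i i).re) ^ 2
      ≤ ∑ i, (occNum S.1 i + ((A * Aᴴ) i i).re) := by
        refine Finset.sum_le_sum fun i _ => ?_
        have h0 := hp0 i
        have h1 := hp1 i
        unfold occNum
        split_ifs <;> nlinarith
    _ = 2 * n := by rw [Finset.sum_add_distrib, hos, hps]; ring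

theorem sum_mul_occNum_sub_eq_zero {A : Matrix (Fin m) (Fin n) ℂ} (hA : Aᴴ * A = 1) (i : Fin m) :
    ∑ S : Occ m n, ‖slater A S‖ ^ 2 * (occNum S.1 i - ((A * Aᴴ) i i).re) = 0 := by
  simp only [mul_sub, Finset.sum_sub_distrib, ← Finset.sum_mul, sum_norm_sq_slater_eq_one hA,
    one_mul]
  rw [sub_eq_zero, ← sum_norm_sq_slater_of_mem hA]
  rfl

/-! ### One candidate -/

/-- The columns `S` of `A A† + E` are, in a suitable basis, close to the columns of `A`. -/
def GoodSample (A : Matrix (Fin m) (Fin n) ℂ) (E : Matrix (Fin m) (Fin m) ℂ) (S : Occ m n) :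
    Prop :=
  slater A S ≠ 0 ∧ frob (colError A E S) ≤ 2 * n * frob E

open Classical in
theorem sum_not_goodSample_le {A : Matrix (Fin m) (Fin n) ℂ} (hA : Aᴴ * A = 1)
    (E : Matrix (Fin m) (Fin m) ℂ) :
    ∑ S : Occ m n, ‖slater A S‖ ^ 2 * (if GoodSample A E S then 0 else 1) ≤ 1 / 2 := by
  have h := sum_slater_mul_frob_colError_le hA E
  have hne : 0 ≤ (n : ℝ) * frob E := mul_nonneg (Nat.cast_nonneg n) (frob_nonneg E)
  -- Markov's inequality at twice the mean needs a positive mean. If it is zero, every `S` of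
  -- positive probability has no error at all.
  rcases hne.eq_or_lt with h0 | h0
  · rw [← h0] at h
    have h1 : ∀ S : Occ m n, ‖slater A S‖ ^ 2 * (if GoodSample A E S then 0 else 1) = 0 := by
      intro S
      have h2 := (Finset.sum_eq_zero_iff_of_nonneg fun S _ =>
        mul_nonneg (sq_nonneg _) (frob_nonneg _)).1
        (le_antisymm h (Finset.sum_nonneg fun S _ => mul_nonneg (sq_nonneg _) (frob_nonneg _))) S
        (Finset.mem_univ S)
      by_cases hS : slater A S = 0
      · simp [hS]
      · have h3 : frob (colError A E S) = 0 := by simpa [hS] using h2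
        have : GoodSample A E S := ⟨hS, by rw [h3]; linarith⟩
        simp [this]
    simp [h1]
  · have h1 : ∀ S : Occ m n, ‖slater A S‖ ^ 2 * (if GoodSample A E S then 0 else 1) *
        (2 * n * frob E) ≤ ‖slater A S‖ ^ 2 * frob (colError A E S) := by
      intro S
      by_cases hS : slater A S = 0
      · simp [hS]
      · split_ifs with hg
        · simp only [mul_zero, zero_mul]
          exact mul_nonneg (sq_nonneg _) (frob_nonneg _)
        · have : 2 * n * frob E < frob (colError A E S) := by
            by_contra hc
            exact hg ⟨hS, not_lt.1 hc⟩
          rw [mul_one]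
          gcongr
    have h2 := (Finset.sum_le_sum fun S _ => h1 S).trans h
    rw [← Finset.sum_mul] at h2
    have h3 := h2.trans (le_of_eq (by ring : (n : ℝ) * frob E = 1 / 2 * (2 * n * frob E)))
    exact le_of_mul_le_mul_right h3 (by linarith)

/-- A projection that fixes the selected columns fixes all their combinations, in particular `A +
colError A E S`; `frob_sub_le_of_fixes` then doubles the error `2 n ‖E‖²`. -/
theorem GoodSample.frob_sub_le {A : Matrix (Fin m) (Fin n) ℂ} (hA : Aᴴ * A = 1)
    {E Q : Matrix (Fin m) (Fin m) ℂ} {S : Occ m n} (hS : GoodSample A E S) {t : ℕ} (ht : t ≤ n)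
    (hQ : IsKernel t Q)
    (hfix : ∀ i ∈ S.1, Q *ᵥ (fun a => (A * Aᴴ + E) a i) = fun a => (A * Aᴴ + E) a i) :
    frob (Q - A * Aᴴ) ≤ 4 * n * frob E := by
  obtain ⟨B, hB, rfl⟩ := hQ
  have h1 : B * Bᴴ * (A * Aᴴ + E).submatrix id S.emb = (A * Aᴴ + E).submatrix id S.emb := by
    ext a k
    exact congrFun (hfix (S.emb k) ((S.exists_emb_iff _).1 ⟨k, rfl⟩)) a
  have h2 : B * Bᴴ * (A + colError A E S) = A + colError A E S := by
    rw [← submatrix_mul_inv E hS.1, ← Matrix.mul_assoc, h1]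
  have h3 := frob_sub_le_of_fixes hA hB ht h2
  have := hS.2
  linarith

/-- A projection of rank at most `n` close to an accurate estimate of the kernel has the required
properties. -/
theorem isKernel_and_tvDist_le {A : Matrix (Fin m) (Fin n) ℂ} (hA : Aᴴ * A = 1)
    {ψ : FockState m n} (hψ : ∀ S, ψ.amp S = slater A S) {Q : Matrix (Fin m) (Fin m) ℂ} {t : ℕ}
    (ht : t ≤ n) (hQ : IsKernel t Q) {ε : ℝ} (hε : 0 ≤ ε) (h1 : frob (Q - A * Aᴴ) < 1)
    (h2 : frob (Q - A * Aᴴ) ≤ 2 * ε ^ 2) :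
    IsKernel n Q ∧ tvDist (kernelProb (n := n) Q) ψ.prob ≤ ε := by
  obtain ⟨B, hB, rfl⟩ := hQ
  obtain rfl : t = n := le_antisymm ht (le_of_frob_sub_lt_one hA hB h1)
  refine ⟨⟨B, hB, rfl⟩, ?_⟩
  have h3 := tvDist_sq_le_frob hA hB
  have h4 : kernelProb (n := t) (B * Bᴴ) = fun S => ‖slater B S‖ ^ 2 :=
    funext fun S => kernelProb_eq_slater B S
  have h5 : ψ.prob = fun S => ‖slater A S‖ ^ 2 := funext fun S => by rw [FockState.prob, hψ]
  rw [h4, h5]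
  exact le_of_sq_le_sq (h3.trans (by linarith)) hε

end
end FermionLearning

namespace FermionLearning
noncomputable section

variable {m n : ℕ} {ψ : FockState m n} {s : State m}

/-! ### Frames of straight-line code -/

/-- The instruction changes at most the index variables `I` and the arrays `A`. -/
def Instr.within (I A : List ℕ) : Instr → Bool
  | .idxConst i _ => I.contains i
  | .idxAdd i _ _ => I.contains i
  | .idxSub i _ _ => I.contains i
  | .numConst x _ => A.contains x.arr
  | .numI x => A.contains x.arr
  | .numOfIdx x _ => A.contains x.arr
  | .numConj x _ => A.contains x.arr
  | .numOp _ x _ _ => A.contains x.arr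
  | .readMode i _ => I.contains i
  | _ => false

theorem Frame.set {I A : List ℕ} {s s' : State m} (h : Frame I A s s') {x : Cell}
    (hx : x.arr ∈ A) (v : ℂ) : Frame I A s (s'.set x v) := by
  refine ⟨⟨h.idx, fun a ha => ?_, h.outcome, h.log⟩, h.net⟩
  rw [← h.num a ha]
  funext i j
  exact if_neg fun (hh : a = x.arr ∧ _) => ha (hh.1 ▸ hx)

theorem Frame.effect {I A : List ℕ} {s s' : State m} (h : Frame I A s s') {a : Instr}
    (ha : a.within I A = true) : Frame I A s (a.effect s') := by
  cases a <;> simp only [Instr.within, List.contains_iff_mem, Bool.false_eq_true] at ha <;>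
    first | exact h.setIdx ha _ | exact h.set ha _

theorem Frame.foldl_effect {I A : List ℕ} {l : List Instr}
    (hl : l.all (Instr.within I A) = true) (s : State m) :
    Frame I A s (l.foldl Instr.effect s) := by
  suffices h : ∀ s', Frame I A s s' → Frame I A s (l.foldl Instr.effect s') from
    h s (Frame.refl I A s)
  induction l with
  | nil => exact fun s' h => h
  | cons a l ih =>
    intro s' h
    rw [List.all_cons, Bool.and_eq_true] at hl
    exact ih hl.2 _ (h.effect hl.1)

theorem hoare_block_frame {I A : List ℕ} {l : List Instr} {Q : State m → Prop}
    (hl : l.all (Instr.within I A) = true) (hne : l ≠ [])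
    (h : Frame I A s (l.foldl Instr.effect s) → Q (l.foldl Instr.effect s)) :
    Hoare ψ (block l) s (2 * l.length) Q := by
  refine hoare_block (fun a ha => ?_) hne (h (Frame.foldl_effect hl s))
  have := List.all_eq_true.1 hl a ha
  cases a <;> trivial

theorem State.setIdx_idx (s : State m) (i v k : ℕ) :
    (s.setIdx i v).idx k = if k = i then v else s.idx k := Function.update_apply _ _ _ _

theorem State.setIdx_num (s : State m) (i v : ℕ) : (s.setIdx i v).num = s.num := rfl

theorem State.set_idx (s : State m) (x : Cell) (v : ℂ) : (s.set x v).idx = s.idx := rfl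

theorem State.set_num (s : State m) (x : Cell) (v : ℂ) (a i j : ℕ) :
    (s.set x v).num a i j =
      if a = x.arr ∧ i = s.idx x.row ∧ j = s.idx x.col then v else s.num a i j := rfl

/-! ### Loops that fill a matrix -/

/-- The scalar variable number `k`: a cell of array `k` (the index variable `2` holds `0`). -/
def sc (k : ℕ) : Cell := ⟨k, 2, 2⟩

/-- A double loop that replaces the entry `(i, j)` of the array `a` by `g i j` of its value. -/
theorem hoare_fillMatrix {P : Program} {i₁ i₂ a t : ℕ} {I A : List ℕ} (g : ℕ → ℕ → ℂ → ℂ)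
    (h0 : s.idx 0 = m) (h3 : s.idx 3 = 1) (h12 : i₁ ≠ i₂) (hI0 : 0 ∉ I) (hI3 : 3 ∉ I)
    (hi₁ : i₁ ∈ I) (hi₂ : i₂ ∈ I)
    (hbody : ∀ i j s', i < m → j < m → s'.idx i₁ = i → s'.idx i₂ = j → Frame I A s s' →
      Hoare ψ P s' t fun s'' => s''.idx i₁ = i ∧ s''.idx i₂ = j ∧ Frame I A s' s'' ∧
        ∀ k l, s''.num a k l = if k = i ∧ l = j then g i j (s'.num a i j) else s'.num a k l) :
    Hoare ψ (forLoop i₁ 0 (forLoop i₂ 0 P)) s (m * (m * (t + 3) + 6) + 3) fun s' =>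
      Frame I A s s' ∧ ∀ i j, i < m → j < m → s'.num a i j = g i j (s.num a i j) := by
  refine (hoare_forLoop I A (fun i s' => ∀ k l, s'.num a k l =
    if k < i ∧ l < m then g k l (s.num a k l) else s.num a k l) h0 h3 hI3 hI0 hi₁ ?_ ?_).mono
    (t := m * (m * (t + 3) + 3 + 3) + 3) le_rfl ?_
  · intro k l; simp [State.setIdx_num]
  · intro i s' hi hi1 hF hInv
    have h0' := (hF.idx 0 hI0).trans h0
    have h3' := (hF.idx 3 hI3).trans h3
    refine (hoare_forLoop I A (fun j s'' => s''.idx i₁ = i ∧ ∀ k l, s''.num a k l =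
      if (k < i ∧ l < m) ∨ (k = i ∧ l < j) then g k l (s.num a k l) else s.num a k l)
      h0' h3' hI3 hI0 hi₂ ?_ ?_).mono le_rfl ?_
    · refine ⟨?_, fun k l => ?_⟩
      · rw [State.setIdx_idx, if_neg h12, hi1]
      · simp [State.setIdx_num, hInv]
    · rintro j s'' hj hj2 hF' ⟨hi1', hInv'⟩
      refine (hbody i j s'' hi hj hi1' hj2 (hF.trans hF' (fun _ => id) fun _ => id)).mono le_rfl ?_
      rintro s3 ⟨e1, e2, e3, e4⟩
      refine ⟨e2, e3, ?_, fun k l => ?_⟩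
      · rw [State.setIdx_idx, if_neg h12, e1]
      · rw [State.setIdx_num, e4, hInv', hInv']
        by_cases h : k = i ∧ l = j
        · obtain ⟨rfl, rfl⟩ := h
          simp
        · rw [if_neg h]
          have : (k < i ∧ l < m ∨ k = i ∧ l < j + 1) ↔ (k < i ∧ l < m ∨ k = i ∧ l < j) := by
            omega
          simp only [this]
    · rintro s'' ⟨hF', hi1', hInv'⟩
      refine ⟨hi1', hF', fun k l => ?_⟩
      rw [State.setIdx_num, hInv']
      have : (k < i ∧ l < m ∨ k = i ∧ l < m) ↔ (k < i + 1 ∧ l < m) := by omega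
      simp only [this]
  · rintro s' ⟨hF, hInv⟩
    exact ⟨hF, fun i j hi hj => by rw [hInv, if_pos ⟨hi, hj⟩]⟩

/-! ### The parameters of the algorithm -/

/-- Constants, `g = δ / 2` and `ε²`. -/
def initBlock : Program := block
  [.idxConst 3 1, .idxAdd 6 0 0, .numConst (sc 10) (1 / 2), .numConst (sc 11) 1,
    .numOp .mul (sc 12) ⟨0, 2, 3⟩ (sc 10), .numOp .mul (sc 14) ⟨0, 2, 2⟩ ⟨0, 2, 2⟩,
    .numI (sc 19), .numOp .add (sc 18) (sc 11) (sc 19)]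

/-- The number `R` of doublings that take `g` to at least `1`. -/
def doublingLoop : Program :=
  .whileDo (.numLt (sc 12) (sc 11)) (block [.numOp .add (sc 12) (sc 12) (sc 12), .idxAdd 4 4 3])

/-- The number `2000 R n² m`. -/
def targetBlock : Program := block
  [.numOfIdx (sc 15) 4, .numOfIdx (sc 16) 1, .numOp .mul (sc 15) (sc 15) (sc 16),
    .numOp .mul (sc 15) (sc 15) (sc 16), .numOfIdx (sc 16) 0,
    .numOp .mul (sc 15) (sc 15) (sc 16), .numConst (sc 16) 2000,
    .numOp .mul (sc 15) (sc 15) (sc 16)]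

/-- The number `N` of measurements for each basis. -/
def countLoop : Program :=
  .whileDo (.numLt (sc 13) (sc 15)) (block [.numOp .add (sc 13) (sc 13) (sc 14), .idxAdd 5 5 3])

def prelude : Program := .seq initBlock (.seq doublingLoop (.seq targetBlock countLoop))

/-- The contents of the variables that stay constant after the prelude. -/
structure Ready (R N : ℕ) (s : State m) : Prop where
  idx0 : s.idx 0 = m
  idx2 : s.idx 2 = 0
  idx3 : s.idx 3 = 1
  idx4 : s.idx 4 = R
  idx5 : s.idx 5 = N
  idx6 : s.idx 6 = m + m
  half : s.num 10 0 0 = 1 / 2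
  one : s.num 11 0 0 = 1
  oneI : s.num 18 0 0 = 1 + Complex.I
  I : s.num 19 0 0 = Complex.I
  zero : s.num 27 0 0 = 0

theorem Ready.frame {R N : ℕ} {s s' : State m} (h : Ready R N s) {I A : List ℕ}
    (hF : NetFrame I A s s') (hI : ∀ k ∈ [0, 2, 3, 4, 5, 6], k ∉ I)
    (hA : ∀ a ∈ [10, 11, 18, 19, 27], a ∉ A) : Ready R N s' := by
  simp only [List.forall_mem_cons] at hI hA
  obtain ⟨i0, i2, i3, i4, i5, i6, -⟩ := hI
  obtain ⟨a10, a11, a18, a19, a27, -⟩ := hA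
  exact ⟨(hF.idx _ i0).trans h.idx0, (hF.idx _ i2).trans h.idx2, (hF.idx _ i3).trans h.idx3,
    (hF.idx _ i4).trans h.idx4, (hF.idx _ i5).trans h.idx5, (hF.idx _ i6).trans h.idx6,
    (congrFun₂ (hF.num _ a10) 0 0).trans h.half, (congrFun₂ (hF.num _ a11) 0 0).trans h.one,
    (congrFun₂ (hF.num _ a18) 0 0).trans h.oneI, (congrFun₂ (hF.num _ a19) 0 0).trans h.I,
    (congrFun₂ (hF.num _ a27) 0 0).trans h.zero⟩

/-- The machine has neither logarithms nor rounding, so it finds `R` and `N` by counting. The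
minimality hypotheses say that the loops do not stop earlier. -/
theorem hoare_prelude {ε δ : ℝ} {R N : ℕ} (hR : 1 ≤ 2 ^ R * (δ / 2))
    (hR' : ∀ j < R, 2 ^ j * (δ / 2) < 1) (hN : 2000 * R * n ^ 2 * m ≤ N * ε ^ 2)
    (hN' : ∀ j < N, j * ε ^ 2 < 2000 * R * n ^ 2 * m) :
    Hoare ψ prelude (State.start m n ε δ) (5 * R + 5 * N + 40) fun s =>
      Ready R N s ∧ Frame [3, 4, 5, 6] [10, 11, 12, 13, 14, 15, 16, 18, 19]
        (State.start m n ε δ) s := by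
  set s₀ : State m := State.start m n ε δ with hs₀
  have h1 : Hoare ψ initBlock s₀ 16 fun s =>
      Frame [3, 6] [10, 11, 12, 14, 18, 19] s₀ s ∧ s.idx 3 = 1 ∧ s.idx 6 = m + m ∧
        s.num 10 0 0 = 1 / 2 ∧ s.num 11 0 0 = 1 ∧ s.num 12 0 0 = ((δ / 2 : ℝ) : ℂ) ∧
        s.num 14 0 0 = ((ε ^ 2 : ℝ) : ℂ) ∧ s.num 19 0 0 = Complex.I ∧
        s.num 18 0 0 = 1 + Complex.I := by
    refine hoare_block_frame (by decide) (by decide) fun hF => ⟨hF, ?_⟩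
    simp [List.foldl, Instr.effect, State.setIdx_idx, State.setIdx_num, State.set_idx,
      State.set_num, State.get, sc, hs₀, State.start, NumOp.eval]
    refine ⟨by ring, by ring⟩
  refine (h1.seq (t' := (R * 5 + 1) + (16 + (N * 5 + 1) + 1) + 1) ?_).mono (by omega)
    fun _ => id
  rintro s ⟨hF1, i3, i6, c10, c11, c12, c14, c19, c18⟩
  have h2 : Hoare ψ doublingLoop s (R * 5 + 1) fun s' =>
      Frame [4] [12] s s' ∧ s'.idx 4 = R := by
    refine (Hoare.whileDo (t := 4) R (fun j s' => j ≤ R ∧ Frame [4] [12] s s' ∧ s'.idx 4 = j ∧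
      s'.num 12 0 0 = ((2 ^ j * (δ / 2) : ℝ) : ℂ)) ?_ ?_ ?_).mono le_rfl ?_
    · rintro j s' ⟨hj, hF, h4, h12⟩
      refine ⟨hj, ?_⟩
      have e2 : s'.idx 2 = 0 := (hF.idx 2 (by decide)).trans (hF1.idx 2 (by decide))
      have e11 : s'.num 11 0 0 = 1 := (congrFun₂ (hF.num 11 (by decide)) 0 0).trans c11
      simp only [Test.holds, State.get, sc, e2, h12, e11, Complex.ofReal_re, Complex.one_re]
      constructor
      · intro h
        rcases hj.eq_or_lt with rfl | hj
        · linarith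
        · exact hj
      · exact hR' j
    · rintro j s' hj ⟨-, hF, h4, h12⟩
      have e2 : s'.idx 2 = 0 := (hF.idx 2 (by decide)).trans (hF1.idx 2 (by decide))
      have e3 : s'.idx 3 = 1 := (hF.idx 3 (by decide)).trans i3
      refine hoare_block_frame (I := [4]) (A := [12]) (by decide) (by decide) fun hF' =>
        ⟨hj, hF.trans hF' (fun _ => id) fun _ => id, ?_⟩
      simp [List.foldl, Instr.effect, State.setIdx_idx, State.setIdx_num, State.set_idx,
        State.set_num, State.get, sc, NumOp.eval, e2, e3, h4, h12]
      ring
    · refine ⟨Nat.zero_le _, Frame.refl _ _ _, hF1.idx 4 (by decide), ?_⟩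
      rw [c12]; simp
    · rintro s' ⟨-, hF, h4, -⟩
      exact ⟨hF, h4⟩
  refine h2.seq ?_
  rintro s2 ⟨hF2, i4⟩
  have hF12 := hF1.mono (I := [3, 4, 6]) (A := [10, 11, 12, 14, 18, 19])
    (by decide) (by decide) |>.trans hF2 (by decide) (by decide)
  have h3 : Hoare ψ targetBlock s2 16 fun s' =>
      Frame [] [15, 16] s2 s' ∧ s'.num 15 0 0 = ((2000 * R * n ^ 2 * m : ℝ) : ℂ) := by
    have e2 : s2.idx 2 = 0 := hF12.idx 2 (by decide)
    have e1 : s2.idx 1 = n := hF12.idx 1 (by decide)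
    have e0 : s2.idx 0 = m := hF12.idx 0 (by decide)
    refine hoare_block_frame (by decide) (by decide) fun hF => ⟨hF, ?_⟩
    simp [List.foldl, Instr.effect, State.set_idx,
      State.set_num, State.get, sc, NumOp.eval, e0, e1, e2, i4]
    ring
  refine h3.seq ?_
  rintro s3 ⟨hF3, c15⟩
  have hF13 := hF12.mono (I := [3, 4, 6]) (A := [10, 11, 12, 14, 15, 16, 18, 19])
    (by decide) (by decide) |>.trans hF3 (by decide) (by decide)
  have e2 : s3.idx 2 = 0 := hF13.idx 2 (by decide)
  have e3 : s3.idx 3 = 1 := (hF3.idx 3 (by decide)).trans ((hF2.idx 3 (by decide)).trans i3)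
  have e14 : s3.num 14 0 0 = ((ε ^ 2 : ℝ) : ℂ) :=
    (congrFun₂ ((hF3.num 14 (by decide)).trans (hF2.num 14 (by decide))) 0 0).trans c14
  refine (Hoare.whileDo (t := 4) N (fun j s' => j ≤ N ∧ Frame [5] [13] s3 s' ∧ s'.idx 5 = j ∧
      s'.num 13 0 0 = ((j * ε ^ 2 : ℝ) : ℂ)) ?_ ?_ ?_).mono le_rfl ?_
  · rintro j s' ⟨hj, hF, h5, h13⟩
    refine ⟨hj, ?_⟩
    have e2 : s'.idx 2 = 0 := (hF.idx 2 (by decide)).trans e2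
    have e15 : s'.num 15 0 0 = _ := (congrFun₂ (hF.num 15 (by decide)) 0 0).trans c15
    simp only [Test.holds, State.get, sc, e2, h13, e15, Complex.ofReal_re]
    constructor
    · intro h
      rcases hj.eq_or_lt with rfl | hj
      · linarith
      · exact hj
    · exact hN' j
  · rintro j s' hj ⟨-, hF, h5, h13⟩
    have e2 : s'.idx 2 = 0 := (hF.idx 2 (by decide)).trans e2
    have e3 : s'.idx 3 = 1 := (hF.idx 3 (by decide)).trans e3
    have e14 : s'.num 14 0 0 = _ := (congrFun₂ (hF.num 14 (by decide)) 0 0).trans e14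
    refine hoare_block_frame (I := [5]) (A := [13]) (by decide) (by decide) fun hF' =>
      ⟨hj, hF.trans hF' (fun _ => id) fun _ => id, ?_⟩
    simp [List.foldl, Instr.effect, State.setIdx_idx, State.setIdx_num, State.set_idx,
      State.set_num, State.get, sc, NumOp.eval, e2, e3, h5, h13, e14]
    ring
  · refine ⟨Nat.zero_le _, Frame.refl _ _ _, hF13.idx 5 (by decide), ?_⟩
    rw [hF13.num 13 (by decide)]
    simp [hs₀, State.start]
  · rintro s' ⟨-, hF, h5, -⟩
    have hF14 := hF13.mono (I := [3, 4, 5, 6]) (A := [10, 11, 12, 13, 14, 15, 16, 18, 19])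
      (by decide) (by decide) |>.trans hF (by decide) (by decide)
    have hF24 := ((hF2.mono (I := [4, 5]) (A := [12, 13, 15, 16]) (by decide) (by decide)).trans
      hF3 (by decide) (by decide)).trans hF (by decide) (by decide)
    refine ⟨⟨hF14.idx 0 (by decide), hF14.idx 2 (by decide), (hF24.idx 3 (by decide)).trans i3,
      (hF.idx 4 (by decide)).trans ((hF3.idx 4 (by decide)).trans i4), h5,
      (hF24.idx 6 (by decide)).trans i6, ?_, ?_, ?_, ?_, ?_⟩, hF14⟩
    · exact (congrFun₂ (hF24.num 10 (by decide)) 0 0).trans c10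
    · exact (congrFun₂ (hF24.num 11 (by decide)) 0 0).trans c11
    · exact (congrFun₂ (hF24.num 18 (by decide)) 0 0).trans c18
    · exact (congrFun₂ (hF24.num 19 (by decide)) 0 0).trans c19
    · rw [hF14.num 27 (by decide)]
      simp [hs₀, State.start]

end
end FermionLearning

namespace FermionLearning
noncomputable section

variable {m n : ℕ} {ψ : FockState m n} {s : State m}

/-! ### Building the measurement networks -/

/-- The round `r` (index variable `9`) and the phase (scalar `17`) that belong to the basis number
`b` (index variable `7`). -/
def roundBlock : Program :=
  .ite (.idxLt 7 0) (block [.idxAdd 9 7 2, .numConst (sc 17) 1])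
    (block [.idxSub 9 7 0, .numI (sc 17)])

/-- The partner of the mode in the index variable `10`. -/
def partnerBlock : Program :=
  .ite (.idxLt 9 10) (block [.idxAdd 11 9 0, .idxSub 11 11 10]) (block [.idxSub 11 9 10])

/-- Acting only at the smaller mode of a pair joins every pair once and leaves a mode that is its
own partner alone. Scalar `18` holds `1 + I`, whose argument `π / 4` makes the beamsplitter
balanced. -/
def gateBlock : Program :=
  .ite (.idxLt 10 11)
    (.seq (.instr (.phaseshift 10 (sc 17))) (.instr (.beamsplitter 10 11 (sc 18)))) skip

def network : Program :=
  .seq (.instr .resetNet) (forLoop 10 0 (.seq partnerBlock gateBlock))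

theorem phaseGate_mul_row (i : Fin m) (θ : ℝ) (V : Matrix.unitaryGroup (Fin m) ℂ) (a : Fin m) :
    (phaseGate i θ * V).1 a =
      if a = i then Complex.exp (θ * Complex.I) • V.1 a else V.1 a := by
  funext b
  have : (phaseGate i θ * V).1 = Matrix.diagonal (Function.update (fun _ => (1 : ℂ)) i
    (Complex.exp (θ * Complex.I))) * V.1 := rfl
  rw [this, Matrix.diagonal_mul, Function.update_apply]
  split_ifs <;> simp

theorem beamGate_mul_row {i j : Fin m} (h : i ≠ j) (θ : ℝ) (V : Matrix.unitaryGroup (Fin m) ℂ)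
    (a : Fin m) :
    (beamGate i j θ * V).1 a =
      if a = i then (Real.cos θ : ℂ) • V.1 i - (Real.sin θ : ℂ) • V.1 j
      else if a = j then (Real.sin θ : ℂ) • V.1 i + (Real.cos θ : ℂ) • V.1 j
      else V.1 a := by
  have : (beamGate i j θ * V).1 = rotMatrix i j θ * V.1 := by
    rw [beamGate, dif_neg h]
    rfl
  have hrow : rotMatrix i j θ a =
      if a = i then Pi.single i (Real.cos θ : ℂ) - Pi.single j (Real.sin θ : ℂ)
      else if a = j then Pi.single i (Real.sin θ : ℂ) + Pi.single j (Real.cos θ : ℂ)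
      else Pi.single a 1 := rfl
  rw [this, Matrix.mul_apply_eq_vecMul, hrow]
  split_ifs
  · rw [Matrix.sub_vecMul, Matrix.single_vecMul, Matrix.single_vecMul]
    rfl
  · rw [Matrix.add_vecMul, Matrix.single_vecMul, Matrix.single_vecMul]
    rfl
  · rw [Matrix.single_vecMul, one_smul]
    rfl

theorem arg_one_add_I : (1 + Complex.I).arg = Real.pi / 4 := by
  have h2 : (√2 : ℂ) * √2 = 2 := by exact_mod_cast Real.mul_self_sqrt (by norm_num : (0:ℝ) ≤ 2)
  have h : (1 + Complex.I) = ((√2 : ℝ) : ℂ) *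
      (Complex.cos ((Real.pi / 4 : ℝ)) + Complex.sin ((Real.pi / 4 : ℝ)) * Complex.I) := by
    rw [← Complex.ofReal_cos, ← Complex.ofReal_sin, Real.cos_pi_div_four, Real.sin_pi_div_four]
    push_cast
    linear_combination -(1 + Complex.I) / 2 * h2
  rw [h, Complex.arg_mul_cos_add_sin_mul_I (Real.sqrt_pos.2 (by norm_num))]
  constructor <;> linarith [Real.pi_pos]

theorem exp_arg_mul_I {φ : ℂ} (hφ : ‖φ‖ = 1) : Complex.exp (φ.arg * Complex.I) = φ := by
  have := Complex.norm_mul_exp_arg_mul_I φ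
  rwa [hφ, Complex.ofReal_one, one_mul] at this

theorem val_sub_eq_ite (r i : Fin m) :
    ((r - i : Fin m) : ℕ) = if (r : ℕ) < i then r + m - i else r - i := by
  have hr := r.2
  have hi := i.2
  rw [Fin.sub_def]
  simp only
  split_ifs with h
  · rw [show m - (i : ℕ) + r = r + m - i by omega, Nat.mod_eq_of_lt (by omega)]
  · rw [show m - (i : ℕ) + r = (r - i) + m by omega, Nat.add_mod_right, Nat.mod_eq_of_lt (by omega)]

theorem fin_sub_sub_self (r i : Fin m) : r - (r - i) = i := by
  apply Fin.ext
  have hr := r.2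
  have hi := i.2
  have h := val_sub_eq_ite r i
  rw [val_sub_eq_ite]
  split_ifs at h ⊢ <;> omega

/-- The network for the round `r` after the pairs whose smaller mode is below `k` have been
joined. -/
def PartialNet (φ : ℂ) (r : Fin m) (k : ℕ) (V : Matrix.unitaryGroup (Fin m) ℂ) : Prop :=
  ∀ a : Fin m, V.1 a =
    if (a : ℕ) < k ∨ ((r - a : Fin m) : ℕ) < k then pairRow φ r a else Pi.single a 1

theorem PartialNet.join {φ : ℂ} (hφ : ‖φ‖ = 1) {r i : Fin m} (hi : i < r - i)
    {V : Matrix.unitaryGroup (Fin m) ℂ} (hV : PartialNet φ r i V) :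
    PartialNet φ r (i + 1)
      (beamGate i (r - i) (1 + Complex.I).arg * (phaseGate i φ.arg * V)) := by
  have hj : r - (r - i) = i := fin_sub_sub_self r i
  have hi' : (i : ℕ) < ((r - i : Fin m) : ℕ) := hi
  -- Neither mode of this pair has been touched, so both rows are still standard unit vectors.
  have hVi : V.1 i = Pi.single i 1 := by rw [hV, if_neg (by omega)]
  have hVj : V.1 (r - i) = Pi.single (r - i) 1 := by
    rw [hV, hj, if_neg (by omega)]
  intro a
  rw [beamGate_mul_row hi.ne, arg_one_add_I, Real.cos_pi_div_four, Real.sin_pi_div_four,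
    phaseGate_mul_row, phaseGate_mul_row, phaseGate_mul_row, if_pos rfl, if_neg hi.ne',
    exp_arg_mul_I hφ, hVi, hVj]
  by_cases ha : a = i
  · subst ha
    rw [if_pos rfl, if_pos (Or.inl (Nat.lt_succ_self _)), pairRow, if_pos hi, smul_sub]
    push_cast
    rfl
  by_cases ha' : a = r - i
  · rw [if_neg ha, if_pos ha', if_pos (Or.inr (by rw [ha', hj]; exact Nat.lt_succ_self _)),
      pairRow, ha', hj, if_neg hi.not_gt, if_pos hi, smul_add]
    push_cast
    rfl
  · rw [if_neg ha, if_neg ha', if_neg ha, hV]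
    have h1 : (a : ℕ) ≠ i := fun h => ha (Fin.ext h)
    have h2 : ((r - a : Fin m) : ℕ) ≠ i := fun h => ha' (by
      rw [← Fin.ext h, fin_sub_sub_self])
    have : ((a : ℕ) < i ∨ ((r - a : Fin m) : ℕ) < i) ↔
        ((a : ℕ) < i + 1 ∨ ((r - a : Fin m) : ℕ) < i + 1) := by omega
    simp only [this]

/-- Either the partner is smaller and the pair has already been joined, or `i` is its own partner
and `pairRow` is the unit vector. -/
theorem PartialNet.skip {φ : ℂ} {r i : Fin m} (hi : ¬ i < r - i)
    {V : Matrix.unitaryGroup (Fin m) ℂ} (hV : PartialNet φ r i V) :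
    PartialNet φ r (i + 1) V := by
  intro a
  rw [hV]
  have hi' : ¬ (i : ℕ) < ((r - i : Fin m) : ℕ) := hi
  by_cases h : (a : ℕ) < i ∨ ((r - a : Fin m) : ℕ) < i
  · rw [if_pos h, if_pos (by omega)]
  rw [if_neg h]
  split_ifs with h'
  · rcases (by omega : (a : ℕ) = i ∨ ((r - a : Fin m) : ℕ) = i) with h1 | h1
    · obtain rfl := Fin.ext h1
      rw [pairRow, if_neg hi, if_neg]
      intro h2
      have h2' : ((r - a : Fin m) : ℕ) < a := h2
      omega
    · have h2 := fin_sub_sub_self r a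
      have h3 : r - a = i := Fin.ext h1
      rw [h3] at h2
      rw [h2] at hi'
      rw [pairRow, h3, if_neg, if_neg]
      · intro h4
        have h4' : (i : ℕ) < a := h4
        omega
      · intro h4
        have h4' : (a : ℕ) < i := h4
        omega
  · rfl

theorem hoare_gateBlock {R N : ℕ} (hs : Ready R N s) {φ : ℂ} (hφ : ‖φ‖ = 1) {r i : Fin m}
    (h17 : s.num 17 0 0 = φ) (h10 : s.idx 10 = i) (h11 : s.idx 11 = ((r - i : Fin m) : ℕ))
    (hV : PartialNet φ r i s.net) :
    Hoare ψ gateBlock s 4 fun s' => NetFrame [] [] s s' ∧ PartialNet φ r (i + 1) s'.net := by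
  refine Hoare.ite (t := 3) ?_ ?_
  · intro h
    have hlt : i < r - i := by
      simp only [Test.holds, h10, h11] at h
      exact h
    refine (Hoare.instr (a := .phaseshift 10 (sc 17)) (Q := fun s' => NetFrame [] [] s s' ∧
      s'.net = phaseGate i φ.arg * s.net) trivial ?_).seq
      (t' := 1) ?_
    · simp only [Instr.effect, State.addPhase, h10, i.2, dite_true]
      refine ⟨⟨fun _ _ => rfl, fun _ _ => rfl, rfl, rfl⟩, ?_⟩
      simp only [State.get, sc, hs.idx2, h17]
    · rintro s1 ⟨hF, hnet⟩
      have e10 := (hF.idx 10 (by decide)).trans h10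
      have e11 := (hF.idx 11 (by decide)).trans h11
      have e2 := (hF.idx 2 (by decide)).trans hs.idx2
      have e18 := (congrFun₂ (hF.num 18 (by decide)) 0 0).trans hs.oneI
      refine Hoare.instr trivial ?_
      have hnet' : Instr.effect s1 (.beamsplitter 10 11 (sc 18)) =
          { s1 with net := beamGate i (r - i) (1 + Complex.I).arg * s1.net } := by
        simp only [Instr.effect, State.addBeamsplitter, e10, e11, i.2, (r - i).2, and_self,
          dite_true, State.get, sc, e2, e18]
      rw [hnet']
      refine ⟨⟨hF.idx, hF.num, hF.outcome, hF.log⟩, ?_⟩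
      simp only [hnet]
      exact hV.join hφ hlt
  · intro h
    refine (hoare_skip hs.idx2 ⟨NetFrame.refl _ _ _, hV.skip ?_⟩).mono (by norm_num)
      fun _ => id
    simp only [Test.holds, h10, h11] at h
    exact h

theorem hoare_partnerBlock {r i : Fin m} (h0 : s.idx 0 = m) (h9 : s.idx 9 = r)
    (h10 : s.idx 10 = i) :
    Hoare ψ partnerBlock s 5 fun s' =>
      Frame [11] [] s s' ∧ s'.idx 11 = ((r - i : Fin m) : ℕ) := by
  have h := val_sub_eq_ite r i
  refine Hoare.ite (t := 4) ?_ ?_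
  · intro hc
    simp only [Test.holds, h9, h10] at hc
    refine hoare_block_frame (by decide) (by decide) fun hF => ⟨hF, ?_⟩
    rw [h, if_pos hc]
    simp [List.foldl, Instr.effect, State.setIdx_idx, h0, h9, h10]
  · intro hc
    simp only [Test.holds, h9, h10] at hc
    refine (hoare_block_frame (by decide) (by decide) fun hF => ⟨hF, ?_⟩).mono
      (by decide) fun _ => id
    rw [h, if_neg hc]
    simp [List.foldl, Instr.effect, State.setIdx_idx, h9, h10]

/-- The network for the round `r` with the phase `φ`. -/
def IsRoundNet (φ : ℂ) (r : Fin m) (V : Matrix.unitaryGroup (Fin m) ℂ) : Prop :=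
  ∀ a, V.1 a = pairRow φ r a

theorem hoare_network {R N : ℕ} (hs : Ready R N s) {φ : ℂ} (hφ : ‖φ‖ = 1) {r : Fin m}
    (h17 : s.num 17 0 0 = φ) (h9 : s.idx 9 = r) :
    Hoare ψ network s (m * 13 + 5) fun s' =>
      NetFrame [10, 11] [] s s' ∧ IsRoundNet φ r s'.net := by
  refine ((Hoare.instr (a := .resetNet)
    (Q := fun s' => NetFrame [10, 11] [] s s' ∧ s'.net = 1) trivial
    ⟨⟨fun _ _ => rfl, fun _ _ => rfl, rfl, rfl⟩, rfl⟩).seq (t' := m * (10 + 3) + 3) ?_).mono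
    (by omega) fun _ => id
  rintro s1 ⟨hF1, hnet1⟩
  intro v
  refine (triple_forLoop (t := 10)
    (fun j s' => NetFrame [10, 11] [] s s' ∧ PartialNet φ r j s'.net) (fun _ _ => v)
    ?_ ?_ ?_).mono le_rfl le_rfl ?_
  · rintro j s' ⟨hF, -⟩
    exact ⟨(hF.idx 0 (by decide)).trans hs.idx0, (hF.idx 3 (by decide)).trans hs.idx3⟩
  · rintro j s' hj h10 ⟨hF, hV⟩
    refine ((hoare_partnerBlock (r := r) (i := ⟨j, hj⟩) ((hF.idx 0 (by decide)).trans hs.idx0)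
      ((hF.idx 9 (by decide)).trans h9) h10).seq (t' := 4) (Q' := fun s'' => s''.idx 10 = j ∧
        NetFrame [10, 11] [] s s'' ∧ PartialNet φ r (j + 1) s''.net) ?_ v).mono le_rfl le_rfl ?_
    · rintro s2 ⟨hF2, h11⟩
      have hF' := hF.trans hF2.1 (by decide) (by decide)
      refine (hoare_gateBlock (hs.frame hF' (by decide) (by decide)) hφ
        (r := r) (i := ⟨j, hj⟩) ((congrFun₂ (hF'.num 17 (by decide)) 0 0).trans h17)
        ((hF2.idx 10 (by decide)).trans h10) h11 (by rw [hF2.net]; exact hV)).mono le_rfl ?_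
      rintro s3 ⟨hF3, hV3⟩
      exact ⟨(hF3.idx 10 (by decide)).trans ((hF2.idx 10 (by decide)).trans h10),
        hF'.trans hF3 (by decide) (by decide), hV3⟩
    · rintro s'' ⟨e1, e2, e3⟩
      exact ⟨⟨e1, (e2.idx 0 (by decide)).trans hs.idx0, (e2.idx 3 (by decide)).trans hs.idx3,
        e2.setIdx (by decide) _, e3⟩, le_rfl⟩
  · refine ⟨hF1.setIdx (by decide) _, fun a => ?_⟩
    have : (s1.setIdx 10 0).net.1 a = (1 : Matrix (Fin m) (Fin m) ℂ) a := by
      show s1.net.1 a = _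
      rw [hnet1]
      rfl
    rw [this, if_neg (by omega)]
    funext b
    rw [Matrix.one_apply, Pi.single_apply]
    simp only [eq_comm]
  · rintro s' ⟨⟨hF, hV⟩, -⟩
    refine ⟨⟨hF, fun a => ?_⟩, le_rfl⟩
    rw [hV, if_pos (Or.inl a.2)]

end
end FermionLearning

namespace FermionLearning
noncomputable section

open scoped ENNReal

variable {m n : ℕ} {ψ : FockState m n} {s : State m}

/-! ### Sampling -/

/-- Add the outcome of the latest measurement to the row of the array `2` that belongs to the
current basis. -/
def tally : Program :=
  forLoop 10 0 (block [.readMode 13 10, .numOfIdx (sc 20) 13,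
    .numOp .add ⟨2, 7, 10⟩ ⟨2, 7, 10⟩ (sc 20)])

def sampling : Program :=
  forLoop 7 6 (.seq roundBlock (.seq network (forLoop 8 5 (.seq (.instr .measure) tally))))

theorem hoare_tally {R N b : ℕ} (hs : Ready R N s) (h7 : s.idx 7 = b) :
    Hoare ψ tally s (m * 9 + 3) fun s' => Frame [10, 13] [2, 20] s s' ∧
      (∀ i : Fin m, s'.num 2 b i = s.num 2 b i + (occNum s.outcome i : ℂ)) ∧
      (∀ b' i, b' ≠ b → s'.num 2 b' i = s.num 2 b' i) ∧
      ((∀ b' i, (s.num 2 b' i).im = 0) → ∀ b' i, (s'.num 2 b' i).im = 0) := by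
  classical
  refine (hoare_forLoop (t := 6) [10, 13] [2, 20]
    (fun j s' => ∀ b' i, s'.num 2 b' i = s.num 2 b' i +
      if b' = b ∧ i < j then (((if ∃ h : i < m, ⟨i, h⟩ ∈ s.outcome then 1 else 0 : ℕ) : ℝ) : ℂ)
        else 0)
    hs.idx0 hs.idx3 (by decide) (by decide) (by decide) ?_ ?_).mono le_rfl ?_
  · intro b' i; simp [State.setIdx_num]
  · rintro j s' hj h10 hF hInv
    have e2 := (hF.idx 2 (by decide)).trans hs.idx2
    have e7 := (hF.idx 7 (by decide)).trans h7
    refine hoare_block_frame (by decide) (by decide) fun hF' => ⟨?_, hF', fun b' i => ?_⟩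
    · simp [List.foldl, Instr.effect, State.setIdx_idx, State.set_idx, h10]
    · rw [State.setIdx_num]
      simp only [List.foldl, Instr.effect, State.setIdx_idx, State.setIdx_num, State.set_idx,
        State.set_num, State.get, sc, NumOp.eval, e2, e7, h10, hF.outcome, hInv]
      by_cases hb : b' = b
      · subst hb
        rcases lt_trichotomy i j with h | h | h
        · simp [h, h.ne, h.trans (Nat.lt_succ_self j)]
        · subst h
          simp
          split_ifs <;> simp
        · simp [h.ne', h.not_gt, (Nat.succ_le_of_lt h).not_gt]
      · simp [hb]
  · rintro s' ⟨hF, hInv⟩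
    refine ⟨hF, fun i => ?_, fun b' i hb => ?_, fun him b' i => ?_⟩
    · rw [hInv, if_pos ⟨rfl, i.2⟩]
      simp [occNum]
    · rw [hInv, if_neg fun h => hb h.1, add_zero]
    · rw [hInv, Complex.add_im, him]
      split_ifs <;> simp

/-- The round of the basis number `b`. -/
def roundOf (b : Fin (m + m)) : Fin m :=
  ⟨if (b : ℕ) < m then b else b - m, by have := b.2; split_ifs <;> omega⟩

/-- The phase of the basis number `b`. -/
def phaseOf (b : Fin (m + m)) : ℂ := if (b : ℕ) < m then 1 else Complex.I

theorem norm_phaseOf (b : Fin (m + m)) : ‖phaseOf b‖ = 1 := by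
  unfold phaseOf
  split_ifs <;> simp

theorem phaseOf_mul_star (b : Fin (m + m)) : phaseOf b * star (phaseOf b) = 1 := by
  have := Complex.mul_conj' (phaseOf b)
  rw [norm_phaseOf] at this
  simpa using this

/-- The probability to observe the mode `i` in the basis number `b`. -/
def basisProb (K : Matrix (Fin m) (Fin m) ℂ) (b : Fin (m + m)) (i : Fin m) : ℝ :=
  pairProb K (phaseOf b) (roundOf b) i

/-- The squared distance of the tallies from their expectations after `c b` measurements in the
basis number `b`. -/
def sqDev (K : Matrix (Fin m) (Fin m) ℂ) (c : ℕ → ℕ) (s : State m) : ℝ :=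
  ∑ b : Fin (m + m), ∑ i : Fin m, ((s.num 2 b i).re - c b * basisProb K b i) ^ 2

/-- The deviations for all bases form one vector, of which a measurement in the basis `b` changes
only the block `b`, by a vector of mean zero and squared length at most `β = 2 n`. -/
theorem sum_prob_mul_exp_le {A : Matrix (Fin m) (Fin n) ℂ} (hA : Aᴴ * A = 1)
    (hψ : ∀ S, ψ.amp S = slater A S) {b : Fin (m + m)} {V : Matrix.unitaryGroup (Fin m) ℂ}
    (hV : IsRoundNet (phaseOf b) (roundOf b) V) {a l : ℝ} (ha : 0 < a) (hl : 0 ≤ l)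
    (D : Fin (m + m) → Fin m → ℝ) :
    ∑ S, (ψ.evolve V).prob S * Real.exp (l * √(a + ∑ b', ∑ i,
      (D b' i + if b' = b then occNum S.1 i - basisProb (A * Aᴴ) b i else 0) ^ 2)) ≤
    Real.exp (l ^ 2 * (2 * n) / 2 + l * ((2 * n) / (2 * √a))) *
      Real.exp (l * √(a + ∑ b', ∑ i, D b' i ^ 2)) := by
  have hVA : (V.1 * A)ᴴ * (V.1 * A) = 1 := by
    rw [Matrix.conjTranspose_mul, Matrix.mul_assoc, ← Matrix.mul_assoc V.1ᴴ,
      ← Matrix.star_eq_conjTranspose V.1, Matrix.UnitaryGroup.star_mul_self, Matrix.one_mul, hA]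
  have hprob : ∀ S, (ψ.evolve V).prob S = ‖slater (V.1 * A) S‖ ^ 2 := fun S => by
    rw [FockState.prob, evolve_amp_eq_slater hψ]
  have hp : ∀ i, ((V.1 * A * (V.1 * A)ᴴ) i i).re = basisProb (A * Aᴴ) b i := by
    intro i
    rw [basisProb, ← re_pairRow_dotProduct (conjTranspose_mul_self_conjTranspose A)
      (phaseOf_mul_star b), ← hV i, Matrix.conjTranspose_mul, Matrix.mul_assoc,
      ← Matrix.mul_assoc A, Matrix.mul_apply]
    rfl
  have h := sum_mul_exp_sqrt_le (κ := Fin (m + m) × Fin m)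
    (p := fun S : Occ m n => (ψ.evolve V).prob S)
    (y := fun S k => if k.1 = b then occNum S.1 k.2 - basisProb (A * Aᴴ) b k.2 else 0)
    (a := a) (c := a) (β := 2 * n) (l := l) (fun k => D k.1 k.2) (fun S => sq_nonneg _)
    (ψ.evolve V).norm_eq_one ?_ ?_ (by positivity) ha le_rfl hl
  · simpa only [Fintype.sum_prod_type] using h
  · rintro ⟨b', i⟩
    by_cases hb : b' = b
    · simp only [hb, if_true, hprob, ← hp]
      exact sum_mul_occNum_sub_eq_zero hVA i
    · simp [hb]
  · intro S
    have := sum_occNum_sub_sq_le hVA S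
    simp only [hp] at this
    rw [Fintype.sum_prod_type]
    simpa [ite_pow, Finset.sum_ite_irrel] using this

/-- The bound for the probability of failure with `k` measurements still to be made, when the
squared deviation so far is `U`. -/
def potential (n : ℕ) (a l g : ℝ) (η : ℝ≥0∞) (k : ℕ) (U : ℝ) : ℝ≥0∞ :=
  ENNReal.ofReal (Real.exp (g + k * (l ^ 2 * (2 * n) / 2 + l * ((2 * n) / (2 * √a)))) *
    Real.exp (l * √(a + U))) + η

/-- The supermartingale property: a measurement uses up one of the `k + 1` factors reserved for the
growth of the exponential moment. -/
theorem sum_prob_mul_potential_le {A : Matrix (Fin m) (Fin n) ℂ} (hA : Aᴴ * A = 1)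
    (hψ : ∀ S, ψ.amp S = slater A S) {b : Fin (m + m)} {V : Matrix.unitaryGroup (Fin m) ℂ}
    (hV : IsRoundNet (phaseOf b) (roundOf b) V) {a l : ℝ} (ha : 0 < a) (hl : 0 ≤ l) (g : ℝ)
    (η : ℝ≥0∞) (k : ℕ) (D : Fin (m + m) → Fin m → ℝ) :
    ∑ S, ENNReal.ofReal ((ψ.evolve V).prob S) * potential n a l g η k (∑ b', ∑ i,
      (D b' i + if b' = b then occNum S.1 i - basisProb (A * Aᴴ) b i else 0) ^ 2) ≤
    potential n a l g η (k + 1) (∑ b', ∑ i, D b' i ^ 2) := by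
  have hnn : ∀ S, 0 ≤ (ψ.evolve V).prob S := fun S => sq_nonneg _
  simp only [potential, mul_add, Finset.sum_add_distrib]
  refine add_le_add ?_ (le_of_eq ?_)
  · simp only [← ENNReal.ofReal_mul (hnn _)]
    rw [← ENNReal.ofReal_sum_of_nonneg fun S _ => mul_nonneg (hnn S) (by positivity)]
    refine ENNReal.ofReal_le_ofReal ?_
    have h := mul_le_mul_of_nonneg_left (sum_prob_mul_exp_le hA hψ hV ha hl D)
      (Real.exp_pos (g + k * (l ^ 2 * (2 * n) / 2 + l * ((2 * n) / (2 * √a))))).le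
    rw [Finset.mul_sum, ← mul_assoc, ← Real.exp_add] at h
    refine le_trans (le_of_eq (Finset.sum_congr rfl fun S _ => by ring_nf)) (h.trans (le_of_eq ?_))
    rw [← Real.exp_add, ← Real.exp_add]
    congr 1
    push_cast
    ring
  · rw [← Finset.sum_mul, ← ENNReal.ofReal_sum_of_nonneg fun S _ => hnn S,
      show ∑ S, (ψ.evolve V).prob S = 1 from (ψ.evolve V).norm_eq_one, ENNReal.ofReal_one, one_mul]

theorem Ready.observe {R N : ℕ} (h : Ready R N s) (S : Occ m n) : Ready R N (s.observe S) :=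
  ⟨h.idx0, h.idx2, h.idx3, h.idx4, h.idx5, h.idx6, h.half, h.one, h.oneI, h.I, h.zero⟩

/-- At most `l` copies have been measured so far, in at most `k` different bases. -/
def LogBound (l k : ℕ) (L : List (Matrix.unitaryGroup (Fin m) ℂ)) : Prop :=
  L.length ≤ l ∧ ∃ B : Finset (Matrix.unitaryGroup (Fin m) ℂ), B.card ≤ k ∧ ∀ V ∈ L, V ∈ B

/-- The invariants list the loaded network once in advance, so repeated measurements in it raise
only the length of the log. `LogBound.new` adds this entry and `LogBound.of_cons` removes it. -/
theorem LogBound.cons {l k : ℕ} {L : List (Matrix.unitaryGroup (Fin m) ℂ)}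
    {V : Matrix.unitaryGroup (Fin m) ℂ} (h : LogBound l k (V :: L)) :
    LogBound (l + 1) k (V :: V :: L) := by
  obtain ⟨h1, B, h2, h3⟩ := h
  refine ⟨by simpa using h1, B, h2, fun W hW => ?_⟩
  rcases List.mem_cons.1 hW with rfl | hW
  · exact h3 _ List.mem_cons_self
  · exact h3 _ hW

theorem LogBound.new {l k : ℕ} {L : List (Matrix.unitaryGroup (Fin m) ℂ)} (h : LogBound l k L)
    (V : Matrix.unitaryGroup (Fin m) ℂ) : LogBound (l + 1) (k + 1) (V :: L) := by
  classical
  obtain ⟨h1, B, h2, h3⟩ := h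
  refine ⟨by simpa using h1, insert V B, (Finset.card_insert_le _ _).trans (by omega),
    fun W hW => ?_⟩
  rcases List.mem_cons.1 hW with rfl | hW
  · exact Finset.mem_insert_self _ _
  · exact Finset.mem_insert_of_mem (h3 _ hW)

theorem LogBound.of_cons {l k : ℕ} {L : List (Matrix.unitaryGroup (Fin m) ℂ)}
    {V : Matrix.unitaryGroup (Fin m) ℂ} (h : LogBound (l + 1) k (V :: L)) : LogBound l k L :=
  ⟨by simpa using h.1, h.2.imp fun B hB => ⟨hB.1, fun W hW => hB.2 W (List.mem_cons_of_mem _ hW)⟩⟩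

/-- The numbers of measurements in the bases when the basis number `b` has been used `t` times. -/
def schedule (N b t b' : ℕ) : ℕ := if b' < b then N else if b' = b then t else 0

theorem schedule_succ (N b t b' : ℕ) :
    schedule N b (t + 1) b' = schedule N b t b' + if b' = b then 1 else 0 := by
  unfold schedule
  split_ifs <;> omega

theorem schedule_full (N b b' : ℕ) : schedule N b N b' = schedule N (b + 1) 0 b' := by
  unfold schedule
  split_ifs <;> omega

/-- The invariant of the loop over the bases. -/
structure BasisInv (R N b : ℕ) (s : State m) : Prop where
  ready : Ready R N s
  im : ∀ b' i, (s.num 2 b' i).im = 0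
  log : LogBound (b * N) b s.log

/-- The invariant of the loop over the measurements in the basis number `b`. -/
structure SampleInv (R N : ℕ) (b : Fin (m + m)) (t : ℕ) (s : State m) : Prop where
  ready : Ready R N s
  idx7 : s.idx 7 = b
  im : ∀ b' i, (s.num 2 b' i).im = 0
  net : IsRoundNet (phaseOf b) (roundOf b) s.net
  log : LogBound (b * N + t + 1) (b + 1) (s.net :: s.log)

theorem triple_sample {A : Matrix (Fin m) (Fin n) ℂ} (hA : Aᴴ * A = 1)
    (hψ : ∀ S, ψ.amp S = slater A S) {a l : ℝ} (ha : 0 < a) (hl : 0 ≤ l) (g : ℝ) (η : ℝ≥0∞)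
    {R N t : ℕ} {b : Fin (m + m)} (k : ℕ) (hs : SampleInv R N b t s) :
    Triple ψ (.seq (.instr .measure) tally) s (m * 9 + 5)
      (potential n a l g η (k + 1) (sqDev (A * Aᴴ) (schedule N b t) s))
      (fun s' => SampleInv R N b (t + 1) s' ∧ s'.idx 8 = s.idx 8)
      (fun s' => potential n a l g η k (sqDev (A * Aᴴ) (schedule N b (t + 1)) s')) := by
  set D : Fin (m + m) → Fin m → ℝ := fun b' i =>
    (s.num 2 b' i).re - schedule N b t b' * basisProb (A * Aᴴ) b' i with hD
  set X : Finset (Fin m) → ℝ := fun S => ∑ b', ∑ i,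
    (D b' i + if b' = b then occNum S i - basisProb (A * Aᴴ) b i else 0) ^ 2 with hX
  have h1 : Triple ψ (.instr .measure) s 1
      (potential n a l g η (k + 1) (sqDev (A * Aᴴ) (schedule N b t) s))
      (fun s1 => ∃ S : Occ m n, s1 = s.observe S)
      (fun s1 => potential n a l g η k (X s1.outcome)) :=
    (Triple.measure (v := fun S => potential n a l g η k (X S.1))
      fun S => ⟨⟨S, rfl⟩, le_rfl⟩).mono le_rfl
      (sum_prob_mul_potential_le hA hψ hs.net ha hl g η k D) fun s' h => ⟨h, le_rfl⟩
  refine (h1.seq (t' := m * 9 + 3) ?_).mono (by omega) le_rfl fun s' h => ⟨h, le_rfl⟩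
  rintro s1 ⟨S, rfl⟩
  have hready := hs.ready.observe S
  refine (hoare_tally hready hs.idx7 _).mono le_rfl le_rfl ?_
  rintro s2 ⟨hF, h2, h3, him⟩
  refine ⟨⟨⟨hready.frame hF.1 (by decide) (by decide), (hF.idx 7 (by decide)).trans hs.idx7,
    him hs.im, ?_, ?_⟩, hF.idx 8 (by decide)⟩, le_of_eq ?_⟩
  · rw [hF.net]; exact hs.net
  · rw [hF.net, hF.log]
    exact hs.log.cons
  · congr 1
    rw [sqDev, hX]
    refine Finset.sum_congr rfl fun b' _ => Finset.sum_congr rfl fun i _ => ?_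
    rw [hD, schedule_succ]
    by_cases hb : b' = b
    · subst hb
      simp only [h2, if_true, Complex.add_re, Complex.ofReal_re]
      push_cast
      congr 1
      show (s.num 2 b' i).re + _ - _ = _
      ring
    · have hb' : (b' : ℕ) ≠ b := fun h => hb (Fin.ext h)
      rw [h3 _ _ hb', if_neg hb, if_neg hb', add_zero, add_zero]
      rfl

theorem hoare_roundBlock {R N : ℕ} (hs : Ready R N s) {b : Fin (m + m)} (h7 : s.idx 7 = b) :
    Hoare ψ roundBlock s 5 fun s' => Frame [9] [17] s s' ∧ s'.idx 9 = roundOf b ∧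
      s'.num 17 0 0 = phaseOf b := by
  have h0 := hs.idx0
  have h2 := hs.idx2
  refine Hoare.ite (t := 4) (fun h => ?_) fun h => ?_
  · simp only [Test.holds, h7, h0] at h
    refine hoare_block_frame (by decide) (by decide) fun hF => ⟨hF, ?_⟩
    simp [List.foldl, Instr.effect, State.setIdx_idx, State.set_idx, State.set_num, sc, h7, h2,
      roundOf, phaseOf, h]
  · simp only [Test.holds, h7, h0] at h
    refine hoare_block_frame (by decide) (by decide) fun hF => ⟨hF, ?_⟩
    simp [List.foldl, Instr.effect, State.setIdx_idx, State.set_idx, State.set_num, sc, h7, h0,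
      h2, roundOf, phaseOf, h]

/-- The bound counts the measurements left: `(m + m - b) * N` before the basis `b`, minus those
already made in it. -/
theorem triple_sampling {A : Matrix (Fin m) (Fin n) ℂ} (hA : Aᴴ * A = 1)
    (hψ : ∀ S, ψ.amp S = slater A S) {a l : ℝ} (ha : 0 < a) (hl : 0 ≤ l) (g : ℝ) (η : ℝ≥0∞)
    {R N : ℕ} (hs : BasisInv R N 0 s) :
    Triple ψ sampling s ((m + m) * (m * 13 + N * (m * 9 + 8) + 18) + 3)
      (potential n a l g η ((m + m) * N) (sqDev (A * Aᴴ) (fun _ => 0) s))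
      (BasisInv R N (m + m))
      (fun s' => potential n a l g η 0 (sqDev (A * Aᴴ) (fun _ => N) s')) := by
  have hsched : ∀ (s : State m), sqDev (A * Aᴴ) (schedule N (m + m) 0) s =
      sqDev (A * Aᴴ) (fun _ => N) s := by
    intro s
    rw [sqDev, sqDev]
    refine Finset.sum_congr rfl fun b _ => ?_
    rw [schedule, if_pos b.2]
  refine (triple_forLoop (t := m * 13 + N * (m * 9 + 8) + 15) (H := m + m)
    (fun b s' => BasisInv R N b s')
    (fun b s' => potential n a l g η ((m + m - b) * N) (sqDev (A * Aᴴ) (schedule N b 0) s'))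
    (fun b s' h => ⟨h.ready.idx6, h.ready.idx3⟩) ?_ ?_).mono le_rfl (le_of_eq ?_) ?_
  · intro b₀ s₀ hb₀ h7 hs
    obtain ⟨b, rfl⟩ : ∃ b : Fin (m + m), (b : ℕ) = b₀ := ⟨⟨b₀, hb₀⟩, rfl⟩
    have h1 := hoare_roundBlock (ψ := ψ) hs.ready h7
      (potential n a l g η ((m + m - b) * N) (sqDev (A * Aᴴ) (schedule N b 0) s₀))
    refine (h1.seq (t' := (m * 13 + 5) + (N * (m * 9 + 8) + 3) + 1) ?_).mono (by omega) le_rfl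
      fun s' h => ⟨h, le_rfl⟩
    rintro s1 ⟨hF1, h9, h17⟩
    have hr1 := hs.ready.frame hF1.1 (by decide) (by decide)
    refine (hoare_network hr1 (norm_phaseOf b) h17 h9 _).seq ?_
    rintro s2 ⟨hF2, hnet⟩
    have hF12 := hF1.1.mono (I := [9, 10, 11]) (A := [17]) (by decide) (by decide) |>.trans hF2
      (by decide) (by decide)
    have hr2 := hr1.frame hF2 (by decide) (by decide)
    have h7' := (hF12.idx 7 (by decide)).trans h7
    refine (triple_forLoop (t := m * 9 + 5) (H := N) (fun t s' => SampleInv R N b t s')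
      (fun t s' => potential n a l g η ((m + m - b) * N - t)
        (sqDev (A * Aᴴ) (schedule N b t) s'))
      (fun t s' h => ⟨h.ready.idx5, h.ready.idx3⟩) ?_ ?_).mono le_rfl (le_of_eq ?_) ?_
    · intro t s' ht h8 hs'
      obtain ⟨k, hk⟩ : ∃ k, (m + m - (b : ℕ)) * N - t = k + 1 := by
        refine ⟨(m + m - (b : ℕ)) * N - t - 1, ?_⟩
        have : 1 * N ≤ (m + m - (b : ℕ)) * N := Nat.mul_le_mul_right _ (by omega)
        omega
      rw [hk]
      refine (triple_sample hA hψ ha hl g η k hs').mono le_rfl le_rfl ?_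
      rintro s'' ⟨h, h8'⟩
      refine ⟨⟨h8'.trans h8, h.ready.idx5, h.ready.idx3, ?_⟩, ?_⟩
      · have hF : NetFrame [8] [] s'' (s''.setIdx 8 (t + 1)) :=
          (NetFrame.refl _ _ _).setIdx (by decide) _
        exact ⟨h.ready.frame hF (by decide) (by decide), (hF.idx 7 (by decide)).trans h.idx7,
          h.im, h.net, h.log⟩
      · have : (m + m - (b : ℕ)) * N - (t + 1) = k := by omega
        simp only [this]
        exact le_rfl
    · have hF : NetFrame [8] [] s2 (s2.setIdx 8 0) :=
        (NetFrame.refl _ _ _).setIdx (by decide) _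
      refine ⟨hr2.frame hF (by decide) (by decide), (hF.idx 7 (by decide)).trans h7', ?_, hnet,
        ?_⟩
      · intro b' i
        show (s2.num 2 b' i).im = 0
        rw [hF12.num 2 (by decide)]
        exact hs.im b' i
      · show LogBound _ _ (s2.net :: s2.log)
        rw [hF12.log]
        exact hs.log.new _
    · rw [Nat.sub_zero]
      congr 1
      rw [sqDev, sqDev]
      have : (s2.setIdx 8 0).num 2 = s₀.num 2 := hF12.num 2 (by decide)
      rw [this]
    · rintro s' ⟨h, -⟩
      refine ⟨⟨h.idx7, h.ready.idx6, h.ready.idx3, ?_⟩, le_of_eq ?_⟩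
      · have hF : NetFrame [7] [] s' (s'.setIdx 7 (b + 1)) :=
          (NetFrame.refl _ _ _).setIdx (by decide) _
        refine ⟨h.ready.frame hF (by decide) (by decide), h.im, ?_⟩
        have := h.log.of_cons
        show LogBound _ _ s'.log
        rw [Nat.succ_mul]
        exact this
      · have : (m + m - ((b : ℕ) + 1)) * N = (m + m - (b : ℕ)) * N - N := by
          rw [← Nat.sub_sub, Nat.sub_mul, one_mul]
        rw [this]
        congr 1
        rw [sqDev, sqDev]
        refine Finset.sum_congr rfl fun b' _ => ?_
        rw [schedule_full]
        rfl
  · have hF : NetFrame [7] [] s (s.setIdx 7 0) := (NetFrame.refl _ _ _).setIdx (by decide) _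
    exact ⟨hs.ready.frame hF (by decide) (by decide), hs.im, hs.log⟩
  · rw [Nat.sub_zero]
    congr 1
    rw [sqDev, sqDev]
    refine Finset.sum_congr rfl fun b _ => ?_
    have : schedule N 0 0 b = 0 := by unfold schedule; split_ifs <;> omega
    rw [this]
    rfl
  · rintro s' ⟨h, -⟩
    refine ⟨h, le_of_eq ?_⟩
    rw [hsched, Nat.sub_self, zero_mul]

end
end FermionLearning

namespace FermionLearning
noncomputable section

open scoped ENNReal

variable {m n : ℕ} {ψ : FockState m n} {s : State m}

/-- The matrix in the array `k`. -/
def matOf (k : ℕ) (s : State m) : Matrix (Fin m) (Fin m) ℂ := Matrix.of fun i j => s.num k i j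

/-! ### Computing the estimate -/

/-- The index variables `9` and `12` hold the round `i + j` modulo `m` and that number plus `m`: the
rows of the tallies for the phases `1` and `I`. -/
def entryBlock : Program :=
  .seq (block [.idxAdd 9 10 11]) (.seq (.ite (.idxLt 9 0) skip (block [.idxSub 9 9 0]))
    (.seq (block [.idxAdd 12 9 0])
      (.seq (.ite (.idxLt 10 11) (block [.numOp .sub (sc 20) ⟨2, 9, 11⟩ ⟨2, 9, 10⟩])
        (.ite (.idxLt 11 10) (block [.numOp .sub (sc 20) ⟨2, 9, 10⟩ ⟨2, 9, 11⟩])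
          (block [.numOp .add (sc 20) ⟨2, 9, 10⟩ ⟨2, 9, 10⟩])))
        (block [.numOp .mul (sc 20) (sc 20) (sc 10), .numOp .sub (sc 22) ⟨2, 12, 11⟩ ⟨2, 12, 10⟩,
          .numOp .mul (sc 22) (sc 22) (sc 10), .numOp .mul (sc 22) (sc 22) (sc 19),
          .numOp .sub (sc 20) (sc 20) (sc 22), .numOp .div ⟨3, 10, 11⟩ (sc 20) (sc 21)]))))

def estimation : Program :=
  .seq (block [.numOfIdx (sc 21) 5]) (forLoop 10 0 (forLoop 11 0 entryBlock))

/-- The round in which the modes `i` and `j` are joined. -/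
def pairRound (m i j : ℕ) : ℕ := if i + j < m then i + j else i + j - m

/-- The entry of the estimate that is computed from the tallies `X`. -/
def entryValue (m N : ℕ) (X : ℕ → ℕ → ℂ) (i j : ℕ) : ℂ :=
  ((if i < j then X (pairRound m i j) j - X (pairRound m i j) i
      else if j < i then X (pairRound m i j) i - X (pairRound m i j) j
      else X (pairRound m i j) i + X (pairRound m i j) i) * (1 / 2) -
    (X (pairRound m i j + m) j - X (pairRound m i j + m) i) * (1 / 2) * Complex.I) / N

theorem hoare_entryBlock {R N i j : ℕ} (hs : Ready R N s) (h21 : s.num 21 0 0 = N)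
    (h10 : s.idx 10 = i) (h11 : s.idx 11 = j) :
    Hoare ψ entryBlock s 29 fun s' => Frame [9, 12] [3, 20, 22] s s' ∧
      ∀ k l, s'.num 3 k l = if k = i ∧ l = j then entryValue m N (s.num 2) i j
        else s.num 3 k l := by
  have h1 : Hoare ψ (block [.idxAdd 9 10 11]) s 2 fun s' => Frame [9] [] s s' ∧
      s'.idx 9 = i + j := by
    refine hoare_block_frame (by decide) (by decide) fun hF => ⟨hF, ?_⟩
    simp [List.foldl, Instr.effect, State.setIdx_idx, h10, h11]
  refine (h1.seq (t' := 3 + (2 + (4 + 12 + 1) + 1) + 1) ?_).mono (by norm_num) fun _ => id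
  rintro s1 ⟨hF1, h9⟩
  have hr1 := hs.frame hF1.1 (by decide) (by decide)
  have h2 : Hoare ψ (.ite (.idxLt 9 0) skip (block [.idxSub 9 9 0])) s1 3 fun s' =>
      Frame [9] [] s s' ∧ s'.idx 9 = pairRound m i j := by
    refine Hoare.ite (t := 2) (fun h => ?_) fun h => ?_
    · simp only [Test.holds, h9, hr1.idx0] at h
      refine (hoare_skip hr1.idx2 ⟨hF1, ?_⟩).mono (by norm_num) fun _ => id
      rw [h9, pairRound, if_pos h]
    · simp only [Test.holds, h9, hr1.idx0] at h
      refine hoare_block_frame (I := [9]) (A := []) (by decide) (by decide) fun hF =>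
        ⟨hF1.trans hF (fun _ => id) fun _ => id, ?_⟩
      simp [List.foldl, Instr.effect, State.setIdx_idx, h9, hr1.idx0, pairRound, h]
  refine h2.seq (t' := 20) ?_
  rintro s2 ⟨hF2, h9⟩
  have hr2 := hs.frame hF2.1 (by decide) (by decide)
  have h3 : Hoare ψ (block [.idxAdd 12 9 0]) s2 2 fun s' => Frame [9, 12] [] s s' ∧
      s'.idx 9 = pairRound m i j ∧ s'.idx 12 = pairRound m i j + m := by
    refine hoare_block_frame (I := [12]) (A := []) (by decide) (by decide) fun hF =>
      ⟨(hF2.mono (by decide) (by decide)).trans hF (by decide) (by decide), ?_⟩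
    simp [List.foldl, Instr.effect, State.setIdx_idx, h9, hr2.idx0]
  refine h3.seq (t' := 17) ?_
  rintro s3 ⟨hF3, h9, h12⟩
  have hr3 := hs.frame hF3.1 (by decide) (by decide)
  have e10 := (hF3.idx 10 (by decide)).trans h10
  have e11 := (hF3.idx 11 (by decide)).trans h11
  have e2 : s3.num 2 = s.num 2 := hF3.num 2 (by decide)
  set r := pairRound m i j with hr
  set X := s.num 2 with hX
  have h4 : Hoare ψ (.ite (.idxLt 10 11) (block [.numOp .sub (sc 20) ⟨2, 9, 11⟩ ⟨2, 9, 10⟩])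
        (.ite (.idxLt 11 10) (block [.numOp .sub (sc 20) ⟨2, 9, 10⟩ ⟨2, 9, 11⟩])
          (block [.numOp .add (sc 20) ⟨2, 9, 10⟩ ⟨2, 9, 10⟩]))) s3 4 fun s' =>
      Frame [] [20] s3 s' ∧ s'.num 20 0 0 = if i < j then X r j - X r i
        else if j < i then X r i - X r j else X r i + X r i := by
    refine Hoare.ite (t := 3) (fun h => ?_) fun h => ?_
    · simp only [Test.holds, e10, e11] at h
      refine (hoare_block_frame (by decide) (by decide) fun hF => ⟨hF, ?_⟩).mono
        (by decide) fun _ => id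
      simp [List.foldl, Instr.effect, State.set_num, State.get, sc, NumOp.eval, hr3.idx2, e10,
        e11, h9, e2, h]
    · simp only [Test.holds, e10, e11] at h
      refine Hoare.ite (t := 2) (fun h' => ?_) fun h' => ?_
      · simp only [Test.holds, e10, e11] at h'
        refine hoare_block_frame (by decide) (by decide) fun hF => ⟨hF, ?_⟩
        simp [List.foldl, Instr.effect, State.set_num, State.get, sc, NumOp.eval, hr3.idx2, e10,
          e11, h9, e2, h, h']
      · simp only [Test.holds, e10, e11] at h'
        refine hoare_block_frame (by decide) (by decide) fun hF => ⟨hF, ?_⟩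
        simp [List.foldl, Instr.effect, State.set_num, State.get, sc, NumOp.eval, hr3.idx2, e10,
          h9, e2, h, h']
  refine h4.seq (t' := 12) ?_
  rintro s4 ⟨hF4, h20⟩
  have hF34 := (hF3.mono (I := [9, 12]) (A := [20]) (by decide) (by decide)).trans hF4
    (by decide) (by decide)
  have hr4 := hs.frame hF34.1 (by decide) (by decide)
  have e10 := (hF34.idx 10 (by decide)).trans h10
  have e11 := (hF34.idx 11 (by decide)).trans h11
  have e12 := (hF4.idx 12 (by decide)).trans h12
  have e2 : s4.num 2 = X := hF34.num 2 (by decide)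
  have e3 : s4.num 3 = s.num 3 := hF34.num 3 (by decide)
  have e21 := (congrFun₂ (hF34.num 21 (by decide)) 0 0).trans h21
  refine hoare_block_frame (I := []) (A := [3, 20, 22]) (by decide) (by decide) fun hF =>
    ⟨(hF34.mono (by decide) (by decide)).trans hF (by decide) (by decide), fun k l => ?_⟩
  simp only [List.foldl, Instr.effect, State.set_num, State.set_idx, State.get, sc, NumOp.eval,
    hr4.idx2, e10, e11, e12, e2, e3, e21, h20, hr4.half, hr4.I]
  by_cases h : k = i ∧ l = j
  · obtain ⟨rfl, rfl⟩ := h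
    simp [entryValue, ← hr]
  · simp [h]

theorem val_add_eq_pairRound [NeZero m] (i j : Fin m) :
    ((i + j : Fin m) : ℕ) = pairRound m i j := by
  rw [Fin.val_add_eq_ite, pairRound]
  split_ifs <;> omega

theorem entryValue_eq_estimate [NeZero m] {N : ℕ} {X : ℕ → ℕ → ℂ}
    (hX : ∀ b i, (X b i).im = 0) (i j : Fin m) :
    entryValue m N X i j = estimate N (fun r i : Fin m => (X r i).re)
      (fun r i : Fin m => (X (r + m) i).re) i j := by
  obtain ⟨x, rfl⟩ : ∃ x : ℕ → ℕ → ℝ, X = fun b i => (x b i : ℂ) :=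
    ⟨fun b i => (X b i).re, funext₂ fun b i =>
      Complex.ext rfl (by rw [Complex.ofReal_im, hX])⟩
  simp only [entryValue, estimate, Matrix.of_apply, val_add_eq_pairRound, Fin.lt_def,
    Complex.ofReal_re]
  congr 2
  · split_ifs <;> push_cast <;> ring
  · push_cast
    ring

theorem hoare_estimation [NeZero m] {R N : ℕ} (hs : Ready R N s)
    (him : ∀ b i, (s.num 2 b i).im = 0) :
    Hoare ψ estimation s (m * (m * 32 + 6) + 6) fun s' =>
      Frame [9, 10, 11, 12] [3, 20, 21, 22] s s' ∧
      matOf 3 s' = estimate N (fun r i : Fin m => (s.num 2 r i).re)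
        (fun r i : Fin m => (s.num 2 (r + m) i).re) := by
  have h1 : Hoare ψ (block [.numOfIdx (sc 21) 5]) s 2 fun s' => Frame [] [21] s s' ∧
      s'.num 21 0 0 = N := by
    refine hoare_block_frame (by decide) (by decide) fun hF => ⟨hF, ?_⟩
    simp [List.foldl, Instr.effect, State.set_num, sc, hs.idx5, hs.idx2]
  refine (h1.seq (t' := m * (m * 32 + 6) + 3) ?_).mono (by omega) fun _ => id
  rintro s1 ⟨hF1, h21⟩
  have hr1 := hs.frame hF1.1 (by decide) (by decide)
  refine (hoare_fillMatrix (I := [9, 10, 11, 12]) (A := [3, 20, 22]) (a := 3)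
    (fun i j _ => entryValue m N (s.num 2) i j) hr1.idx0 hr1.idx3
    (by decide) (by decide) (by decide) (by decide) (by decide) ?_).mono le_rfl ?_
  · intro i j s' hi hj h10 h11 hF
    refine (hoare_entryBlock (hr1.frame hF.1 (by decide) (by decide))
      ((congrFun₂ (hF.num 21 (by decide)) 0 0).trans h21) h10 h11).mono le_rfl ?_
    rintro s'' ⟨hF', h⟩
    refine ⟨(hF'.idx 10 (by decide)).trans h10, (hF'.idx 11 (by decide)).trans h11,
      hF'.mono (by decide) (by decide), fun k l => ?_⟩
    rw [h, hF.num 2 (by decide), hF1.num 2 (by decide)]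
  · rintro s' ⟨hF, h⟩
    refine ⟨(hF1.mono (by decide) (by decide)).trans hF (by decide) (by decide), ?_⟩
    ext i j
    rw [matOf, Matrix.of_apply, h i j i.2 j.2, entryValue_eq_estimate him]

/-! ### One candidate -/

/-- The component of the column number `10` of the estimate orthogonal to the range of the
projection in the array `4`, and its squared norm. -/
def residualLoop : Program :=
  forLoop 11 0 (.seq (block [.numOp .add (sc 25) ⟨3, 11, 10⟩ (sc 27)])
    (.seq (forLoop 14 0 (block [.numOp .mul (sc 26) ⟨4, 11, 14⟩ ⟨3, 14, 10⟩,
      .numOp .sub (sc 25) (sc 25) (sc 26)]))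
    (block [.numOp .add ⟨5, 11, 2⟩ (sc 25) (sc 27), .numConj (sc 26) (sc 25),
      .numOp .mul (sc 26) (sc 25) (sc 26), .numOp .add (sc 24) (sc 24) (sc 26)])))

/-- The whole residual is stored in array `5` before array `4` is overwritten, so the update in
place reads no altered entries. With `n` occupied modes, these `O(m²)` updates fit in the cubic cost
of a candidate. -/
def extendBlock : Program :=
  .seq (block [.numConst (sc 24) 0]) (.seq residualLoop
    (forLoop 11 0 (forLoop 14 0 (block [.numConj (sc 25) ⟨5, 14, 2⟩,
      .numOp .mul (sc 25) ⟨5, 11, 2⟩ (sc 25), .numOp .div (sc 25) (sc 25) (sc 24),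
      .numOp .add ⟨4, 11, 14⟩ ⟨4, 11, 14⟩ (sc 25)]))))

theorem hoare_residualLoop {R N : ℕ} (hs : Ready R N s) {i : Fin m} (h10 : s.idx 10 = i)
    (h24 : s.num 24 0 0 = 0) {w : Fin m → ℂ}
    (hw : w = (fun a => matOf 3 s a i) - matOf 4 s *ᵥ fun a => matOf 3 s a i) :
    Hoare ψ residualLoop s (m * (m * 7 + 18) + 3) fun s' =>
      Frame [11, 14] [5, 24, 25, 26] s s' ∧ (∀ a : Fin m, s'.num 5 a 0 = w a) ∧
      s'.num 24 0 0 = ∑ a, w a * star (w a) := by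
  set W : ℕ → ℂ := fun a => s.num 3 a i - ∑ k ∈ Finset.range m, s.num 4 a k * s.num 3 k i with hW
  have hWw : ∀ a : Fin m, W a = w a := by
    intro a
    rw [hw, hW]
    simp only [Pi.sub_apply, Matrix.mulVec, dotProduct, matOf, Matrix.of_apply]
    rw [Finset.sum_range]
  refine (hoare_forLoop (t := m * 7 + 15) [11, 14] [5, 24, 25, 26]
    (fun j s' => (∀ a < j, s'.num 5 a 0 = W a) ∧
      s'.num 24 0 0 = ∑ a ∈ Finset.range j, W a * star (W a))
    hs.idx0 hs.idx3 (by decide) (by decide) (by decide) ?_ ?_).mono le_rfl ?_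
  · refine ⟨fun a ha => absurd ha (Nat.not_lt_zero _), ?_⟩
    rw [State.setIdx_num, h24, Finset.range_zero, Finset.sum_empty]
  · rintro j s' hj h11 hF ⟨h5, h24'⟩
    have hr := hs.frame hF.1 (by decide) (by decide)
    have e10 := (hF.idx 10 (by decide)).trans h10
    have h1 : Hoare ψ (block [.numOp .add (sc 25) ⟨3, 11, 10⟩ (sc 27)]) s' 2 fun s1 =>
        Frame [] [25] s' s1 ∧ s1.num 25 0 0 = s.num 3 j i := by
      refine hoare_block_frame (by decide) (by decide) fun hF' => ⟨hF', ?_⟩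
      simp [List.foldl, Instr.effect, State.set_num, State.get, sc, NumOp.eval, hr.idx2, h11, e10,
        hr.zero, hF.num 3 (by decide)]
    refine (h1.seq (t' := (m * (4 + 3) + 3) + 8 + 1) ?_).mono (by omega) fun _ => id
    rintro s1 ⟨hF1, h25⟩
    have hr1 := hr.frame hF1.1 (by decide) (by decide)
    have h2 : Hoare ψ (forLoop 14 0 (block [.numOp .mul (sc 26) ⟨4, 11, 14⟩ ⟨3, 14, 10⟩,
        .numOp .sub (sc 25) (sc 25) (sc 26)])) s1 (m * (4 + 3) + 3) fun s2 =>
        Frame [14] [25, 26] s1 s2 ∧ s2.num 25 0 0 = W j := by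
      refine hoare_forLoop (t := 4) [14] [25, 26] (fun k s2 => s2.num 25 0 0 = s.num 3 j i -
        ∑ k ∈ Finset.range k, s.num 4 j k * s.num 3 k i)
        hr1.idx0 hr1.idx3 (by decide) (by decide) (by decide) ?_ ?_
      · rw [State.setIdx_num, h25, Finset.range_zero, Finset.sum_empty, sub_zero]
      · intro k s2 hk h14 hF2 h25'
        have hr2 := hr1.frame hF2.1 (by decide) (by decide)
        have hFF := (hF.trans (hF1.mono (I := [11, 14]) (A := [5, 24, 25, 26]) (by decide)
          (by decide)) (by decide) (by decide)).trans hF2 (by decide) (by decide)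
        have e10 := (hFF.idx 10 (by decide)).trans h10
        have e11 := (hF2.idx 11 (by decide)).trans ((hF1.idx 11 (by decide)).trans h11)
        refine hoare_block_frame (I := []) (A := [25, 26]) (by decide) (by decide) fun hF' =>
          ⟨(hF'.idx 14 (by decide)).trans h14, hF'.mono (by decide) (by decide), ?_⟩
        rw [State.setIdx_num, Finset.sum_range_succ]
        simp [List.foldl, Instr.effect, State.set_num, State.set_idx, State.get, sc, NumOp.eval,
          hr2.idx2, h14, e10, e11, h25', hFF.num 3 (by decide), hFF.num 4 (by decide)]
        ring
    refine h2.seq (t' := 8) ?_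
    rintro s2 ⟨hF2, h25⟩
    have hFF := (hF1.mono (I := [11, 14]) (A := [25, 26]) (by decide)
          (by decide)).trans hF2 (by decide) (by decide)
    have hr2 := hr.frame hFF.1 (by decide) (by decide)
    have e11 := (hF2.idx 11 (by decide)).trans ((hF1.idx 11 (by decide)).trans h11)
    have e5 : s2.num 5 = s'.num 5 := hFF.num 5 (by decide)
    have e24 := (congrFun₂ (hFF.num 24 (by decide)) 0 0).trans h24'
    refine hoare_block_frame (I := []) (A := [5, 24, 26]) (by decide) (by decide) fun hF' =>
      ⟨(hF'.idx 11 (by decide)).trans e11,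
        (hFF.mono (by decide) (by decide)).trans hF' (by decide) (by decide), fun a ha => ?_, ?_⟩
    · rw [State.setIdx_num]
      simp only [List.foldl, Instr.effect, State.set_num, State.set_idx, State.get, sc,
        NumOp.eval, hr2.idx2, e11, h25, e5, hr2.zero]
      rcases Nat.lt_succ_iff_lt_or_eq.1 ha with h | h
      · simp [h5 a h, h.ne]
      · simp [h]
    · rw [State.setIdx_num, Finset.sum_range_succ]
      simp [List.foldl, Instr.effect, State.set_num, State.set_idx, State.get, sc,
        NumOp.eval, hr2.idx2, e11, h25, e24]
  · rintro s' ⟨hF, h5, h24⟩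
    refine ⟨hF, fun a => (h5 a a.2).trans (hWw a), ?_⟩
    rw [h24, Finset.sum_range]
    simp only [hWw]

theorem hoare_extendBlock {R N : ℕ} (hs : Ready R N s) {i : Fin m} (h10 : s.idx 10 = i) :
    Hoare ψ extendBlock s (m * (m * 18 + 24) + 10) fun s' =>
      Frame [11, 14] [4, 5, 24, 25, 26] s s' ∧
      matOf 4 s' = extendProj (matOf 4 s) fun a => matOf 3 s a i := by
  have h1 : Hoare ψ (block [.numConst (sc 24) 0]) s 2 fun s1 =>
      Frame [] [24] s s1 ∧ s1.num 24 0 0 = 0 := by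
    refine hoare_block_frame (by decide) (by decide) fun hF => ⟨hF, ?_⟩
    simp [List.foldl, Instr.effect, State.set_num, sc, hs.idx2]
  refine (h1.seq (t' := (m * (m * 7 + 18) + 3) + (m * (m * (8 + 3) + 6) + 3) + 1) ?_).mono
    (by ring_nf; omega) fun _ => id
  rintro s1 ⟨hF1, h24⟩
  have hr1 := hs.frame hF1.1 (by decide) (by decide)
  have e3 : matOf 3 s1 = matOf 3 s := by
    ext a b; exact congrFun₂ (hF1.num 3 (by decide)) _ _
  have e4 : matOf 4 s1 = matOf 4 s := by
    ext a b; exact congrFun₂ (hF1.num 4 (by decide)) _ _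
  refine (hoare_residualLoop hr1 ((hF1.idx 10 (by decide)).trans h10) h24 rfl).seq ?_
  rw [e3, e4]
  set w := (fun a => matOf 3 s a i) - matOf 4 s *ᵥ fun a => matOf 3 s a i with hw
  rintro s2 ⟨hF2, h5, h24⟩
  have hr2 := hr1.frame hF2.1 (by decide) (by decide)
  refine (hoare_fillMatrix (I := [11, 14]) (A := [4, 25]) (a := 4)
    (fun a b z => z + s2.num 5 a 0 * star (s2.num 5 b 0) / s2.num 24 0 0) hr2.idx0 hr2.idx3
    (by decide) (by decide) (by decide) (by decide) (by decide) ?_).mono le_rfl ?_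
  · intro a b s' ha hb h11 h14 hF
    have hr' := hr2.frame hF.1 (by decide) (by decide)
    refine hoare_block_frame (I := []) (A := [4, 25]) (by decide) (by decide) fun hF' =>
      ⟨(hF'.idx 11 (by decide)).trans h11, (hF'.idx 14 (by decide)).trans h14,
        hF'.mono (by decide) (by decide), fun k l => ?_⟩
    simp [List.foldl, Instr.effect, State.set_num, State.set_idx, State.get, sc,
        NumOp.eval, hr'.idx2, h11, h14, hF.num 5 (by decide), hF.num 24 (by decide)]
  · rintro s' ⟨hF, h⟩
    refine ⟨((hF1.mono (by decide) (by decide)).trans hF2 (by decide) (by decide)).trans hF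
      (by decide) (by decide), ?_⟩
    ext a b
    have e4' : s2.num 4 = s.num 4 :=
      (hF2.num 4 (by decide)).trans (hF1.num 4 (by decide))
    rw [matOf, Matrix.of_apply, h a b a.2 b.2, h5, h5, h24, e4', extendProj, ← hw]
    rfl

end
end FermionLearning

namespace FermionLearning
noncomputable section

open scoped ENNReal

variable {m n : ℕ} {ψ : FockState m n} {s : State m}

/-! ### Building, scoring and selecting a candidate -/

def clearLoop : Program := forLoop 10 0 (forLoop 11 0 (block [.numConst ⟨4, 10, 11⟩ 0]))

/-- The projection to the span of the columns of the estimate that belong to the occupied modes. -/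
def collectLoop : Program :=
  forLoop 10 0 (.seq (block [.readMode 13 10]) (.ite (.idxLt 2 13) extendBlock skip))

/-- The squared distance of the projection from the estimate. -/
def distanceBlock : Program :=
  .seq (block [.numConst (sc 24) 0]) (forLoop 10 0 (forLoop 11 0 (block
    [.numOp .sub (sc 25) ⟨4, 10, 11⟩ ⟨3, 10, 11⟩, .numConj (sc 26) (sc 25),
      .numOp .mul (sc 25) (sc 25) (sc 26), .numOp .add (sc 24) (sc 24) (sc 25)])))

/-- Output the projection if it is closer to the estimate than the previous ones. -/
def selectBlock : Program :=
  .ite (.numLt (sc 24) (sc 23))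
    (.seq (block [.numOp .add (sc 23) (sc 24) (sc 27)])
      (forLoop 10 0 (forLoop 11 0 (block [.numOp .add ⟨1, 10, 11⟩ ⟨4, 10, 11⟩ (sc 27)])))) skip

def candidate : Program :=
  .seq clearLoop (.seq collectLoop (.seq distanceBlock selectBlock))

/-- The best score starts at `1`, so only a projection at squared distance below `1` from the
estimate is ever output. -/
def search : Program :=
  .seq (.instr .resetNet) (.seq (block [.numConst (sc 23) 1])
    (forLoop 7 4 (.seq (.instr .measure) candidate)))

theorem hoare_clearLoop {R N : ℕ} (hs : Ready R N s) :
    Hoare ψ clearLoop s (m * (m * 5 + 6) + 3) fun s' =>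
      Frame [10, 11] [4] s s' ∧ matOf 4 s' = 0 := by
  refine (hoare_fillMatrix (t := 2) (I := [10, 11]) (A := [4]) (a := 4) (fun _ _ _ => 0)
    hs.idx0 hs.idx3 (by decide) (by decide) (by decide) (by decide) (by decide) ?_).mono le_rfl ?_
  · intro a b s' ha hb h10 h11 hF
    refine hoare_block_frame (I := []) (A := [4]) (by decide) (by decide) fun hF' =>
      ⟨(hF'.idx 10 (by decide)).trans h10, (hF'.idx 11 (by decide)).trans h11,
        hF'.mono (by decide) (by decide), fun k l => ?_⟩
    simp [List.foldl, Instr.effect, State.set_num, h10, h11]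
  · rintro s' ⟨hF, h⟩
    exact ⟨hF, Matrix.ext fun a b => h a b a.2 b.2⟩

theorem isKernel_zero : IsKernel 0 (0 : Matrix (Fin m) (Fin m) ℂ) :=
  ⟨0, Subsingleton.elim _ _, by simp⟩

/-- The rank is bounded by the number of occupied modes processed, not fixed by it, since selected
columns may be dependent. Columns fixed earlier stay fixed by `IsKernel.extendProj`. -/
theorem hoare_collectLoop {R N : ℕ} (hs : Ready R N s) (h4 : matOf 4 s = 0) :
    Hoare ψ collectLoop s (m * (m * (m * 18 + 24) + 17) + 3) fun s' =>
      Frame [10, 11, 13, 14] [4, 5, 24, 25, 26] s s' ∧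
      ∃ t ≤ s.outcome.card, IsKernel t (matOf 4 s') ∧
        ∀ i ∈ s.outcome, matOf 4 s' *ᵥ (fun a => matOf 3 s a i) = fun a => matOf 3 s a i := by
  classical
  refine (hoare_forLoop (t := m * (m * 18 + 24) + 14) [10, 11, 13, 14] [4, 5, 24, 25, 26]
    (fun j s' => ∃ t ≤ (s.outcome.filter fun i : Fin m => (i : ℕ) < j).card,
      IsKernel t (matOf 4 s') ∧ ∀ i ∈ s.outcome, (i : ℕ) < j →
        matOf 4 s' *ᵥ (fun a => matOf 3 s a i) = fun a => matOf 3 s a i)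
    hs.idx0 hs.idx3 (by decide) (by decide) (by decide) ?_ ?_).mono le_rfl ?_
  · refine ⟨0, Nat.zero_le _, ?_, fun i _ hi => absurd hi (Nat.not_lt_zero _)⟩
    show IsKernel 0 (matOf 4 s)
    rw [h4]
    exact isKernel_zero
  · rintro j s' hj h10 hF ⟨t, ht, hK, hfix⟩
    have hr := hs.frame hF.1 (by decide) (by decide)
    have h1 : Hoare ψ (block [.readMode 13 10]) s' 2 fun s1 => Frame [13] [] s' s1 ∧
        (s1.idx 13 = if (⟨j, hj⟩ : Fin m) ∈ s.outcome then 1 else 0) := by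
      refine hoare_block_frame (by decide) (by decide) fun hF' => ⟨hF', ?_⟩
      simp [List.foldl, Instr.effect, State.setIdx_idx, h10, hF.outcome, hj]
    refine (h1.seq (t' := (m * (m * 18 + 24) + 10) + 1) ?_).mono (by omega) fun _ => id
    rintro s1 ⟨hF1, h13⟩
    have hr1 := hr.frame hF1.1 (by decide) (by decide)
    have e10 := (hF1.idx 10 (by decide)).trans h10
    have e4 : matOf 4 s1 = matOf 4 s' := by
      ext a b; exact congrFun₂ (hF1.num 4 (by decide)) _ _
    have e3 : matOf 3 s1 = matOf 3 s := by
      ext a b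
      exact congrFun₂ ((hF1.num 3 (by decide)).trans (hF.num 3 (by decide))) _ _
    refine Hoare.ite (fun h => ?_) fun h => ?_
    · have hmem : (⟨j, hj⟩ : Fin m) ∈ s.outcome := by
        by_contra hc
        simp [Test.holds, h13, hr1.idx2, hc] at h
      refine (hoare_extendBlock hr1 (i := ⟨j, hj⟩) e10).mono le_rfl ?_
      rintro s2 ⟨hF2, h2⟩
      rw [e4, e3] at h2
      obtain ⟨t', ht', hK', hv, hx⟩ := hK.extendProj fun a => matOf 3 s a ⟨j, hj⟩
      refine ⟨(hF2.idx 10 (by decide)).trans e10,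
        (hF1.mono (by decide) (by decide)).trans hF2 (by decide) (by decide), t', ?_, ?_, ?_⟩
      · have : (s.outcome.filter fun i : Fin m => (i : ℕ) < j + 1) =
            insert ⟨j, hj⟩ (s.outcome.filter fun i : Fin m => (i : ℕ) < j) := by
          ext i
          simp only [Finset.mem_filter, Finset.mem_insert, Fin.ext_iff]
          constructor
          · rintro ⟨h, h'⟩
            rcases Nat.lt_succ_iff_lt_or_eq.1 h' with h' | h'
            · exact Or.inr ⟨h, h'⟩
            · exact Or.inl h'
          · rintro (h' | ⟨h, h'⟩)
            · exact ⟨by rwa [show i = ⟨j, hj⟩ from Fin.ext h'], by omega⟩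
            · exact ⟨h, by omega⟩
        rw [this, Finset.card_insert_of_notMem (by simp)]
        omega
      · show IsKernel t' (matOf 4 s2)
        rwa [h2]
      · intro i hi hij
        show matOf 4 s2 *ᵥ _ = _
        rw [h2]
        rcases Nat.lt_succ_iff_lt_or_eq.1 hij with h' | h'
        · exact hx _ (hfix i hi h')
        · rw [show i = ⟨j, hj⟩ from Fin.ext h']
          exact hv
    · have hmem : (⟨j, hj⟩ : Fin m) ∉ s.outcome := by
        intro hc
        simp [Test.holds, h13, hr1.idx2, hc] at h
      refine (hoare_skip hr1.idx2 ⟨e10, hF1.mono (by decide) (by decide), t, ?_, ?_, ?_⟩).mono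
        (by omega) fun _ => id
      · exact ht.trans (Finset.card_le_card fun i hi => by
          rw [Finset.mem_filter] at hi ⊢
          exact ⟨hi.1, by omega⟩)
      · show IsKernel t (matOf 4 s1)
        rwa [e4]
      · intro i hi hij
        show matOf 4 s1 *ᵥ _ = _
        rw [e4]
        rcases Nat.lt_succ_iff_lt_or_eq.1 hij with h' | h'
        · exact hfix i hi h'
        · exact absurd hi (by rwa [show i = ⟨j, hj⟩ from Fin.ext h'])
  · rintro s' ⟨hF, t, ht, hK, hfix⟩
    exact ⟨hF, t, ht.trans (Finset.card_filter_le _ _), hK, fun i hi => hfix i hi i.2⟩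

theorem hoare_distanceBlock {R N : ℕ} (hs : Ready R N s) :
    Hoare ψ distanceBlock s (m * (m * 11 + 6) + 6) fun s' =>
      Frame [10, 11] [24, 25, 26] s s' ∧
      s'.num 24 0 0 = (frob (matOf 4 s - matOf 3 s) : ℂ) := by
  set d : ℕ → ℕ → ℂ := fun i j =>
    (s.num 4 i j - s.num 3 i j) * star (s.num 4 i j - s.num 3 i j) with hd
  have h1 : Hoare ψ (block [.numConst (sc 24) 0]) s 2 fun s1 =>
      Frame [] [24] s s1 ∧ s1.num 24 0 0 = 0 := by
    refine hoare_block_frame (by decide) (by decide) fun hF => ⟨hF, ?_⟩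
    simp [List.foldl, Instr.effect, State.set_num, sc, hs.idx2]
  refine (h1.seq (t' := m * (m * 11 + 3 + 3) + 3) ?_).mono (by ring_nf; omega) fun _ => id
  rintro s1 ⟨hF1, h24⟩
  have hr1 := hs.frame hF1.1 (by decide) (by decide)
  have hdsum : ∑ i ∈ Finset.range m, ∑ j ∈ Finset.range m, d i j =
      (frob (matOf 4 s - matOf 3 s) : ℂ) := by
    rw [Finset.sum_range, frob, Complex.ofReal_sum]
    refine Finset.sum_congr rfl fun i _ => ?_
    rw [Finset.sum_range, Complex.ofReal_sum]
    refine Finset.sum_congr rfl fun j _ => ?_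
    rw [Complex.ofReal_pow]
    exact Complex.mul_conj' _
  refine (hoare_forLoop (t := m * 11 + 3) [10, 11] [24, 25, 26]
    (fun i s' => s'.num 24 0 0 = ∑ i ∈ Finset.range i, ∑ j ∈ Finset.range m, d i j)
    hr1.idx0 hr1.idx3 (by decide) (by decide) (by decide) ?_ ?_).mono le_rfl ?_
  · rw [State.setIdx_num, h24, Finset.range_zero, Finset.sum_empty]
  · intro i s2 hi h10 hF2 h24
    have hr2 := hr1.frame hF2.1 (by decide) (by decide)
    refine (hoare_forLoop (t := 8) [11] [24, 25, 26]
      (fun j s' => s'.num 24 0 0 = ∑ i ∈ Finset.range i, ∑ j ∈ Finset.range m, d i j +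
        ∑ j ∈ Finset.range j, d i j)
      hr2.idx0 hr2.idx3 (by decide) (by decide) (by decide) ?_ ?_).mono le_rfl ?_
    · rw [State.setIdx_num, h24, Finset.range_zero, Finset.sum_empty, add_zero]
    · intro j s3 hj h11 hF3 h24
      have hr3 := hr2.frame hF3.1 (by decide) (by decide)
      have e10 := (hF3.idx 10 (by decide)).trans h10
      have hFF := ((hF1.mono (I := [10, 11]) (A := [24, 25, 26]) (by decide) (by decide)).trans
        hF2 (by decide) (by decide)).trans hF3 (by decide) (by decide)
      refine hoare_block_frame (I := []) (A := [24, 25, 26]) (by decide) (by decide) fun hF' =>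
        ⟨(hF'.idx 11 (by decide)).trans h11, hF'.mono (by decide) (by decide), ?_⟩
      rw [State.setIdx_num, Finset.sum_range_succ]
      simp [List.foldl, Instr.effect, State.set_num, State.set_idx, State.get, sc,
        NumOp.eval, hr3.idx2, e10, h11, hFF.num 3 (by decide), hFF.num 4 (by decide), h24, hd]
      ring
    · rintro s3 ⟨hF3, h24⟩
      refine ⟨(hF3.idx 10 (by decide)).trans h10, hF3.mono (by decide) (by decide), ?_⟩
      rw [State.setIdx_num, Finset.sum_range_succ, h24]
  · rintro s2 ⟨hF2, h24⟩
    exact ⟨(hF1.mono (by decide) (by decide)).trans hF2 (by decide) (by decide),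
      h24.trans hdsum⟩

theorem hoare_selectBlock {R N : ℕ} (hs : Ready R N s) {d β : ℝ} (h24 : s.num 24 0 0 = d)
    (h23 : s.num 23 0 0 = β) :
    Hoare ψ selectBlock s (m * (m * 5 + 6) + 7) fun s' =>
      Frame [10, 11] [1, 23] s s' ∧
      ((d < β ∧ s'.num 23 0 0 = d ∧ matOf 1 s' = matOf 4 s) ∨
        (β ≤ d ∧ s'.num 23 0 0 = β ∧ matOf 1 s' = matOf 1 s)) := by
  have hc : (Test.numLt (sc 24) (sc 23)).holds s ↔ d < β := by
    simp only [Test.holds, State.get, sc, hs.idx2, h24, h23, Complex.ofReal_re]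
  refine Hoare.ite (t := m * (m * 5 + 6) + 6) (fun h => ?_) fun h => ?_
  · have h1 : Hoare ψ (block [.numOp .add (sc 23) (sc 24) (sc 27)]) s 2 fun s1 =>
        Frame [] [23] s s1 ∧ s1.num 23 0 0 = d := by
      refine hoare_block_frame (by decide) (by decide) fun hF => ⟨hF, ?_⟩
      simp [List.foldl, Instr.effect, State.set_num, State.get, sc, NumOp.eval, hs.idx2, h24,
        hs.zero]
    refine (h1.seq (t' := m * (m * 5 + 6) + 3) ?_).mono (by omega) fun _ => id
    rintro s1 ⟨hF1, h23'⟩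
    have hr1 := hs.frame hF1.1 (by decide) (by decide)
    refine (hoare_fillMatrix (t := 2) (I := [10, 11]) (A := [1]) (a := 1)
      (fun i j _ => s.num 4 i j) hr1.idx0 hr1.idx3 (by decide) (by decide) (by decide)
      (by decide) (by decide) ?_).mono le_rfl ?_
    · intro a b s' ha hb h10 h11 hF
      have hr := hr1.frame hF.1 (by decide) (by decide)
      refine hoare_block_frame (I := []) (A := [1]) (by decide) (by decide) fun hF' =>
        ⟨(hF'.idx 10 (by decide)).trans h10, (hF'.idx 11 (by decide)).trans h11,
          hF'.mono (by decide) (by decide), fun k l => ?_⟩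
      simp [List.foldl, Instr.effect, State.set_num, State.get, sc, NumOp.eval, h10, h11,
        hr.idx2, hr.zero, hF.num 4 (by decide), hF1.num 4 (by decide)]
    · rintro s' ⟨hF, h'⟩
      refine ⟨(hF1.mono (by decide) (by decide)).trans hF (by decide) (by decide),
        Or.inl ⟨hc.1 h, ?_, Matrix.ext fun a b => h' a b a.2 b.2⟩⟩
      rw [hF.num 23 (by decide), h23']
  · exact (hoare_skip hs.idx2 ⟨Frame.refl _ _ _,
      Or.inr ⟨not_lt.1 (mt hc.2 h), h23, rfl⟩⟩).mono (by omega) fun _ => id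

/-- The best candidate so far: the array `1` holds a projection of rank at most `n`, at squared
distance `β` from the estimate `M`, unless `β` still has the initial value `1`. -/
structure Best (n : ℕ) (M : Matrix (Fin m) (Fin m) ℂ) (β : ℝ) (s : State m) : Prop where
  val : s.num 23 0 0 = β
  le_one : β ≤ 1
  out : β < 1 → ∃ t ≤ n, IsKernel t (matOf 1 s) ∧ β = frob (matOf 1 s - M)

theorem hoare_candidate {R N : ℕ} (hs : Ready R N s) {M : Matrix (Fin m) (Fin m) ℂ} {β : ℝ}
    (hM : matOf 3 s = M) (hβ : Best n M β s) (hcard : s.outcome.card = n) :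
    Hoare ψ candidate s (m * (m * (m * 18 + 45) + 35) + 22) fun s' =>
      Frame [10, 11, 13, 14] [1, 4, 5, 23, 24, 25, 26] s s' ∧ matOf 3 s' = M ∧
      ∃ β' ≤ β, Best n M β' s' ∧ ∃ (t : ℕ) (Q : Matrix (Fin m) (Fin m) ℂ), t ≤ n ∧ IsKernel t Q ∧
        (∀ i ∈ s.outcome, Q *ᵥ (fun a => M a i) = fun a => M a i) ∧ β' ≤ frob (Q - M) := by
  refine ((hoare_clearLoop hs).seq (t' := (m * (m * (m * 18 + 24) + 17) + 3) +
    ((m * (m * 11 + 6) + 6) + (m * (m * 5 + 6) + 7) + 1) + 1) ?_).mono (by ring_nf; omega)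
    fun _ => id
  rintro s1 ⟨hF1, h4⟩
  have hr1 := hs.frame hF1.1 (by decide) (by decide)
  have e3 : matOf 3 s1 = M := by
    rw [← hM]; ext a b; exact congrFun₂ (hF1.num 3 (by decide)) _ _
  refine (hoare_collectLoop hr1 h4).seq ?_
  rintro s2 ⟨hF2, t, ht, hK, hfix⟩
  rw [e3] at hfix
  rw [hF1.outcome, hcard] at ht
  rw [hF1.outcome] at hfix
  have hr2 := hr1.frame hF2.1 (by decide) (by decide)
  refine (hoare_distanceBlock hr2).seq ?_
  rintro s3 ⟨hF3, h24⟩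
  have hF13 := ((hF1.mono (I := [10, 11, 13, 14]) (A := [4, 5, 24, 25, 26]) (by decide)
    (by decide)).trans hF2 (by decide) (by decide)).trans hF3 (by decide) (by decide)
  have hr3 := hr2.frame hF3.1 (by decide) (by decide)
  have e3' : ∀ {s'}, Frame [10, 11, 13, 14] [1, 4, 5, 23, 24, 25, 26] s s' → matOf 3 s' = M := by
    intro s' hF
    rw [← hM]; ext a b; exact congrFun₂ (hF.num 3 (by decide)) _ _
  have e32 : matOf 3 s2 = M := by
    rw [← e3]; ext a b; exact congrFun₂ (hF2.num 3 (by decide)) _ _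
  have e4 : matOf 4 s3 = matOf 4 s2 := by
    ext a b; exact congrFun₂ (hF3.num 4 (by decide)) _ _
  have e1 : matOf 1 s3 = matOf 1 s := by
    ext a b; exact congrFun₂ (hF13.num 1 (by decide)) _ _
  rw [e32] at h24
  refine (hoare_selectBlock hr3 h24
    ((congrFun₂ (hF13.num 23 (by decide)) 0 0).trans hβ.val)).mono le_rfl ?_
  rintro s4 ⟨hF4, h⟩
  have hF := (hF13.mono (I := [10, 11, 13, 14]) (A := [1, 4, 5, 23, 24, 25, 26]) (by decide)
    (by decide)).trans hF4 (by decide) (by decide)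
  refine ⟨hF, e3' hF, ?_⟩
  rcases h with ⟨hlt, hval, hout⟩ | ⟨hle, hval, hout⟩
  · rw [e4] at hout
    refine ⟨_, hlt.le, ⟨hval, hlt.le.trans hβ.le_one, fun _ => ⟨t, ht, ?_, ?_⟩⟩, t, matOf 4 s2,
      ht, hK, hfix, le_rfl⟩
    · rwa [hout]
    · rw [hout]
  · rw [e1] at hout
    refine ⟨β, le_rfl, ⟨hval, hβ.le_one, fun h => ?_⟩, t, matOf 4 s2, ht, hK, hfix, hle⟩
    rw [hout]
    exact hβ.out h

/-! ### The search over all candidates -/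

/-- The invariant of the loop over the candidates. -/
structure SearchInv (n R N : ℕ) (M : Matrix (Fin m) (Fin m) ℂ) (c : ℕ) (s : State m) :
    Prop where
  ready : Ready R N s
  est : matOf 3 s = M
  best : ∃ β, Best n M β s
  net : s.net = 1
  log : LogBound ((m + m) * N + c + 1) (m + m + 1) (s.net :: s.log)

theorem evolve_one_prob (ψ : FockState m n) (S : Occ m n) :
    (ψ.evolve 1).prob S = ψ.prob S := by
  have : (ψ.evolve 1).amp = ψ.amp := by
    classical
    have h : lift n ((1 : Matrix.unitaryGroup (Fin m) ℂ) : Matrix (Fin m) (Fin m) ℂ) = 1 :=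
      lift_one
    show lift n _ *ᵥ ψ.amp = ψ.amp
    rw [h, Matrix.one_mulVec]
  rw [FockState.prob, FockState.prob, this]

open Classical in
/-- If a candidate is, except with probability `q`, within the squared distance `θ` of the
estimate, then the best of the `R` candidates is, except with probability `q ^ R`. -/
theorem triple_search {R N : ℕ} {M : Matrix (Fin m) (Fin m) ℂ} (hs : Ready R N s)
    (hM : matOf 3 s = M) (hlog : LogBound ((m + m) * N) (m + m) s.log) {θ : ℝ} {q : ℝ≥0∞}
    (hθ : θ < 1) (Win : Occ m n → Prop)
    (hWin : ∀ S, Win S → ∀ (t : ℕ) (Q : Matrix (Fin m) (Fin m) ℂ), t ≤ n → IsKernel t Q →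
      (∀ i ∈ S.1, Q *ᵥ (fun a => M a i) = fun a => M a i) → frob (Q - M) ≤ θ)
    (hq : ∑ S, ENNReal.ofReal (ψ.prob S) * (if Win S then 0 else 1) ≤ q) :
    Triple ψ search s (R * (m * (m * (m * 18 + 45) + 35) + 27) + 8) (q ^ R)
      (fun s' => SearchInv n R N M R s')
      (fun s' => if (s'.num 23 0 0).re ≤ θ then 0 else 1) := by
  have h1 : Hoare ψ (.instr .resetNet) s 1 fun s1 => NetFrame [] [] s s1 ∧ s1.net = 1 :=
    Hoare.instr trivial ⟨⟨fun _ _ => rfl, fun _ _ => rfl, rfl, rfl⟩, rfl⟩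
  refine ((h1 _).seq (t' := 2 + (R * (m * (m * (m * 18 + 45) + 35) + 27) + 3) + 1) ?_).mono
    (by omega) le_rfl fun s' h => ⟨h, le_rfl⟩
  rintro s1 ⟨hF1, hnet1⟩
  have hr1 := hs.frame hF1 (by decide) (by decide)
  have h2 : Hoare ψ (block [.numConst (sc 23) 1]) s1 2 fun s2 => Frame [] [23] s1 s2 ∧
      s2.num 23 0 0 = 1 := by
    refine hoare_block_frame (by decide) (by decide) fun hF => ⟨hF, ?_⟩
    simp [List.foldl, Instr.effect, State.set_num, sc, hr1.idx2]
  refine (h2 _).seq ?_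
  rintro s2 ⟨hF2, h23⟩
  have hF12 : NetFrame [] [23] s s2 :=
    (hF1.mono (by decide) (by decide)).trans hF2.1 (by decide) (by decide)
  have hr2 := hs.frame hF12 (by decide) (by decide)
  refine (triple_forLoop (t := m * (m * (m * 18 + 45) + 35) + 24) (H := R)
    (fun c s' => SearchInv n R N M c s')
    -- The conditional bound on failure: nothing once the best score is at most `θ`, which persists
    -- because scores never increase; otherwise all remaining candidates have to fail.
    (fun c s' => if (s'.num 23 0 0).re ≤ θ then 0 else q ^ (R - c))
    (fun c s' h => ⟨h.ready.idx4, h.ready.idx3⟩) ?_ ?_).mono le_rfl ?_ ?_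
  · intro c s' hc h7 hI
    obtain ⟨β, hβ⟩ := hI.best
    set v : Occ m n → ℝ≥0∞ := fun S =>
      if β ≤ θ then 0 else (if Win S then 0 else 1) * q ^ (R - (c + 1)) with hv
    have hmeas : Triple ψ (.instr .measure) s' 1
        (if (s'.num 23 0 0).re ≤ θ then 0 else q ^ (R - c))
        (fun s3 => ∃ S : Occ m n, s3 = s'.observe S)
        (fun s3 => if β ≤ θ then 0 else
          (if ∃ S : Occ m n, s3.outcome = S.1 ∧ Win S then 0 else 1) * q ^ (R - (c + 1))) := by
      refine (Triple.measure (v := v) fun S => ⟨⟨S, rfl⟩, ?_⟩).mono le_rfl ?_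
        fun s' h => ⟨h, le_rfl⟩
      · rw [hv]
        by_cases hw : Win S
        · have : ∃ S' : Occ m n, (s'.observe S).outcome = S'.1 ∧ Win S' := ⟨S, rfl, hw⟩
          simp [this]
        · simp only [hw, if_false]
          split_ifs <;> simp
      · have hval : (s'.num 23 0 0).re = β := by rw [hβ.val, Complex.ofReal_re]
        rw [hval, hI.net]
        by_cases hb : β ≤ θ
        · simp [hv, hb]
        · simp only [hv, hb, if_false, ← mul_assoc, ← Finset.sum_mul, evolve_one_prob]
          have : R - c = R - (c + 1) + 1 := by omega
          rw [this, pow_succ', ]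
          gcongr
    refine (hmeas.seq (t' := m * (m * (m * 18 + 45) + 35) + 22) ?_).mono (by omega) le_rfl
      fun s' h => ⟨h, le_rfl⟩
    rintro s3 ⟨S, rfl⟩
    have hcard : (s'.observe S).outcome.card = n := Set.powersetCard.card_eq S
    refine (hoare_candidate (hI.ready.observe S) (M := M) (β := β) hI.est
      ⟨hβ.val, hβ.le_one, hβ.out⟩ hcard _).mono le_rfl le_rfl ?_
    rintro s4 ⟨hF4, hM4, β', hβ', hbest, t, Q, ht, hQ, hfix, hle⟩
    have hr4 := (hI.ready.observe S).frame hF4.1 (by decide) (by decide)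
    refine ⟨⟨(hF4.idx 7 (by decide)).trans h7, hr4.idx4, hr4.idx3, ?_⟩, ?_⟩
    · have hF : NetFrame [7] [] s4 (s4.setIdx 7 (c + 1)) :=
        (NetFrame.refl _ _ _).setIdx (by decide) _
      refine ⟨hr4.frame hF (by decide) (by decide), hM4, ⟨β', hbest.val, hbest.le_one, hbest.out⟩,
        hF4.net.trans hI.net, ?_⟩
      show LogBound _ _ (s4.net :: s4.log)
      rw [hF4.net, hF4.log]
      exact hI.log.cons
    · have hval : (((s4.setIdx 7 (c + 1)).num 23 0 0)).re = β' := by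
        rw [State.setIdx_num, hbest.val, Complex.ofReal_re]
      rw [hval]
      by_cases hb : β' ≤ θ
      · simp [hb]
      · have hb' : ¬ β ≤ θ := fun h => hb (hβ'.trans h)
        have hw : ¬ ∃ S' : Occ m n, (s'.observe S).outcome = S'.1 ∧ Win S' := by
          rintro ⟨S', hS', hw⟩
          have : S = S' := Subtype.ext hS'
          subst this
          exact hb (hle.trans (hWin S hw t Q ht hQ hfix))
        simp [hb, hb', hw]
  · have hF : NetFrame [7] [] s2 (s2.setIdx 7 0) := (NetFrame.refl _ _ _).setIdx (by decide) _
    refine ⟨hr2.frame hF (by decide) (by decide), ?_, ⟨1, ?_, le_rfl, fun h => absurd h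
      (lt_irrefl _)⟩, hF2.net.trans hnet1, ?_⟩
    · rw [← hM]; ext a b; exact congrFun₂ (hF12.num 3 (by decide)) _ _
    · rw [State.setIdx_num, h23, Complex.ofReal_one]
    · show LogBound _ _ (s2.net :: s2.log)
      rw [hF12.log]
      exact hlog.new _
  · rw [State.setIdx_num, h23, Complex.one_re, if_neg (not_le.2 hθ), Nat.sub_zero]
  · rintro s' ⟨h, -⟩
    refine ⟨h, le_of_eq ?_⟩
    rw [Nat.sub_self, pow_zero]

end
end FermionLearning

namespace FermionLearning
noncomputable section

open scoped ENNReal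

variable {m n : ℕ} {ψ : FockState m n} {s : State m}

/-! ### The algorithm -/

def learner : Program := .seq prelude (.seq sampling (.seq estimation search))

theorem sqDev_eq_sum (K : Matrix (Fin m) (Fin m) ℂ) (N : ℕ) (s : State m) :
    sqDev K (fun _ => N) s =
      ∑ r : Fin m, ∑ i : Fin m, ((s.num 2 r i).re - N * pairProb K 1 r i) ^ 2 +
      ∑ r : Fin m, ∑ i : Fin m, ((s.num 2 (r + m) i).re - N * pairProb K Complex.I r i) ^ 2 := by
  rw [sqDev, Fin.sum_univ_add]
  have h1 : ∀ r : Fin m, roundOf (Fin.castAdd m r) = r ∧ phaseOf (Fin.castAdd m r) = 1 :=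
    fun r => ⟨Fin.ext (by simp [roundOf]), by simp [phaseOf]⟩
  have h2 : ∀ r : Fin m, roundOf (Fin.natAdd m r) = r ∧ phaseOf (Fin.natAdd m r) = Complex.I :=
    fun r => ⟨Fin.ext (by simp [roundOf]), by simp [phaseOf]⟩
  simp only [basisProb, h1, h2, Fin.val_castAdd, Fin.val_natAdd, add_comm m]

theorem frob_estimate_sub_le_sqDev [NeZero m] {K : Matrix (Fin m) (Fin m) ℂ} (hK : Kᴴ = K)
    {N : ℕ} (hN : 0 < N) (s : State m) :
    frob (estimate N (fun r i : Fin m => (s.num 2 r i).re)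
      (fun r i : Fin m => (s.num 2 (r + m) i).re) - K) ≤ sqDev K (fun _ => N) s / N ^ 2 := by
  rw [sqDev_eq_sum]
  exact frob_estimate_sub_le hK hN _ _

open Classical in
/-- The search succeeds, up to a probability of `2 ^ (-R)`, with an accurate estimate `M`. -/
theorem triple_search_of_accurate {R N : ℕ} {M : Matrix (Fin m) (Fin m) ℂ} (hs : Ready R N s)
    (hM : matOf 3 s = M) (hlog : LogBound ((m + m) * N) (m + m) s.log)
    {A : Matrix (Fin m) (Fin n) ℂ} (hA : Aᴴ * A = 1) (hψ : ∀ S, ψ.amp S = slater A S)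
    (hn : 0 < n) {ε : ℝ} (hε : 0 < ε) (hε1 : ε ≤ 1)
    (hacc : 22 * n * frob (M - A * Aᴴ) ≤ ε ^ 2 / 2) :
    Triple ψ search s (R * (m * (m * (m * 18 + 45) + 35) + 27) + 8)
      ((ENNReal.ofReal (1 / 2)) ^ R) (fun s' => SearchInv n R N M R s')
      (fun s' => if IsKernel n s'.output ∧ tvDist (kernelProb (n := n) s'.output) ψ.prob ≤ ε
        then 0 else 1) := by
  set E := M - A * Aᴴ with hE
  have hMe : M = A * Aᴴ + E := by rw [hE]; abel
  have he := frob_nonneg E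
  have hn1 : (1 : ℝ) ≤ n := by exact_mod_cast hn
  have hne : frob E ≤ n * frob E := le_mul_of_one_le_left he hn1
  have hε2 : ε ^ 2 ≤ 1 := pow_le_one₀ hε.le hε1
  have hε0 : 0 < ε ^ 2 := by positivity
  -- A good candidate is within `4 n ‖E‖²` of `K`, hence within `2 · 4n + 2 ≤ 10 n` times `‖E‖²` of
  -- `M`. Conversely, a score of at most `10 n ‖E‖²` gives distance at most `2 · 10n + 2 ≤ 22 n`
  -- times `‖E‖²` from `K`.
  have hθ : 10 * n * frob E < 1 := by nlinarith
  refine (triple_search hs hM hlog hθ (GoodSample A E) ?_ ?_).mono le_rfl le_rfl ?_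
  · intro S hS t Q ht hQ hfix
    rw [hMe] at hfix ⊢
    have h1 := hS.frob_sub_le hA ht hQ hfix
    have h2 := frob_add_le (Q - A * Aᴴ) (-E)
    rw [frob_neg] at h2
    have e : Q - (A * Aᴴ + E) = Q - A * Aᴴ + -E := by abel
    rw [e]
    nlinarith
  · have h := sum_not_goodSample_le hA E
    refine le_trans (le_of_eq ?_) (ENNReal.ofReal_le_ofReal h)
    rw [ENNReal.ofReal_sum_of_nonneg fun S _ => mul_nonneg (sq_nonneg _) (by
      split_ifs <;> norm_num)]
    refine Finset.sum_congr rfl fun S _ => ?_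
    rw [FockState.prob, hψ, ENNReal.ofReal_mul (sq_nonneg _)]
    split_ifs <;> simp
  · intro s' h
    refine ⟨h, ?_⟩
    split_ifs with h1 h2 h2
    · exact le_rfl
    · exact zero_le_one
    · exfalso
      apply h1
      obtain ⟨β, hβ⟩ := h.best
      rw [hβ.val, Complex.ofReal_re] at h2
      obtain ⟨t, ht, hK, hβe⟩ := hβ.out (h2.trans_lt hθ)
      have h3 := frob_add_le (matOf 1 s' - M) E
      have e : matOf 1 s' - M + E = matOf 1 s' - A * Aᴴ := by rw [hE]; abel
      rw [e, ← hβe] at h3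
      exact isKernel_and_tvDist_le hA hψ ht hK hε.le (by nlinarith) (by nlinarith)
    · exact le_rfl

open Classical in
/-- Whatever the estimate, the search ends. -/
theorem triple_search_one {R N : ℕ} {M : Matrix (Fin m) (Fin m) ℂ} (hs : Ready R N s)
    (hM : matOf 3 s = M) (hlog : LogBound ((m + m) * N) (m + m) s.log) (P : State m → Prop) :
    Triple ψ search s (R * (m * (m * (m * 18 + 45) + 35) + 27) + 8) 1
      (fun s' => SearchInv n R N M R s') (fun s' => if P s' then 0 else 1) := by
  -- The threshold `-1` is never reached, so the bound is trivial; only the time and log bounds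
  -- matter, which must hold for bad estimates too.
  refine (triple_search (θ := -1) (q := 1) hs hM hlog (by norm_num) (fun _ => False)
    (fun S hS => hS.elim) ?_).mono le_rfl (one_pow R).le fun s' h => ⟨h, ?_⟩
  · have hnn : ∀ S, 0 ≤ ψ.prob S := fun S => sq_nonneg _
    simp only [if_false, mul_one]
    rw [← ENNReal.ofReal_sum_of_nonneg fun S _ => hnn S,
      show ∑ S, ψ.prob S = 1 from ψ.norm_eq_one, ENNReal.ofReal_one]
  obtain ⟨β, hβ⟩ := h.best
  have : ¬ (s'.num 23 0 0).re ≤ -1 := by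
    rw [hβ.val, Complex.ofReal_re, not_le]
    by_cases h1 : β < 1
    · obtain ⟨t, -, -, hβe⟩ := hβ.out h1
      have := frob_nonneg (matOf 1 s' - M)
      linarith
    · linarith
  rw [if_neg this]
  split_ifs <;> simp

/-- The deviation that the tallies exceed with probability at most `exp (-R)`. -/
theorem potential_start_le {n R : ℕ} {a : ℝ} (ha : 0 < a) {k : ℕ} (hk : (k : ℝ) * (2 * n) = a)
    (η : ℝ≥0∞) :
    potential n a (√(2 * R) / √a) (-(√(2 * R) / √a) * (√a * (3 / 2 + √(2 * R)))) η k 0 ≤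
      ENNReal.ofReal ((1 / 2) ^ R) + η := by
  unfold potential
  gcongr
  have hsa : 0 < √a := Real.sqrt_pos.2 ha
  have hsa2 : √a ^ 2 = a := Real.sq_sqrt ha.le
  have hμ2 : √(2 * R) ^ 2 = 2 * R := Real.sq_sqrt (by positivity)
  set μ := √(2 * R)
  -- With `k · 2n = a` the growth contributes `μ²/2 + μ/2` and the initial value `√a` contributes
  -- `μ`. The threshold subtracts `3μ/2 + μ²`, which leaves `-μ²/2 = -R`.
  have e : -(μ / √a) * (√a * (3 / 2 + μ)) + k * ((μ / √a) ^ 2 * (2 * n) / 2 +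
      (μ / √a) * ((2 * n) / (2 * √a))) + μ / √a * √(a + 0) = -R := by
    have e1 : (k : ℝ) * ((μ / √a) ^ 2 * (2 * n) / 2 + (μ / √a) * ((2 * n) / (2 * √a))) =
        (k * (2 * n)) / √a ^ 2 * (μ ^ 2 / 2 + μ / 2) := by
      field_simp
    rw [e1, hk, hsa2, div_self ha.ne', add_zero, div_mul_cancel₀ _ hsa.ne']
    have e2 : -(μ / √a) * (√a * (3 / 2 + μ)) = -(μ * (3 / 2 + μ)) := by field_simp
    rw [e2]
    linarith
  rw [← Real.exp_add, e, ← Real.rpow_natCast, Real.rpow_def_of_pos (by norm_num : (0:ℝ) < 1 / 2)]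
  rw [Real.exp_le_exp]
  have : -1 ≤ Real.log (1 / 2) := by
    rw [one_div, Real.log_inv]
    have := Real.log_two_lt_d9
    linarith
  nlinarith [Nat.cast_nonneg (α := ℝ) R]

/-- An inaccurate estimate is already charged with failure probability `1`, so nothing need be shown
about the search that follows it. -/
theorem one_le_potential {n : ℕ} {a l τ U : ℝ} (ha : 0 < a) (hl : 0 ≤ l)
    (hU : τ ^ 2 ≤ U) (η : ℝ≥0∞) : 1 ≤ potential n a l (-l * τ) η 0 U := by
  unfold potential
  refine le_add_right ?_
  rw [ENNReal.one_le_ofReal, ← Real.exp_add]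
  refine Real.one_le_exp ?_
  have h1 : τ ≤ √(a + U) := Real.le_sqrt_of_sq_le (by linarith)
  have := mul_le_mul_of_nonneg_left h1 hl
  push_cast
  linarith

/-- The steps that the algorithm takes. -/
def totalTime (m R N : ℕ) : ℕ :=
  5 * R + 5 * N + 40 + (((m + m) * (m * 13 + N * (m * 9 + 8) + 18) + 3) +
    ((m * (m * 32 + 6) + 6) + (R * (m * (m * (m * 18 + 45) + 35) + 27) + 8) + 1) + 1) + 1

open Classical in
theorem triple_learner [NeZero m] {A : Matrix (Fin m) (Fin n) ℂ} (hA : Aᴴ * A = 1)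
    (hψ : ∀ S, ψ.amp S = slater A S) (hn : 0 < n) {ε δ : ℝ} (hε : 0 < ε) (hε1 : ε ≤ 1)
    (hδ1 : δ < 1) {R N : ℕ} (hR : 1 ≤ 2 ^ R * (δ / 2))
    (hR' : ∀ j < R, 2 ^ j * (δ / 2) < 1) (hN : 2000 * R * n ^ 2 * m ≤ N * ε ^ 2)
    (hN' : ∀ j < N, j * ε ^ 2 < 2000 * R * n ^ 2 * m) :
    Triple ψ learner (State.start m n ε δ) (totalTime m R N) (ENNReal.ofReal δ)
      (fun s' => LogBound ((m + m) * N + R) (m + m + 1) s'.log)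
      (fun s' => if IsKernel n s'.output ∧ tvDist (kernelProb (n := n) s'.output) ψ.prob ≤ ε
        then 0 else 1) := by
  have hm : 0 < m := Nat.pos_of_ne_zero (NeZero.ne m)
  have hmR : (0 : ℝ) < m := by exact_mod_cast hm
  have hnR : (0 : ℝ) < n := by exact_mod_cast hn
  have hε0 : 0 < ε ^ 2 := by positivity
  -- As `δ < 1`, at least two doublings are needed. This makes `√(2R) ≥ 2`, which absorbs the `3/2`
  -- in `τ`.
  have hR2 : 2 ≤ R := by
    by_contra hc
    have hc' : R = 0 ∨ R = 1 := by omega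
    rcases hc' with rfl | rfl <;> norm_num at hR <;> linarith
  have hRR : (2 : ℝ) ≤ R := by exact_mod_cast hR2
  have hNR : (0 : ℝ) < N := by
    by_contra hc
    have : (0 : ℝ) < 2000 * R * n ^ 2 * m := by positivity
    nlinarith
  have hN0 : 0 < N := by exact_mod_cast hNR
  set K := A * Aᴴ with hK
  set k := (m + m) * N with hk
  set a : ℝ := k * (2 * n) with ha
  have ha0 : 0 < a := by
    rw [ha, hk]; push_cast; positivity
  set l := √(2 * R) / √a with hl
  have hl0 : 0 ≤ l := by positivity
  set τ := √a * (3 / 2 + √(2 * R)) with hτ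
  set η : ℝ≥0∞ := ENNReal.ofReal (1 / 2) ^ R with hη
  have hhalf : ((1 : ℝ) / 2) ^ R ≤ δ / 2 := by
    rw [one_div, inv_pow, inv_le_iff_one_le_mul₀ (by positivity), mul_comm]
    exact hR
  have hstart : potential n a l (-l * τ) η k 0 ≤ ENNReal.ofReal δ := by
    refine (potential_start_le ha0 ha.symm η).trans ?_
    rw [hη, ← ENNReal.ofReal_pow (by norm_num), ← ENNReal.ofReal_add (by positivity)
      (by positivity)]
    exact ENNReal.ofReal_le_ofReal (by linarith)
  refine ((hoare_prelude hR hR' hN hN' _).seq ?_).mono le_rfl hstart fun s' h => ⟨h, le_rfl⟩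
  rintro s1 ⟨hr1, hF1⟩
  have hnum1 : ∀ b i, s1.num 2 b i = 0 := fun b i => by
    rw [hF1.num 2 (by decide)]; simp [State.start]
  have hB : BasisInv R N 0 s1 := by
    refine ⟨hr1, fun b i => by rw [hnum1, Complex.zero_im], ?_⟩
    rw [hF1.log]
    exact ⟨by simp [State.start], ∅, by simp, fun V hV => by simp [State.start] at hV⟩
  have hdev1 : sqDev K (fun _ => 0) s1 = 0 := by simp [sqDev, hnum1]
  have hsamp := triple_sampling hA hψ ha0 hl0 (-l * τ) η hB
  rw [← hK, hdev1] at hsamp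
  refine hsamp.seq ?_
  intro s2 hB2
  have hest := hoare_estimation (ψ := ψ) hB2.ready hB2.im
    (potential n a l (-l * τ) η 0 (sqDev K (fun _ => N) s2))
  refine hest.seq ?_
  rintro s3 ⟨hF3, hM⟩
  have hr3 := hB2.ready.frame hF3.1 (by decide) (by decide)
  have hlog : LogBound ((m + m) * N) (m + m) s3.log := by rw [hF3.log]; exact hB2.log
  by_cases hU : τ ^ 2 ≤ sqDev K (fun _ => N) s2
  · exact (triple_search_one hr3 hM hlog (fun s' => IsKernel n s'.output ∧
      tvDist (kernelProb (n := n) s'.output) ψ.prob ≤ ε)).mono le_rfl (one_le_potential ha0 hl0 hU η)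
      fun s' h => ⟨h.log.of_cons, le_of_eq (by congr)⟩
  · refine (triple_search_of_accurate hr3 hM hlog hA hψ hn hε hε1 ?_).mono le_rfl ?_
      fun s' h => ⟨h.log.of_cons, le_rfl⟩
    · have hKh : Kᴴ = K := conjTranspose_mul_self_conjTranspose A
      have h1 := frob_estimate_sub_le_sqDev hKh hN0 s2
      have hμ2 : √(2 * R) ^ 2 = 2 * R := Real.sq_sqrt (by positivity)
      have hμ : 2 ≤ √(2 * R) := Real.le_sqrt_of_sq_le (by linarith)
      -- From `√(2R) ≥ 2` follows `3/2 + √(2R) ≤ (7/4) √(2R)`, whose square is `49/8 R`. With `a = 4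
      -- m n N` this gives the constant `24.5` below.
      have hτ2 : τ ^ 2 ≤ a * (49 / 8 * R) := by
        rw [hτ, mul_pow, Real.sq_sqrt ha0.le]
        refine mul_le_mul_of_nonneg_left ?_ ha0.le
        nlinarith
      have h2 : sqDev K (fun _ => N) s2 / N ^ 2 ≤ 24.5 * n * m * R / N := by
        rw [div_le_div_iff₀ (by positivity) hNR]
        have h3 : sqDev K (fun _ => N) s2 ≤ 24.5 * n * m * R * N := by
          refine (not_le.1 hU).le.trans (hτ2.trans (le_of_eq ?_))
          rw [ha, hk]
          push_cast
          ring
        calc sqDev K (fun _ => N) s2 * N ≤ 24.5 * n * m * R * N * N := by gcongr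
          _ = _ := by ring
      -- The requirement is `N ε² ≥ 1078 R n² m`, which the `2000` in the program covers.
      have h4 : 22 * n * (24.5 * n * m * R / N) ≤ ε ^ 2 / 2 := by
        have e : 22 * (n : ℝ) * (24.5 * n * m * R / N) = 539 * (R * n ^ 2 * m) / N := by
          field_simp; ring
        rw [e, div_le_iff₀ hNR]
        have : 0 ≤ (R : ℝ) * n ^ 2 * m := by positivity
        nlinarith
      exact (mul_le_mul_of_nonneg_left (h1.trans h2) (by positivity)).trans h4
    · exact le_add_left le_rfl

/-! ### The resources -/

/-- By minimality `2 ^ (R - 1) < 2 / δ`; take logarithms. -/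
theorem two_pow_bound {δ : ℝ} (hδ : 0 < δ) {R : ℕ}
    (hR' : ∀ j < R, 2 ^ j * (δ / 2) < 1) :
    (R : ℝ) ≤ 4 * max 1 (Real.log (1 / δ)) := by
  rcases Nat.eq_zero_or_pos R with rfl | hR
  · have := le_max_left 1 (Real.log (1 / δ))
    push_cast; linarith
  have h1 := hR' (R - 1) (by omega)
  obtain ⟨k, rfl⟩ : ∃ k, R = k + 1 := ⟨R - 1, by omega⟩
  rw [Nat.add_sub_cancel] at h1
  have h2 : (2 : ℝ) ^ k < 2 * (1 / δ) := by
    rw [mul_one_div, lt_div_iff₀ hδ]; linarith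
  have h3 := Real.log_lt_log (by positivity) h2
  rw [Real.log_pow, Real.log_mul (by norm_num) (by positivity)] at h3
  have h4 := Real.log_two_gt_d9
  have h5 := Real.log_two_lt_d9
  have h6 := le_max_left 1 (Real.log (1 / δ))
  have h7 := le_max_right 1 (Real.log (1 / δ))
  push_cast
  nlinarith [Nat.cast_nonneg (α := ℝ) k]

theorem count_bound {N : ℕ} {e X : ℝ} (he : 0 < e) (hX : 0 ≤ X)
    (hN' : ∀ j < N, j * e < X) : (N : ℝ) ≤ X / e + 1 := by
  rcases Nat.eq_zero_or_pos N with rfl | hN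
  · push_cast; positivity
  have h1 := hN' (N - 1) (by omega)
  rw [Nat.cast_sub hN, Nat.cast_one] at h1
  rw [div_add_one he.ne', le_div_iff₀ he]
  linarith

end
end FermionLearning

/-! ### Resource bounds and conclusion -/

namespace FermionLearning
noncomputable section

open scoped ENNReal

variable {m n : ℕ} {ψ : FockState m n}

theorem LogBound.bases_le {l k : ℕ} {s : State m} (h : LogBound l k s.log) : s.bases ≤ k := by
  obtain ⟨-, B, h2, h3⟩ := h
  refine le_trans ?_ h2
  rw [State.bases, ← Set.ncard_coe_finset]
  exact Set.ncard_le_ncard (fun V hV => h3 V hV) B.finite_toSet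

theorem totalTime_le (hm : 1 ≤ m) (R N : ℕ) :
    totalTime m R N ≤ 39 * (N * m ^ 2) + 130 * (R * m ^ 3) + 200 * m ^ 3 := by
  have a1 : 1 ≤ m ^ 2 := Nat.one_le_pow _ _ hm
  have a2 : 1 ≤ m ^ 3 := Nat.one_le_pow _ _ hm
  have a3 : m ≤ m ^ 3 := Nat.le_self_pow (by norm_num) m
  have a4 : m ^ 2 ≤ m ^ 3 := Nat.pow_le_pow_right hm (by norm_num)
  have a5 : m ≤ m ^ 2 := Nat.le_self_pow (by norm_num) m
  have b1 := Nat.mul_le_mul_left N a1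
  have b2 := Nat.mul_le_mul_left N a5
  have c1 := Nat.mul_le_mul_left R a2
  have c2 := Nat.mul_le_mul_left R a3
  have c3 := Nat.mul_le_mul_left R a4
  unfold totalTime
  linarith

/-- A bound on the expectation of a failure indicator that is infinite off `A`. -/
theorem support_subset_and_le_toOuterMeasure {α : Type*} {μ : PMF α} {A B : α → Prop} {δ : ℝ}
    (hδ : 0 ≤ δ) {F : α → ℝ≥0∞} (hF : ∀ c, ¬ A c → F c = ⊤) (hF' : ∀ c, ¬ B c → 1 ≤ F c)
    (h : expect μ F ≤ ENNReal.ofReal δ) :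
    (∀ c ∈ μ.support, A c) ∧ ENNReal.ofReal (1 - δ) ≤ μ.toOuterMeasure {c | B c} := by
  classical
  constructor
  · intro c hc
    by_contra hA
    have h1 : μ c * F c ≤ expect μ F := ENNReal.le_tsum c
    rw [hF c hA, ENNReal.mul_top ((μ.mem_support_iff c).1 hc)] at h1
    exact absurd (h1.trans h) (not_le.2 ENNReal.ofReal_lt_top)
  · have h1 : 1 ≤ μ.toOuterMeasure {c | B c} + expect μ F := by
      rw [← μ.tsum_coe, PMF.toOuterMeasure_apply, expect, ← ENNReal.tsum_add]
      refine ENNReal.tsum_le_tsum fun c => ?_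
      by_cases hc : B c
      · rw [Set.indicator_of_mem (show c ∈ {c | B c} from hc)]
        exact le_self_add
      · exact le_add_left (le_mul_of_one_le_right' (hF' c hc))
    rw [ENNReal.ofReal_sub _ hδ, ENNReal.ofReal_one, tsub_le_iff_right]
    exact h1.trans (add_le_add_right h _)

theorem learner_correct {A : Matrix (Fin m) (Fin n) ℂ} (hA : Aᴴ * A = 1) (hnm : n ≤ m)
    (hψ : ∀ S, ψ.amp S = slater A S) (hn : 0 < n) {ε δ : ℝ} (hε : 0 < ε) (hε1 : ε ≤ 1)
    (hδ : 0 < δ) (hδ1 : δ < 1) {T : ℕ}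
    (hT : 10 ^ 6 * ((m : ℝ) ^ 3 * n ^ 2 * max 1 (Real.log (1 / δ)) / ε ^ 2) < T + 1) :
    (∀ c ∈ (run ψ T ([learner], State.start m n ε δ)).support, c.1 = [] ∧
      (c.2.copies : ℝ) ≤ 10 ^ 6 * ((m : ℝ) ^ 2 * n ^ 2 * max 1 (Real.log (1 / δ)) / ε ^ 2) ∧
      (c.2.bases : ℝ) ≤ 10 ^ 6 * (m : ℝ)) ∧
    ENNReal.ofReal (1 - δ) ≤ (run ψ T ([learner], State.start m n ε δ)).toOuterMeasure
      {c | IsKernel n c.2.output ∧ tvDist (kernelProb (n := n) c.2.output) ψ.prob ≤ ε} := by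
  classical
  have hm : 1 ≤ m := hn.trans_le hnm
  have : NeZero m := ⟨by omega⟩
  have hm1 : (1 : ℝ) ≤ m := by exact_mod_cast hm
  have hn1 : (1 : ℝ) ≤ n := by exact_mod_cast hn
  have hε0 : 0 < ε ^ 2 := by positivity
  have hε2 : ε ^ 2 ≤ 1 := pow_le_one₀ hε.le hε1
  have eR : ∃ R : ℕ, 1 ≤ 2 ^ R * (δ / 2) := by
    obtain ⟨R, hR⟩ := pow_unbounded_of_one_lt (2 / δ) (one_lt_two (α := ℝ))
    refine ⟨R, ?_⟩
    rw [div_lt_iff₀ hδ] at hR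
    linarith
  obtain ⟨R, hR, hR'⟩ : ∃ R : ℕ, 1 ≤ 2 ^ R * (δ / 2) ∧ ∀ j < R, 2 ^ j * (δ / 2) < 1 :=
    ⟨Nat.find eR, Nat.find_spec eR, fun j hj => not_le.1 (Nat.find_min eR hj)⟩
  have eN : ∃ N : ℕ, 2000 * R * n ^ 2 * m ≤ N * ε ^ 2 := by
    obtain ⟨N, hN⟩ := exists_nat_ge (2000 * R * n ^ 2 * m / ε ^ 2)
    exact ⟨N, (div_le_iff₀ hε0).1 hN⟩
  obtain ⟨N, hN, hN'⟩ : ∃ N : ℕ, 2000 * R * n ^ 2 * m ≤ N * ε ^ 2 ∧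
      ∀ j : ℕ, j < N → j * ε ^ 2 < 2000 * R * n ^ 2 * m :=
    ⟨Nat.find eN, Nat.find_spec eN, fun j hj => not_le.1 (Nat.find_min eN hj)⟩
  have hRL := two_pow_bound hδ hR'
  have hNX := count_bound hε0 (by positivity) hN'
  set L := max 1 (Real.log (1 / δ)) with hL
  have hL1 : 1 ≤ L := le_max_left _ _
  set X := (n : ℝ) ^ 2 * L / ε ^ 2 with hX
  have hXL : L ≤ X := by
    rw [hX, le_div_iff₀ hε0]
    have : 1 ≤ (n : ℝ) ^ 2 := one_le_pow₀ hn1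
    nlinarith
  have hX1 : 1 ≤ X := hL1.trans hXL
  have hXm : 1 ≤ m * X := one_le_mul_of_one_le_of_one_le hm1 hX1
  have hN8 : (N : ℝ) ≤ 8001 * (m * X) := by
    have : 2000 * R * n ^ 2 * m / ε ^ 2 ≤ 8000 * (m * X) := by
      rw [hX, mul_div_assoc', mul_div_assoc', div_le_div_iff_of_pos_right hε0]
      have h0 : (0 : ℝ) ≤ n ^ 2 * m := by positivity
      nlinarith
    linarith
  have e3 : (m : ℝ) ^ 3 * n ^ 2 * L / ε ^ 2 = m ^ 3 * X := by rw [hX]; ring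
  have e2 : (m : ℝ) ^ 2 * n ^ 2 * L / ε ^ 2 = m ^ 2 * X := by rw [hX]; ring
  rw [e3] at hT
  rw [e2]
  have hR4 : (R : ℝ) ≤ 4 * X := by linarith
  -- Everything is a multiple of `m³ X` with `X = n² L / ε² ≥ 1`: the constant is `39 · 8001 + 130 ·
  -- 4 + 200`, which is below `10 ^ 6`.
  have htime : totalTime m R N ≤ T := by
    have h1 : (totalTime m R N : ℝ) ≤
        39 * (N * m ^ 2) + 130 * (R * m ^ 3) + 200 * m ^ 3 := by
      exact_mod_cast totalTime_le hm R N
    have h2 : (N : ℝ) * m ^ 2 ≤ 8001 * (m ^ 3 * X) := by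
      refine (mul_le_mul_of_nonneg_right hN8 (by positivity)).trans (le_of_eq (by ring))
    have h3 : (R : ℝ) * m ^ 3 ≤ 4 * (m ^ 3 * X) :=
      (mul_le_mul_of_nonneg_right hR4 (by positivity)).trans (le_of_eq (by ring))
    have h4 : (m : ℝ) ^ 3 ≤ m ^ 3 * X := le_mul_of_one_le_right (by positivity) hX1
    have h5 : (totalTime m R N : ℝ) < T + 1 := by linarith
    exact Nat.lt_succ_iff.1 (by exact_mod_cast h5)
  -- The value `⊤` off the halted configurations with bounded log turns a finite expectation into a
  -- statement about every configuration in the support; elsewhere `F` is the indicator of failure.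
  set F : Config m → ℝ≥0∞ := fun c =>
    if c.1 = [] ∧ LogBound ((m + m) * N + R) (m + m + 1) c.2.log then
      if IsKernel n c.2.output ∧ tvDist (kernelProb (n := n) c.2.output) ψ.prob ≤ ε
        then 0 else 1
    else ⊤ with hF
  have hsafe : Safe ψ F [learner] (State.start m n ε δ) (0 + totalTime m R N)
      (ENNReal.ofReal δ) := by
    refine triple_learner hA hψ hn hε hε1 hδ1 hR hR' hN hN' F [] 0 fun s' hs' =>
      Safe.halt.mono le_rfl (le_of_eq ?_)
    rw [hF]
    simp only [true_and, if_pos hs']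
  obtain ⟨h1, h2⟩ := support_subset_and_le_toOuterMeasure
    (A := fun c : Config m => c.1 = [] ∧ LogBound ((m + m) * N + R) (m + m + 1) c.2.log)
    (B := fun c : Config m => IsKernel n c.2.output ∧
      tvDist (kernelProb (n := n) c.2.output) ψ.prob ≤ ε) hδ.le
    (fun c hc => if_neg hc) (fun c hc => by
      simp only [if_neg hc]
      split_ifs
      · exact le_rfl
      · exact le_top) (hsafe T (by omega))
  refine ⟨fun c hc => ?_, h2⟩
  obtain ⟨hc1, hc2⟩ := h1 c hc
  refine ⟨hc1, ?_, ?_⟩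
  · have h3 : (c.2.copies : ℝ) ≤ (m + m) * N + R := by exact_mod_cast hc2.1
    have h4 : (m : ℝ) * N ≤ 8001 * (m ^ 2 * X) :=
      (mul_le_mul_of_nonneg_left hN8 (by positivity)).trans (le_of_eq (by ring))
    have h5 : X ≤ m ^ 2 * X :=
      le_mul_of_one_le_left (by linarith) (one_le_pow₀ hm1)
    nlinarith
  · have h3 : (c.2.bases : ℝ) ≤ m + m + 1 := by exact_mod_cast hc2.bases_le
    linarith

end
end FermionLearning

theorem mainTheorem1 :
    ∃ (P : FermionLearning.Program) (C : ℝ), 0 < C ∧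
      ∀ (m n : ℕ), 0 < n →
      ∀ (Ψ : FermionLearning.FockState m n), Ψ.IsNonInteracting →
      ∀ (ε δ : ℝ), 0 < ε → ε ≤ 1 → 0 < δ → δ < 1 →
        let L : ℝ := max 1 (Real.log (1 / δ))
        let T : ℕ := ⌊C * ((m : ℝ) ^ 3 * (n : ℝ) ^ 2 * L / ε ^ 2)⌋₊
        let final : PMF (FermionLearning.Config m) :=
          FermionLearning.run Ψ T ([P], FermionLearning.State.start m n ε δ)
        (∀ c ∈ final.support,
          c.1 = [] ∧
          (c.2.copies : ℝ) ≤ C * ((m : ℝ) ^ 2 * (n : ℝ) ^ 2 * L / ε ^ 2) ∧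
          (c.2.bases : ℝ) ≤ C * (m : ℝ)) ∧
        ENNReal.ofReal (1 - δ) ≤
          final.toOuterMeasure
            {c | FermionLearning.IsKernel n c.2.output ∧
              FermionLearning.tvDist
                (FermionLearning.kernelProb (n := n) c.2.output) Ψ.prob ≤ ε} := by
  refine ⟨FermionLearning.learner, 10 ^ 6, by norm_num, ?_⟩
  intro m n hn Ψ hΨ ε δ hε hε1 hδ hδ1
  obtain ⟨hnm, A, hA, hamp⟩ := hΨ.exists_slater
  exact FermionLearning.learner_correct hA hnm hamp hn hε hε1 hδ hδ1 (Nat.lt_floor_add_one _)
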